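/- **Setting.** Let $m>0$ and let $\eta=\mathrm{diag}(1,-1,-1,-1)$ be the Minkowski metric. Let $\mathcal P$ be the graded commutative complex algebra generated by the even fields $v_\mu$ ($\mu=0,\dots,3$), $\Phi$ and the odd fields $u,\tilde u$, together with all their derivatives $y_{;\mu_1\dots\mu_n}=d_{\mu_1}\cdots d_{\mu_n}y$ (symmetric in the indices), modulo the Klein–Gordon equations $\eta^{\mu\nu}d_\mu d_\nu y+m^2y=0$ and all their derivatives. Let $d_Q$ be the graded derivation of $\mathcal P$ that commutes with the $d_\mu$ and satisfies $$d_Qv_\mu=i\,d_\mu u,\qquad d_Q\Phi=i\,m\,u,\qquad d_Qu=0,\qquad d_Q\tilde u=-i\,(d_\mu v^\mu+m\Phi);$$ then $d_Q^2=0$. Put $Z_Q=\ker d_Q$, $B_Q=d_Q\mathcal P$, $H_Q=Z_Q/B_Q$. Let $$F_{\mu\nu;\rho_1\dots\rho_n}=d_{\rho_1}\cdots d_{\rho_n}(d_\mu v_\nu-d_\nu v_\mu)\ (n\ge0),\qquad g_{\mu_1\dots\mu_n}=\tfrac1n\sum_{l}v_{\mu_l;\mu_1\dots\hat\mu_l\dots\mu_n},\qquad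 \phi_{\mu_1\dots\mu_n}=d_{\mu_1}\cdots d_{\mu_n}\Phi-m\,g_{\mu_1\dots\mu_n}\ (n\ge1).$$ A traceless part of a tensor $T$ is a tensor $T^{(0)}$ all of whose $\eta$-contractions of two indices vanish and such that $T-T^{(0)}$ is a sum, over pairs of indices, of $\eta_{\mu_i\mu_j}$ times a tensor in the remaining indices. The canonical dimension of a monomial is the number of its factors plus the total number of derivatives. Let $\mathcal P^{(n)}\subset\mathcal P$ be the span of the monomials of dimension $\le n$, and put $Z_Q^{(n)}=Z_Q\cap\mathcal P^{(n)}$, $B_Q^{(n)}=d_Q\mathcal P^{(n-1)}$ (with $\mathcal P^{(-1)}=0$), $H_Q^{(n)}=Z_Q^{(n)}/B_Q^{(n)}$. **Theorem.** The tensors $F_{\mu\nu;\rho_1\dots\rho_n}$ ($n\ge 0$) and $\phi_{\mu_1\dots\mu_n}$ ($n\ge 1$) have unique traceless parts $F^{(0)}_{\mu\nu;\rho_1\dots\rho_n}$ and $\phi^{(0)}_{\mu_1\dots\mu_n}$. Let $\mathcal P_0\subset\mathcal P$ be the subalgebra generated by the components of these traceless parts. (1) Every $p\in Z_Q$ is of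 the form $p=p_0+d_Qq$ with $p_0\in\mathcal P_0$, $q\in\mathcal P$. (2) Let $\mathcal A$ be the algebra of polynomials in formal symbols $F^{(0)}_{\mu\nu;\rho_1\dots\rho_n}$ ($n\ge0$) and $\phi^{(0)}_{\mu_1\dots\mu_n}$ ($n\ge1$), modulo the relations saying that $F^{(0)}$ is antisymmetric in $\mu,\nu$, symmetric in the $\rho_l$ and traceless, that $\phi^{(0)}$ is symmetric and traceless, and modulo the Bianchi identities $F^{(0)}_{\mu\nu;\rho\tau_1\dots\tau_n}+F^{(0)}_{\nu\rho;\mu\tau_1\dots\tau_n}+F^{(0)}_{\rho\mu;\nu\tau_1\dots\tau_n}=0$. Sending symbols to the corresponding elements of $\mathcal P$ gives a well-defined injective algebra homomorphism $\Psi:\mathcal A\to\mathcal P$ with image $\mathcal P_0\subset Z_Q$, and $a\mapsto[\Psi(a)]$ is a linear isomorphism $\mathcal A\cong H_Q$. (3) For every $n\ge0$, every $p\in Z_Q^{(n)}$ is of the form $p=p_1+d_Qp_2$ with $p_1\in\mathcal P_0\cap\mathcal P^{(n)}$ (primary cocycle) and $p_2\in\mathcal P^{(n)}$ (so that $d_Qp_2\in\mathcal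 P^{(n)}$ is a secondary cocycle). Moreover, if $\mathcal A^{(n)}\subset\mathcal A$ is the span of the products of symbols of total dimension $\le n$, where $F^{(0)}_{\mu\nu;\rho_1\dots\rho_k}$ has dimension $k+2$ and $\phi^{(0)}_{\mu_1\dots\mu_k}$ has dimension $k+1$, then $(a,[s])\mapsto[\Psi(a)+s]$ is a linear isomorphism $$\mathcal A^{(n)}\oplus\bigl(\mathcal P^{(n)}\cap d_Q\mathcal P^{(n)}\bigr)/d_Q\mathcal P^{(n-1)}\;\cong\;H_Q^{(n)}.$$ -/

import Mathlib

namespace MassiveGauge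

/-! ## Fields and on-shell polynomials -/

/-- The basic fields: the covector field `v_μ`, the scalar `Φ` (Bose statistics), and the ghosts
`u`, `ũ` (Fermi statistics). -/
inductive Fld : Type
  | v (μ : Fin 4)
  | Phi
  | u
  | ut

/-- Grassmann parity (`0` for Bose, `1` for Fermi statistics). -/
def Fld.parity : Fld → ℕ
  | .v _ => 0
  | .Phi => 0
  | .u => 1
  | .ut => 1

/-- Jet variables `y_{α;μ₁…μₙ}`: a field with an (unordered) list of derivative indices. -/
abbrev Jet : Type := Fld × Multiset (Fin 4)

/-- Canonical dimension of a jet variable: one for the field, and one for each derivative. -/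
def Jet.dim (a : Jet) : ℕ := 1 + Multiset.card a.2

/-- The Minkowski metric `diag(1, -1, -1, -1)`. -/
def eta (μ ν : Fin 4) : ℂ := if μ = ν then (if μ = 0 then 1 else -1) else 0

/-- Graded commutativity of the jet variables, and the Klein-Gordon equation of mass `m`
with all its derivatives. -/
inductive Rel (m : ℝ) : FreeAlgebra ℂ Jet → FreeAlgebra ℂ Jet → Prop
  | comm (a b : Jet) :
      Rel m (FreeAlgebra.ι ℂ a * FreeAlgebra.ι ℂ b)
        ((-1 : ℂ) ^ (a.1.parity * b.1.parity) • (FreeAlgebra.ι ℂ b * FreeAlgebra.ι ℂ a))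
  | kleinGordon (α : Fld) (J : Multiset (Fin 4)) :
      Rel m (∑ μ, eta μ μ • FreeAlgebra.ι ℂ ((α, μ ::ₘ μ ::ₘ J) : Jet)
        + (m : ℂ) ^ 2 • FreeAlgebra.ι ℂ ((α, J) : Jet)) 0

/-- The graded commutative algebra `𝒫` of complex polynomials in the fields and their
derivatives, on the mass shell. -/
def Poly (m : ℝ) : Type := RingQuot (Rel m)

noncomputable instance (m : ℝ) : Ring (Poly m) := inferInstanceAs (Ring (RingQuot (Rel m)))

noncomputable instance (m : ℝ) : Algebra ℂ (Poly m) :=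
  inferInstanceAs (Algebra ℂ (RingQuot (Rel m)))

/-- The quotient map onto `𝒫`. -/
noncomputable def Poly.mk (m : ℝ) : FreeAlgebra ℂ Jet →ₐ[ℂ] Poly m :=
  RingQuot.mkAlgHom ℂ (Rel m)

theorem Poly.mk_surjective (m : ℝ) : Function.Surjective (Poly.mk m) :=
  RingQuot.mkAlgHom_surjective ℂ (Rel m)

theorem Poly.mk_rel (m : ℝ) {x y : FreeAlgebra ℂ Jet} (h : Rel m x y) :
    Poly.mk m x = Poly.mk m y :=
  RingQuot.mkAlgHom_rel ℂ h

/-- The algebra homomorphism on `𝒫` with prescribed values on the variables. -/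
noncomputable def Poly.lift {A : Type} [Semiring A] [Algebra ℂ A] (m : ℝ) (f : Jet → A)
    (h : ∀ ⦃x y⦄, Rel m x y → FreeAlgebra.lift ℂ f x = FreeAlgebra.lift ℂ f y) :
    Poly m →ₐ[ℂ] A :=
  RingQuot.liftAlgHom ℂ ⟨FreeAlgebra.lift ℂ f, h⟩

theorem Poly.lift_mk {A : Type} [Semiring A] [Algebra ℂ A] (m : ℝ) (f : Jet → A)
    (h : ∀ ⦃x y⦄, Rel m x y → FreeAlgebra.lift ℂ f x = FreeAlgebra.lift ℂ f y)
    (x : FreeAlgebra ℂ Jet) : Poly.lift m f h (Poly.mk m x) = FreeAlgebra.lift ℂ f x :=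
  RingQuot.liftAlgHom_mkAlgHom_apply ℂ _ _ _

/-- The variable `y_{α;J}` as an element of `𝒫`. -/
noncomputable def jet (m : ℝ) (a : Jet) : Poly m :=
  Poly.mk m (FreeAlgebra.ι ℂ a)

theorem jet_comm (m : ℝ) (a b : Jet) :
    jet m a * jet m b = (-1 : ℂ) ^ (a.1.parity * b.1.parity) • (jet m b * jet m a) := by
  have h := Poly.mk_rel m (Rel.comm a b)
  simpa [jet] using h

theorem jet_kleinGordon (m : ℝ) (α : Fld) (J : Multiset (Fin 4)) :
    ∑ μ, eta μ μ • jet m (α, μ ::ₘ μ ::ₘ J) + (m : ℂ) ^ 2 • jet m (α, J) = 0 := by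
  have h := Poly.mk_rel m (Rel.kleinGordon α J)
  simp only [map_add, map_sum, map_smul, map_zero] at h
  exact h

/-! ## The operator `d_Q` -/

theorem parity_aux (m : ℝ) ⦃x y : FreeAlgebra ℂ Jet⦄ (h : Rel m x y) :
    FreeAlgebra.lift ℂ (fun a : Jet => (-1 : ℂ) ^ a.1.parity • jet m a) x =
      FreeAlgebra.lift ℂ (fun a : Jet => (-1 : ℂ) ^ a.1.parity • jet m a) y := by
  induction h with
  | comm a b =>
    simp only [map_mul, map_smul, FreeAlgebra.lift_ι_apply, smul_mul_assoc, mul_smul_comm]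
    rw [jet_comm m a b]
    simp only [smul_smul]
    congr 1
    ring
  | kleinGordon α J =>
    have h := congrArg (fun z => (-1 : ℂ) ^ α.parity • z) (jet_kleinGordon m α J)
    simp only [smul_add, Finset.smul_sum, smul_zero] at h
    simp only [map_add, map_sum, map_smul, map_zero, FreeAlgebra.lift_ι_apply]
    rw [← h]
    congr 1
    · exact Finset.sum_congr rfl fun μ _ => smul_comm _ _ _
    · exact smul_comm _ _ _

/-- The parity automorphism of `𝒫`: it multiplies an element of ghost parity `ε` by `(-1)^ε`. -/
noncomputable def parityAut (m : ℝ) : Poly m →ₐ[ℂ] Poly m :=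
  Poly.lift m (fun a : Jet => (-1 : ℂ) ^ a.1.parity • jet m a) (parity_aux m)

theorem parityAut_jet (m : ℝ) (a : Jet) :
    parityAut m (jet m a) = (-1 : ℂ) ^ a.1.parity • jet m a := by
  rw [parityAut]
  nth_rewrite 1 [jet]
  rw [Poly.lift_mk, FreeAlgebra.lift_ι_apply]

/-- The variable `C = ∂_μ v^μ + m Φ` and its derivatives. -/
noncomputable def Cjet (m : ℝ) (J : Multiset (Fin 4)) : Poly m :=
  ∑ μ, eta μ μ • jet m (.v μ, μ ::ₘ J) + (m : ℂ) • jet m (.Phi, J)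

/-- `d_Q` on the variables, with `d_Q` commuting with the derivatives:
`d_Q v_μ = i ∂_μ u`, `d_Q Φ = i m u`, `d_Q u = 0`, `d_Q ũ = -i C`. -/
noncomputable def dQGen (m : ℝ) : Jet → Poly m
  | (.v μ, J) => Complex.I • jet m (.u, μ ::ₘ J)
  | (.Phi, J) => (Complex.I * (m : ℂ)) • jet m (.u, J)
  | (.u, _) => 0
  | (.ut, J) => (-Complex.I) • Cjet m J

theorem Cjet_comm (m : ℝ) (J : Multiset (Fin 4)) (b : Jet) :
    Cjet m J * jet m b = jet m b * Cjet m J := by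
  have h1 : ∀ μ K, jet m (.v μ, K) * jet m b = jet m b * jet m (.v μ, K) := fun μ K => by
    simpa [Fld.parity] using jet_comm m (.v μ, K) b
  have h2 : ∀ K, jet m (.Phi, K) * jet m b = jet m b * jet m (.Phi, K) := fun K => by
    simpa [Fld.parity] using jet_comm m (.Phi, K) b
  simp only [Cjet, add_mul, mul_add, Finset.sum_mul, Finset.mul_sum, smul_mul_assoc,
    mul_smul_comm, h1, h2]

theorem dQGen_comm (m : ℝ) (a b : Jet) :
    dQGen m a * jet m b = (-1 : ℂ) ^ ((a.1.parity + 1) * b.1.parity) • (jet m b * dQGen m a) := by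
  obtain ⟨α, J⟩ := a
  have hu : ∀ K, jet m (.u, K) * jet m b = (-1 : ℂ) ^ b.1.parity • (jet m b * jet m (.u, K)) :=
    fun K => by simpa [Fld.parity] using jet_comm m (.u, K) b
  cases α with
  | v μ =>
    simp only [dQGen, Fld.parity, smul_mul_assoc, mul_smul_comm, hu, zero_add, one_mul]
    exact smul_comm _ _ _
  | Phi =>
    simp only [dQGen, Fld.parity, smul_mul_assoc, mul_smul_comm, hu, zero_add, one_mul]
    exact smul_comm _ _ _
  | u => simp [dQGen]
  | ut =>
    have : (-1 : ℂ) ^ ((1 + 1) * b.1.parity) = 1 := by rw [pow_mul]; norm_num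
    change (-Complex.I • Cjet m J) * jet m b =
      (-1 : ℂ) ^ ((1 + 1) * b.1.parity) • (jet m b * (-Complex.I • Cjet m J))
    rw [this, one_smul, smul_mul_assoc, mul_smul_comm, Cjet_comm]

theorem Cjet_kleinGordon (m : ℝ) (J : Multiset (Fin 4)) :
    ∑ μ, eta μ μ • Cjet m (μ ::ₘ μ ::ₘ J) + (m : ℂ) ^ 2 • Cjet m J = 0 := by
  have h1 : ∑ ν, eta ν ν • (∑ μ, eta μ μ • jet m (.v ν, μ ::ₘ μ ::ₘ ν ::ₘ J)
      + (m : ℂ) ^ 2 • jet m (.v ν, ν ::ₘ J)) = 0 :=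
    Finset.sum_eq_zero fun ν _ => by rw [jet_kleinGordon, smul_zero]
  have h2 := congrArg (fun z => (m : ℂ) • z) (jet_kleinGordon m .Phi J)
  simp only [smul_zero] at h2
  rw [← add_zero (0 : Poly m)]
  nth_rewrite 1 [← h1]
  rw [← h2]
  have h3 : ∀ μ ν : Fin 4, ν ::ₘ μ ::ₘ μ ::ₘ J = μ ::ₘ μ ::ₘ ν ::ₘ J := fun μ ν => by
    rw [Multiset.cons_swap ν μ, Multiset.cons_swap ν μ]
  simp only [Cjet, smul_add, Finset.smul_sum, Finset.sum_add_distrib, h3]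
  rw [Finset.sum_comm]
  simp only [smul_smul, mul_comm]
  abel

theorem dQGen_kleinGordon (m : ℝ) (α : Fld) (J : Multiset (Fin 4)) :
    ∑ μ, eta μ μ • dQGen m (α, μ ::ₘ μ ::ₘ J) + (m : ℂ) ^ 2 • dQGen m (α, J) = 0 := by
  have key : ∀ (c : ℂ) (f : Fin 4 → Poly m) (g : Poly m),
      ∑ μ, eta μ μ • f μ + (m : ℂ) ^ 2 • g = 0 →
      ∑ μ, eta μ μ • c • f μ + (m : ℂ) ^ 2 • c • g = 0 := fun c f g h => by
    simp only [smul_comm _ c, ← Finset.smul_sum, ← smul_add, h, smul_zero]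
  cases α with
  | v ν =>
    have h3 : ∀ μ : Fin 4, ν ::ₘ μ ::ₘ μ ::ₘ J = μ ::ₘ μ ::ₘ ν ::ₘ J := fun μ => by
      rw [Multiset.cons_swap ν μ, Multiset.cons_swap ν μ]
    simp only [dQGen, h3]
    exact key _ _ _ (jet_kleinGordon m .u (ν ::ₘ J))
  | Phi => exact key _ _ _ (jet_kleinGordon m .u J)
  | u => simp [dQGen]
  | ut => exact key _ _ _ (Cjet_kleinGordon m J)

/-- `p ↦ [[parity p, d_Q p], [0, p]]` is multiplicative exactly when `d_Q` is a graded
derivation; this is its value on the variables. -/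
noncomputable def dQMat (m : ℝ) (a : Jet) : Matrix (Fin 2) (Fin 2) (Poly m) :=
  !![(-1 : ℂ) ^ a.1.parity • jet m a, dQGen m a; 0, jet m a]

theorem dQMat_rel (m : ℝ) ⦃x y : FreeAlgebra ℂ Jet⦄ (h : Rel m x y) :
    FreeAlgebra.lift ℂ (dQMat m) x = FreeAlgebra.lift ℂ (dQMat m) y := by
  induction h with
  | comm a b =>
    have e1 := jet_comm m a b
    have e2 := dQGen_comm m a b
    have e3 := dQGen_comm m b a
    have e4 : (-1 : ℂ) ^ a.1.parity * (-1 : ℂ) ^ a.1.parity = 1 := by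
      rw [← mul_pow]; norm_num
    have e5 : (-1 : ℂ) ^ (a.1.parity * b.1.parity) * (-1 : ℂ) ^ (a.1.parity * b.1.parity) = 1 := by
      rw [← mul_pow]; norm_num
    simp only [map_mul, map_smul, FreeAlgebra.lift_ι_apply, dQMat, Matrix.mul_fin_two]
    ext i j
    fin_cases i <;> fin_cases j
    · simp [e1, smul_smul]
      congr 1
      ring
    · simp [e2, e3, smul_smul]
      rw [add_comm]
      congr 2
      · ring
      · rw [add_mul, one_mul, pow_add, mul_comm b.1.parity, ← mul_assoc, e5, one_mul]
    · simp
    · simp [e1]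
  | kleinGordon α J =>
    have k1 := jet_kleinGordon m α J
    have k2 := dQGen_kleinGordon m α J
    simp only [map_add, map_sum, map_smul, map_zero, FreeAlgebra.lift_ι_apply, dQMat]
    ext i j
    fin_cases i <;> fin_cases j
    · have k3 := congrArg (fun z => (-1 : ℂ) ^ α.parity • z) k1
      simp only [smul_add, Finset.smul_sum, smul_zero, smul_comm ((-1 : ℂ) ^ α.parity)] at k3
      simpa [Matrix.sum_apply] using k3
    · simpa [Matrix.sum_apply] using k2
    · simp [Matrix.sum_apply]
    · simpa [Matrix.sum_apply] using k1

/-- The algebra homomorphism `p ↦ [[parity p, d_Q p], [0, p]]`. -/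
noncomputable def dQHom (m : ℝ) : Poly m →ₐ[ℂ] Matrix (Fin 2) (Fin 2) (Poly m) :=
  Poly.lift m (dQMat m) (dQMat_rel m)

/-- The operator `d_Q`: the graded derivation of `𝒫` with the values `dQGen` on the variables
(see `dQ_jet` and `dQ_mul`). -/
noncomputable def dQ (m : ℝ) : Poly m →ₗ[ℂ] Poly m :=
  Matrix.entryLinearMap ℂ (Poly m) 0 1 ∘ₗ (dQHom m).toLinearMap

theorem dQHom_jet (m : ℝ) (a : Jet) : dQHom m (jet m a) = dQMat m a := by
  rw [dQHom, jet, Poly.lift_mk, FreeAlgebra.lift_ι_apply]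

theorem dQ_jet (m : ℝ) (a : Jet) : dQ m (jet m a) = dQGen m a := by
  simp [dQ, dQHom_jet, dQMat]

theorem poly_induction (m : ℝ) {P : Poly m → Prop} (h1 : ∀ c : ℂ, P (algebraMap ℂ _ c))
    (hj : ∀ a, P (jet m a)) (hm : ∀ p q, P p → P q → P (p * q))
    (ha : ∀ p q, P p → P q → P (p + q)) (p : Poly m) : P p := by
  obtain ⟨x, rfl⟩ := Poly.mk_surjective m p
  induction x using FreeAlgebra.induction with
  | grade0 r => simpa using h1 r
  | grade1 a => exact hj a
  | mul a b h h' => rw [map_mul]; exact hm _ _ h h'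
  | add a b h h' => rw [map_add]; exact ha _ _ h h'

theorem dQHom_apply (m : ℝ) (p : Poly m) :
    dQHom m p = !![parityAut m p, dQ m p; 0, p] := by
  have h : dQHom m p 0 0 = parityAut m p ∧ dQHom m p 1 0 = 0 ∧ dQHom m p 1 1 = p := by
    induction p using poly_induction m with
    | h1 c => simp [Matrix.algebraMap_matrix_apply]
    | hj a => simp [dQHom_jet, dQMat, parityAut_jet]
    | hm p q hp hq =>
      obtain ⟨h1, h2, h3⟩ := hp
      obtain ⟨k1, k2, k3⟩ := hq
      simp [Matrix.mul_apply, h1, h2, h3, k1, k2, k3]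
    | ha p q hp hq =>
      obtain ⟨h1, h2, h3⟩ := hp
      obtain ⟨k1, k2, k3⟩ := hq
      simp [h1, h2, h3, k1, k2, k3]
  ext i j
  fin_cases i <;> fin_cases j
  · exact h.1
  · rfl
  · exact h.2.1
  · exact h.2.2

theorem dQ_mul (m : ℝ) (p q : Poly m) :
    dQ m (p * q) = dQ m p * q + parityAut m p * dQ m q := by
  have h := congrFun (congrFun (map_mul (dQHom m) p q) 0) 1
  rw [dQHom_apply, dQHom_apply, dQHom_apply, Matrix.mul_fin_two] at h
  simpa [add_comm] using h

theorem dQ_algebraMap (m : ℝ) (c : ℂ) : dQ m (algebraMap ℂ _ c) = 0 := by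
  simp [dQ, Matrix.algebraMap_matrix_apply]

theorem dQ_Cjet (m : ℝ) (J : Multiset (Fin 4)) : dQ m (Cjet m J) = 0 := by
  have h := congrArg (fun z => Complex.I • z) (jet_kleinGordon m .u J)
  simp only [smul_zero, smul_add, Finset.smul_sum] at h
  rw [← h]
  simp only [Cjet, map_add, map_sum, map_smul, dQ_jet, dQGen, smul_smul]
  congr 1
  · exact Finset.sum_congr rfl fun μ _ => by rw [mul_comm]
  · congr 1; ring

theorem dQ_dQ (m : ℝ) (p : Poly m) : dQ m (dQ m p) = 0 := by
  have h : dQ m (dQ m p) = 0 ∧ dQ m (parityAut m p) = - parityAut m (dQ m p) := by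
    induction p using poly_induction m with
    | h1 c => simp [dQ_algebraMap]
    | hj a =>
      have hC : ∀ J, parityAut m (Cjet m J) = Cjet m J := fun J => by
        simp only [Cjet, map_add, map_sum, map_smul, parityAut_jet, Fld.parity, pow_zero, one_smul]
      obtain ⟨α, J⟩ := a
      cases α <;>
        simp [dQ_jet, dQGen, parityAut_jet, Fld.parity, dQ_Cjet, hC]
    | hm p q hp hq =>
      have hpp : ∀ x : Poly m, parityAut m (parityAut m x) = x := fun x => by
        induction x using poly_induction m with
        | h1 c => simp
        | hj a =>
          have : (-1 : ℂ) ^ a.1.parity * (-1 : ℂ) ^ a.1.parity = 1 := by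
            rw [← mul_pow]; norm_num
          simp [parityAut_jet, smul_smul, this]
        | hm p q hp hq => simp [hp, hq]
        | ha p q hp hq => simp [hp, hq]
      constructor
      · simp [dQ_mul, hp.1, hq.1, hp.2]
      · simp only [dQ_mul, map_mul, map_add, hp.2, hq.2, hpp]
        noncomm_ring
    | ha p q hp hq => simp [hp.1, hq.1, hp.2, hq.2, add_comm]
  exact h.1

/-! ## Tensors and their traceless parts -/

/-- A tensor of rank `k` on Minkowski space (lower indices) with entries in `𝒫`. -/
abbrev Tensor (m : ℝ) (k : ℕ) : Type := (Fin k → Fin 4) → Poly m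

/-- All contractions of two indices with the Minkowski metric vanish. -/
def IsTraceless {m : ℝ} {k : ℕ} (T : Tensor m k) : Prop :=
  ∀ (I : Fin k → Fin 4) (i j : Fin k), i ≠ j →
    ∑ μ, eta μ μ • T (Function.update (Function.update I i μ) j μ) = 0

/-- `T₀` is the traceless part of `T`: it is traceless, and `T - T₀` is a sum over pairs `i < j`
of `η_{μ_i μ_j}` times a tensor `S i j` in the remaining indices. -/
def IsTracelessPart {m : ℝ} {k : ℕ} (T T₀ : Tensor m k) : Prop :=
  IsTraceless T₀ ∧
  ∃ S : Fin k → Fin k → Tensor m k,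
    (∀ i j I μ ν, S i j (Function.update (Function.update I i μ) j ν) = S i j I) ∧
    ∀ I, T I - T₀ I =
      ∑ i, ∑ j, if i < j then eta (I i) (I j) • S i j I else 0

open Classical in
/-- The traceless part of a tensor (junk value `0` if there were none). -/
noncomputable def tracelessPart {m : ℝ} {k : ℕ} (T : Tensor m k) : Tensor m k :=
  if h : ∃ T₀, IsTracelessPart T T₀ then h.choose else 0

/-- The list of indices `μ₁, …, μ_k` as a multiset of derivative indices. -/
def idx {k : ℕ} (I : Fin k → Fin 4) : Multiset (Fin 4) := Finset.univ.val.map I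

/-- The tensor `F_{μν;ρ₁…ρₙ}`, where `F_{μν} = ∂_μ v_ν - ∂_ν v_μ`. -/
noncomputable def fieldStrength (m : ℝ) (n : ℕ) : Tensor m (n + 2) := fun I =>
  let ρ := idx fun l : Fin n => I l.succ.succ
  jet m (.v (I 1), I 0 ::ₘ ρ) - jet m (.v (I 0), I 1 ::ₘ ρ)

/-- `g_{μ₁…μₙ} = (1/n) ∑_l v_{μ_l;μ₁…μ̂_l…μₙ}`, the symmetric part of `v_{μ₁;μ₂…μₙ}`. -/
noncomputable def gTensor (m : ℝ) (n : ℕ) : Tensor m n := fun I =>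
  (n : ℂ)⁻¹ • ∑ l, jet m (.v (I l), (Finset.univ.erase l).val.map I)

/-- `φ_{μ₁…μₙ} = ∂_{μ₁}…∂_{μₙ} Φ - m g_{μ₁…μₙ}`, used for `n ≥ 1`. -/
noncomputable def phiTensor (m : ℝ) (n : ℕ) : Tensor m n := fun I =>
  jet m (.Phi, idx I) - (m : ℂ) • gTensor m n I

/-! ## The space `𝒫₀` and its formal counterpart -/

/-- Symbols for the components of `F⁽⁰⁾_{μν;ρ₁…ρₙ}` (`n ≥ 0`) and of `φ⁽⁰⁾_{μ₁…μₙ₊₁}`. -/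
inductive Sym0 : Type
  | F (n : ℕ) (I : Fin (n + 2) → Fin 4)
  | phi (n : ℕ) (I : Fin (n + 1) → Fin 4)

/-- Canonical dimension of the symbols; both kinds contain `n + 1` derivatives of a field. -/
def Sym0.dim : Sym0 → ℕ
  | .F n _ => n + 2
  | .phi n _ => n + 2

/-- The element of `𝒫` denoted by a symbol. -/
noncomputable def Sym0.val (m : ℝ) : Sym0 → Poly m
  | .F n I => tracelessPart (fieldStrength m n) I
  | .phi n I => tracelessPart (phiTensor m (n + 1)) I

/-- `𝒫₀`: the polynomials in the components of the tensors `F⁽⁰⁾` and `φ⁽⁰⁾`. -/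
noncomputable def P0 (m : ℝ) : Subalgebra ℂ (Poly m) :=
  Algebra.adjoin ℂ (Set.range (Sym0.val m))

/-- The index symmetries and tracelessness which make the symbols components of traceless
tensors: antisymmetry in `μ, ν`, symmetry in the `ρ`'s, symmetry of `φ`, vanishing traces. -/
inductive TensorRel : MvPolynomial Sym0 ℂ → Prop
  | F_antisymm (n : ℕ) (I : Fin (n + 2) → Fin 4) :
      TensorRel (MvPolynomial.X (.F n I) + MvPolynomial.X (.F n (I ∘ Equiv.swap 0 1)))
  | F_symm (n : ℕ) (I : Fin (n + 2) → Fin 4) (i j : Fin n) :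
      TensorRel (MvPolynomial.X (.F n I) -
        MvPolynomial.X (.F n (I ∘ Equiv.swap i.succ.succ j.succ.succ)))
  | F_trace (n : ℕ) (I : Fin (n + 2) → Fin 4) (i j : Fin (n + 2)) (h : i ≠ j) :
      TensorRel (∑ μ, eta μ μ •
        MvPolynomial.X (.F n (Function.update (Function.update I i μ) j μ)))
  | phi_symm (n : ℕ) (I : Fin (n + 1) → Fin 4) (i j : Fin (n + 1)) :
      TensorRel (MvPolynomial.X (.phi n I) - MvPolynomial.X (.phi n (I ∘ Equiv.swap i j)))
  | phi_trace (n : ℕ) (I : Fin (n + 1) → Fin 4) (i j : Fin (n + 1)) (h : i ≠ j) :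
      TensorRel (∑ μ, eta μ μ •
        MvPolynomial.X (.phi n (Function.update (Function.update I i μ) j μ)))

/-- The Bianchi identities `F_{μν;ρτ} + F_{νρ;μτ} + F_{ρμ;ντ} = 0`, with `τ = τ₁…τₙ`. -/
inductive BianchiRel : MvPolynomial Sym0 ℂ → Prop
  | mk (n : ℕ) (μ ν ρ : Fin 4) (τ : Fin n → Fin 4) :
      BianchiRel
        (MvPolynomial.X (.F (n + 1) (Matrix.vecCons μ (Matrix.vecCons ν (Matrix.vecCons ρ τ)))) +
        MvPolynomial.X (.F (n + 1) (Matrix.vecCons ν (Matrix.vecCons ρ (Matrix.vecCons μ τ)))) +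
        MvPolynomial.X (.F (n + 1) (Matrix.vecCons ρ (Matrix.vecCons μ (Matrix.vecCons ν τ)))))

/-- The ideal generated by the tensor relations and the Bianchi identities. -/
noncomputable def bianchiIdeal : Ideal (MvPolynomial Sym0 ℂ) :=
  Ideal.span {f | TensorRel f} ⊔ Ideal.span {f | BianchiRel f}

/-- Polynomials in traceless tensors `F⁽⁰⁾`, `φ⁽⁰⁾`, modulo the Bianchi identities. -/
abbrev FormalP0 : Type := MvPolynomial Sym0 ℂ ⧸ bianchiIdeal

/-- The class of a symbol. -/
noncomputable def Sym0.cls (s : Sym0) : FormalP0 :=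
  Ideal.Quotient.mk bianchiIdeal (MvPolynomial.X s)

/-! ## Filtration by canonical dimension, and the cohomology spaces -/

/-- The span of the monomials of total weight `≤ n` in generators `gen` with weights `w`. -/
def weightLE {G A : Type} [Semiring A] [Algebra ℂ A] (gen : G → A) (w : G → ℕ) (n : ℤ) :
    Submodule ℂ A :=
  Submodule.span ℂ {a | ∃ L : List G, ((L.map w).sum : ℤ) ≤ n ∧ a = (L.map gen).prod}

/-- `𝒫⁽ⁿ⁾`: the polynomials of canonical dimension `≤ n`. -/
noncomputable def PolyLE (m : ℝ) (n : ℤ) : Submodule ℂ (Poly m) := weightLE (jet m) Jet.dim n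

/-- Formal polynomials of canonical dimension `≤ n`, modulo the Bianchi identities. -/
noncomputable def FormalP0LE (n : ℤ) : Submodule ℂ FormalP0 := weightLE Sym0.cls Sym0.dim n

/-- The cocycles `Z_Q`. -/
noncomputable def ZQ (m : ℝ) : Submodule ℂ (Poly m) := LinearMap.ker (dQ m)

/-- The coboundaries `B_Q`. -/
noncomputable def BQ (m : ℝ) : Submodule ℂ (Poly m) := LinearMap.range (dQ m)

/-- The cohomology space `H_Q = Z_Q / B_Q`. -/
abbrev HQ (m : ℝ) : Type := ZQ m ⧸ (BQ m).submoduleOf (ZQ m)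

/-- The cocycles `Z_Q⁽ⁿ⁾` in `𝒫⁽ⁿ⁾`. -/
noncomputable def ZQLE (m : ℝ) (n : ℤ) : Submodule ℂ (Poly m) := ZQ m ⊓ PolyLE m n

/-- The coboundaries `B_Q⁽ⁿ⁾ = d_Q 𝒫⁽ⁿ⁻¹⁾`. -/
noncomputable def BQLE (m : ℝ) (n : ℤ) : Submodule ℂ (Poly m) := (PolyLE m (n - 1)).map (dQ m)

/-- The cohomology space `H_Q⁽ⁿ⁾ = Z_Q⁽ⁿ⁾ / B_Q⁽ⁿ⁾`. -/
abbrev HQLE (m : ℝ) (n : ℤ) : Type := ZQLE m n ⧸ (BQLE m n).submoduleOf (ZQLE m n)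

/-- The secondary cocycles: the elements of `𝒫⁽ⁿ⁾` of the form `d_Q p₂` with `p₂ ∈ 𝒫⁽ⁿ⁾`. -/
noncomputable def SQLE (m : ℝ) (n : ℤ) : Submodule ℂ (Poly m) :=
  PolyLE m n ⊓ (PolyLE m n).map (dQ m)

end MassiveGauge

/-!
The contraction of two indices and the multiplication with the metric in them are adjoint for the
standard Hermitian product on tensors of a given rank, because `η` is real and `η² = 1`. So the
traceless tensors are the orthogonal complement of the multiples of the metric.

The algebra `𝒫` is the graded polynomial algebra on the space of jets modulo the Klein–Gordon
equation, on which `d_Q` is linear. This space is also spanned by the components of `F⁽⁰⁾` and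
`φ⁽⁰⁾`, on which `d_Q` vanishes, and by pairs of vectors one of which is mapped to the other: the
derivatives of `ũ` are mapped to those of `∂_μ v^μ + m Φ`, and certain symmetrized derivatives of
`v` and `Φ` to those of `u`. An odd derivation `h` inverts `d_Q` on these pairs, and
`D = d_Q h + h d_Q` counts the number of factors from the pairs. On cocycles `D` is `d_Q h`, so
`∏ (1 - D / j)`, taken over `1 ≤ j ≤ n`, is the identity modulo coboundaries, while it removes all
the monomials of dimension at most `n` which are not polynomials in `F⁽⁰⁾` and `φ⁽⁰⁾`.

For the injectivity, an algebra homomorphism from `𝒫` to the formal algebra is constructed which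
annihilates the image of `d_Q` and recovers every symbol from its value in `𝒫` up to symbols of
lower order. Composed with `Ψ` it is the identity up to lower order terms, hence injective.
-/

namespace MassiveGauge

/-! ## Traceless parts -/

section Metric

theorem eta_of_ne {μ ν : Fin 4} (h : μ ≠ ν) : eta μ ν = 0 := if_neg h

theorem eta_comm (μ ν : Fin 4) : eta μ ν = eta ν μ := by
  rcases eq_or_ne μ ν with rfl | h
  · rfl
  · rw [eta_of_ne h, eta_of_ne h.symm]

theorem conj_eta (μ ν : Fin 4) : starRingEnd ℂ (eta μ ν) = eta μ ν := by
  unfold eta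
  split_ifs <;> simp

theorem sum_eta_smul {M : Type*} [AddCommMonoid M] [Module ℂ M] (μ : Fin 4) (f : Fin 4 → M) :
    ∑ ν, eta μ ν • f ν = eta μ μ • f μ :=
  Finset.sum_eq_single μ (fun ν _ h => by rw [eta_of_ne h.symm, zero_smul]) (by simp)

theorem sum_eta_mul_smul {M : Type*} [AddCommMonoid M] [Module ℂ M] (μ : Fin 4) (f : Fin 4 → M) :
    ∑ κ, (eta κ κ * eta κ μ) • f κ = f μ := by
  rw [Fintype.sum_eq_single μ fun κ h => by rw [eta_of_ne h, mul_zero, zero_smul]]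
  by_cases h : μ = 0 <;> simp [eta, h]

theorem sum_eta_mul_self_smul {M : Type*} [AddCommMonoid M] [Module ℂ M] (x : M) :
    ∑ κ, (eta κ κ * eta κ κ) • x = (4 : ℂ) • x := by
  rw [← Finset.sum_smul]
  congr 1
  norm_num [eta, Fin.sum_univ_succ]

theorem sum_eta_self_smul {M : Type*} [AddCommGroup M] [Module ℂ M] (f : Fin 4 → M) :
    ∑ κ, eta κ κ • f κ = f 0 - ∑ i : Fin 3, f i.succ := by
  simp [eta, Fin.sum_univ_succ (n := 3), Fin.succ_ne_zero, sub_eq_add_neg]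

end Metric

/-- Tensors of rank `k` on Minkowski space with entries in a complex vector space. -/
abbrev TensorIn (M : Type*) (k : ℕ) : Type _ := (Fin k → Fin 4) → M

section Contraction

variable {M N : Type*} [AddCommGroup M] [Module ℂ M] [AddCommGroup N] [Module ℂ N] {k : ℕ}

/-- The contraction of the indices `i` and `j`. The result is again regarded as a tensor of rank
`k`, which does not depend on these two indices. -/
def contract (i j : Fin k) : TensorIn M k →ₗ[ℂ] TensorIn M k where
  toFun T I := ∑ μ, eta μ μ • T (Function.update (Function.update I i μ) j μ)
  map_add' T T' := by
    funext I
    simp only [Pi.add_apply, smul_add, Finset.sum_add_distrib]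
  map_smul' c T := by
    funext I
    simp only [Pi.smul_apply, smul_comm _ c, Finset.smul_sum, RingHom.id_apply]

/-- The transpose of `contract i j`. On tensors which do not depend on the indices `i` and `j` it
is `16` times the multiplication with the metric. -/
def contractTranspose (i j : Fin k) : TensorIn M k →ₗ[ℂ] TensorIn M k where
  toFun S I := eta (I i) (I j) • ∑ μ, ∑ ν, S (Function.update (Function.update I i μ) j ν)
  map_add' S S' := by
    funext I
    simp only [Pi.add_apply, smul_add, Finset.sum_add_distrib]
  map_smul' c S := by
    funext I
    simp only [Pi.smul_apply, Finset.smul_sum, smul_comm _ c, RingHom.id_apply]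

theorem contract_apply (i j : Fin k) (T : TensorIn M k) (I : Fin k → Fin 4) :
    contract i j T I = ∑ μ, eta μ μ • T (Function.update (Function.update I i μ) j μ) := rfl

theorem contractTranspose_apply (i j : Fin k) (S : TensorIn M k) (I : Fin k → Fin 4) :
    contractTranspose i j S I =
      eta (I i) (I j) • ∑ μ, ∑ ν, S (Function.update (Function.update I i μ) j ν) := rfl

theorem contract_comm {i j : Fin k} (h : i ≠ j) (T : TensorIn M k) :
    contract i j T = contract j i T := by
  funext I
  simp only [contract_apply, Function.update_comm h]

theorem contractTranspose_comm {i j : Fin k} (h : i ≠ j) (S : TensorIn M k) :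
    contractTranspose i j S = contractTranspose j i S := by
  funext I
  rw [contractTranspose_apply, contractTranspose_apply, eta_comm, Finset.sum_comm]
  simp only [Function.update_comm h]

theorem contractTranspose_of_forall_update {i j : Fin k} {S : TensorIn M k}
    (hS : ∀ I μ ν, S (Function.update (Function.update I i μ) j ν) = S I) (I : Fin k → Fin 4) :
    contractTranspose i j S I = (16 : ℂ) • eta (I i) (I j) • S I := by
  simp only [contractTranspose_apply, hS, Finset.sum_const, Finset.card_univ, Fintype.card_fin]
  module

theorem contract_map (f : M →ₗ[ℂ] N) (i j : Fin k) (T : TensorIn M k) :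
    contract i j (fun I => f (T I)) = fun I => f (contract i j T I) := by
  funext I
  simp only [contract_apply, map_sum, map_smul]

theorem contractTranspose_map (f : M →ₗ[ℂ] N) (i j : Fin k) (S : TensorIn M k) :
    contractTranspose i j (fun I => f (S I)) = fun I => f (contractTranspose i j S I) := by
  funext I
  simp only [contractTranspose_apply, map_sum, map_smul]

theorem update_update_comp_perm (I : Fin k → Fin 4) (σ : Equiv.Perm (Fin k)) (i j : Fin k)
    (μ ν : Fin 4) : Function.update (Function.update I i μ) j ν ∘ σ =
      Function.update (Function.update (I ∘ σ) (σ.symm i) μ) (σ.symm j) ν := by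
  funext l
  simp only [Function.comp_apply, Function.update_apply, Equiv.eq_symm_apply]

theorem contract_comp_perm (σ : Equiv.Perm (Fin k)) (i j : Fin k) (T : TensorIn M k) :
    contract i j (fun I => T (I ∘ σ)) = fun I => contract (σ.symm i) (σ.symm j) T (I ∘ σ) := by
  funext I
  simp only [contract_apply, update_update_comp_perm]

theorem contractTranspose_comp_perm (σ : Equiv.Perm (Fin k)) (i j : Fin k) (S : TensorIn M k) :
    contractTranspose i j (fun I => S (I ∘ σ)) =
      fun I => contractTranspose (σ.symm i) (σ.symm j) S (I ∘ σ) := by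
  funext I
  simp only [contractTranspose_apply, update_update_comp_perm, Function.comp_apply,
    Equiv.apply_symm_apply]

omit [Module ℂ M] in
theorem sum_update_swap (i : Fin k) (G : (Fin k → Fin 4) → (Fin k → Fin 4) → M) :
    ∑ I, ∑ μ, G I (Function.update I i μ) = ∑ I, ∑ μ, G (Function.update I i μ) I := by
  rw [← Fintype.sum_prod_type', ← Fintype.sum_prod_type']
  refine Finset.sum_nbij' (fun p => (Function.update p.1 i p.2, p.1 i))
    (fun p => (Function.update p.1 i p.2, p.1 i)) ?_ ?_ ?_ ?_ ?_ <;> simp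

theorem sum_contractTranspose_mul {i j : Fin k} (hij : i ≠ j) (S T : TensorIn ℂ k) :
    ∑ I, contractTranspose i j S I * T I = ∑ I, S I * contract i j T I := by
  have hcontract : ∀ I, S I * contract i j T I = ∑ μ, ∑ ν, S I *
      (eta (Function.update (Function.update I i μ) j ν i)
        (Function.update (Function.update I i μ) j ν j) *
        T (Function.update (Function.update I i μ) j ν)) := fun I => by
    simp only [Function.update_self, Function.update_of_ne hij, ← smul_eq_mul (eta _ _),
      ← Finset.mul_sum, contract_apply, sum_eta_smul]
  simp only [hcontract]
  rw [sum_update_swap i fun I L => ∑ ν, S I * (eta (Function.update L j ν i)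
    (Function.update L j ν j) * T (Function.update L j ν)), Finset.sum_comm]
  have hswap := fun μ => sum_update_swap j fun I L =>
    S (Function.update I i μ) * (eta (L i) (L j) * T L)
  simp only [hswap]
  rw [Finset.sum_comm]
  refine Finset.sum_congr rfl fun I _ => ?_
  simp only [contractTranspose_apply, smul_eq_mul, Finset.mul_sum, Finset.sum_mul,
    Function.update_comm hij]
  exact Finset.sum_congr rfl fun μ _ => Finset.sum_congr rfl fun ν _ => by ring

end Contraction

section TracelessProjection

variable {M N : Type*} [AddCommGroup M] [Module ℂ M] [AddCommGroup N] [Module ℂ N] {k : ℕ}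

variable (M k) in
/-- The tensors all of whose contractions vanish. -/
def tracelessTensors : Submodule ℂ (TensorIn M k) :=
  ⨅ p : {p : Fin k × Fin k // p.1 < p.2}, LinearMap.ker (contract p.1.1 p.1.2)

variable (M k) in
/-- The sums over pairs of indices of the metric in these two indices times a tensor in the
remaining ones. -/
def metricTensors : Submodule ℂ (TensorIn M k) :=
  ⨆ p : {p : Fin k × Fin k // p.1 < p.2}, LinearMap.range (contractTranspose p.1.1 p.1.2)

theorem mem_tracelessTensors {T : TensorIn M k} :
    T ∈ tracelessTensors M k ↔ ∀ i j, i ≠ j → contract i j T = 0 := by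
  simp only [tracelessTensors, Submodule.mem_iInf, LinearMap.mem_ker, Subtype.forall, Prod.forall]
  refine ⟨fun h i j hij => ?_, fun h i j hij => h i j hij.ne⟩
  rcases lt_or_gt_of_ne hij with hlt | hgt
  · exact h i j hlt
  · rw [contract_comm hij, h j i hgt]

theorem contractTranspose_mem_metricTensors {i j : Fin k} (hij : i ≠ j) (S : TensorIn M k) :
    contractTranspose i j S ∈ metricTensors M k := by
  rcases lt_or_gt_of_ne hij with hlt | hgt
  · exact Submodule.mem_iSup_of_mem ⟨(i, j), hlt⟩ ⟨S, rfl⟩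
  · exact Submodule.mem_iSup_of_mem ⟨(j, i), hgt⟩ ⟨S, (contractTranspose_comm hij S).symm⟩

theorem metricTensors_le {Y : Submodule ℂ (TensorIn M k)}
    (h : ∀ i j, i ≠ j → ∀ S, contractTranspose i j S ∈ Y) : metricTensors M k ≤ Y :=
  iSup_le fun p => by
    rintro _ ⟨S, rfl⟩
    exact h _ _ p.2.ne S

theorem map_mem_tracelessTensors {T : TensorIn M k} (hT : T ∈ tracelessTensors M k)
    (f : M →ₗ[ℂ] N) : (fun I => f (T I)) ∈ tracelessTensors N k := by
  rw [mem_tracelessTensors] at hT ⊢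
  intro i j hij
  rw [contract_map, hT i j hij]
  exact funext fun _ => map_zero f

theorem map_mem_metricTensors {T : TensorIn M k} (hT : T ∈ metricTensors M k) (f : M →ₗ[ℂ] N) :
    (fun I => f (T I)) ∈ metricTensors N k := by
  suffices h : metricTensors M k ≤ (metricTensors N k).comap (f.compLeft _) from h hT
  refine metricTensors_le fun i j hij S => ?_
  rw [Submodule.mem_comap, show f.compLeft _ (contractTranspose i j S) = _ from
    (contractTranspose_map f i j S).symm]
  exact contractTranspose_mem_metricTensors hij _

theorem comp_perm_mem_tracelessTensors {T : TensorIn M k} (hT : T ∈ tracelessTensors M k)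
    (σ : Equiv.Perm (Fin k)) : (fun I => T (I ∘ σ)) ∈ tracelessTensors M k := by
  rw [mem_tracelessTensors] at hT ⊢
  intro i j hij
  rw [contract_comp_perm, hT _ _ (σ.symm.injective.ne hij)]
  rfl

theorem comp_perm_mem_metricTensors {T : TensorIn M k} (hT : T ∈ metricTensors M k)
    (σ : Equiv.Perm (Fin k)) : (fun I => T (I ∘ σ)) ∈ metricTensors M k := by
  suffices h : metricTensors M k ≤ (metricTensors M k).comap (LinearMap.funLeft ℂ M (· ∘ σ)) from
    h hT
  refine metricTensors_le fun i j hij S => ?_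
  have hperm := contractTranspose_comp_perm σ (σ i) (σ j) S
  simp only [Equiv.symm_apply_apply] at hperm
  rw [Submodule.mem_comap, show LinearMap.funLeft ℂ M (· ∘ σ) (contractTranspose i j S) = _ from
    hperm.symm]
  exact contractTranspose_mem_metricTensors (σ.injective.ne hij) _

theorem conj_contractTranspose (i j : Fin k) (S : TensorIn ℂ k) :
    contractTranspose i j (star S) = star (contractTranspose i j S) := by
  funext I
  simp [contractTranspose_apply, conj_eta]

theorem inner_contractTranspose {i j : Fin k} (hij : i ≠ j) (S T : TensorIn ℂ k) :
    inner ℂ (WithLp.toLp 2 (contractTranspose i j S)) (WithLp.toLp 2 T) =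
      inner ℂ (WithLp.toLp 2 S) (WithLp.toLp 2 (contract i j T)) := by
  have h := sum_contractTranspose_mul hij (star S) T
  rw [conj_contractTranspose] at h
  simp only [PiLp.inner_apply, RCLike.inner_apply']
  exact h

theorem orthogonal_metricTensors :
    ((metricTensors ℂ k).map (WithLp.linearEquiv 2 ℂ (TensorIn ℂ k)).symm.toLinearMap)ᗮ =
      (tracelessTensors ℂ k).map (WithLp.linearEquiv 2 ℂ (TensorIn ℂ k)).symm.toLinearMap := by
  ext x
  obtain ⟨T, rfl⟩ := WithLp.toLp_surjective 2 x
  have htraceless : WithLp.toLp 2 T ∈ (tracelessTensors ℂ k).map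
      (WithLp.linearEquiv 2 ℂ (TensorIn ℂ k)).symm.toLinearMap ↔ T ∈ tracelessTensors ℂ k :=
    (Submodule.mem_map_equiv _).trans Iff.rfl
  rw [htraceless, Submodule.mem_orthogonal']
  refine ⟨fun h => mem_tracelessTensors.2 fun i j hij => ?_, fun hT => ?_⟩
  · have hinner := h _ ⟨_, contractTranspose_mem_metricTensors hij (contract i j T), rfl⟩
    rw [inner_eq_zero_symm] at hinner
    have hzero := (inner_contractTranspose hij (contract i j T) T).symm.trans hinner
    exact congrArg WithLp.ofLp (inner_self_eq_zero.1 hzero)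
  · suffices h : metricTensors ℂ k ≤ LinearMap.ker (innerₛₗ ℂ (WithLp.toLp 2 T) ∘ₗ
        (WithLp.linearEquiv 2 ℂ (TensorIn ℂ k)).symm.toLinearMap) by
      rintro _ ⟨D, hD, rfl⟩
      exact h hD
    refine metricTensors_le fun i j hij S => ?_
    change inner ℂ (WithLp.toLp 2 T) (WithLp.toLp 2 (contractTranspose i j S)) = 0
    rw [inner_eq_zero_symm]
    have hinner := inner_contractTranspose hij S T
    rw [mem_tracelessTensors.1 hT i j hij] at hinner
    exact hinner.trans (inner_zero_right _)

theorem isCompl_metricTensors_complex : IsCompl (tracelessTensors ℂ k) (metricTensors ℂ k) := by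
  have h := Submodule.isCompl_orthogonal
    ((metricTensors ℂ k).map (WithLp.linearEquiv 2 ℂ (TensorIn ℂ k)).symm.toLinearMap)
  rw [orthogonal_metricTensors] at h
  exact ((Submodule.orderIsoMapComap
    (WithLp.linearEquiv 2 ℂ (TensorIn ℂ k)).symm).isCompl_iff.2 h).symm

theorem disjoint_tracelessTensors_metricTensors :
    Disjoint (tracelessTensors M k) (metricTensors M k) := by
  rw [Submodule.disjoint_def]
  refine fun T hT hT' => funext fun I =>
    (Module.forall_dual_apply_eq_zero_iff ℂ (T I)).1 fun f => ?_
  exact congrFun (Submodule.disjoint_def.1 isCompl_metricTensors_complex.disjoint _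
    (map_mem_tracelessTensors hT f) (map_mem_metricTensors hT' f)) I

theorem codisjoint_tracelessTensors_metricTensors :
    Codisjoint (tracelessTensors M k) (metricTensors M k) := by
  rw [codisjoint_iff, eq_top_iff]
  rintro T -
  have hsum : T = ∑ J, fun I => Pi.single (M := fun _ => ℂ) J 1 I • T J := by
    funext I
    simp only [Finset.sum_apply, Pi.single_apply, ite_smul, one_smul, zero_smul, Finset.sum_ite_eq,
      Finset.mem_univ, if_true]
  rw [hsum]
  refine sum_mem fun J _ => ?_
  obtain ⟨A, hA, B, hB, hAB⟩ := Submodule.mem_sup.1 (isCompl_metricTensors_complex.sup_eq_top ▸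
    Submodule.mem_top (x := (Pi.single J 1 : TensorIn ℂ k)))
  rw [← hAB]
  exact Submodule.mem_sup.2 ⟨_, map_mem_tracelessTensors hA (LinearMap.toSpanSingleton ℂ M (T J)),
    _, map_mem_metricTensors hB (LinearMap.toSpanSingleton ℂ M (T J)),
    funext fun I => (add_smul (A I) (B I) (T J)).symm⟩

theorem isCompl_metricTensors : IsCompl (tracelessTensors M k) (metricTensors M k) :=
  ⟨disjoint_tracelessTensors_metricTensors, codisjoint_tracelessTensors_metricTensors⟩

theorem exists_of_mem_metricTensors {T : TensorIn M k} (hT : T ∈ metricTensors (M) k) :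
    ∃ S : Fin k → Fin k → TensorIn M k,
      (∀ i j I μ ν, S i j (Function.update (Function.update I i μ) j ν) = S i j I) ∧
      ∀ I, T I = ∑ i, ∑ j, if i < j then eta (I i) (I j) • S i j I else 0 := by
  induction hT using Submodule.iSup_induction' with
  | mem p T hT =>
    obtain ⟨⟨a, b⟩, hab⟩ := p
    obtain ⟨S, rfl⟩ := hT
    let S' : TensorIn M k := fun I =>
      ∑ μ, ∑ ν, S (Function.update (Function.update I a μ) b ν)
    refine ⟨fun i j => if i = a ∧ j = b then S' else 0, fun i j I μ ν => ?_, fun I => ?_⟩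
    · dsimp only
      split_ifs with h
      · obtain ⟨rfl, rfl⟩ := h
        simp only [S', Function.update_idem, Function.update_comm hab.ne]
      · rfl
    · rw [Fintype.sum_eq_single a fun i hi => Finset.sum_eq_zero fun j _ => ?_,
        Fintype.sum_eq_single b fun j hj => ?_, if_pos hab]
      · simp only [and_self, if_true]
        rfl
      · simp only [hj, and_false, if_false, Pi.zero_apply, smul_zero, ite_self]
      · simp only [hi, false_and, if_false, Pi.zero_apply, smul_zero, ite_self]
  | zero => exact ⟨0, fun _ _ _ _ _ => rfl, fun I => by simp⟩
  | add T T' _ _ hT hT' =>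
    obtain ⟨S, hS, hT⟩ := hT
    obtain ⟨S', hS', hT'⟩ := hT'
    refine ⟨S + S', fun i j I μ ν => ?_, fun I => ?_⟩
    · simp only [Pi.add_apply, hS, hS']
    · simp only [Pi.add_apply, hT, hT', ← Finset.sum_add_distrib, smul_add, ite_add_ite, add_zero]

theorem mem_metricTensors_of_eq_sum {T : TensorIn M k} {S : Fin k → Fin k → TensorIn M k}
    (hS : ∀ i j I μ ν, S i j (Function.update (Function.update I i μ) j ν) = S i j I)
    (hT : ∀ I, T I = ∑ i, ∑ j, if i < j then eta (I i) (I j) • S i j I else 0) :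
    T ∈ metricTensors (M) k := by
  have hsum : T = ∑ i, ∑ j, if i < j then (16 : ℂ)⁻¹ • contractTranspose i j (S i j) else 0 := by
    funext I
    simp only [hT, Finset.sum_apply, apply_ite (fun T : TensorIn M k => T I), Pi.smul_apply,
      contractTranspose_of_forall_update (hS _ _), Pi.zero_apply,
      inv_smul_smul₀ (by norm_num : (16 : ℂ) ≠ 0)]
  rw [hsum]
  refine sum_mem fun i _ => sum_mem fun j _ => ?_
  split_ifs with hij
  · exact Submodule.smul_mem _ _ (contractTranspose_mem_metricTensors hij.ne _)
  · exact zero_mem _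

/-- The projection onto the traceless tensors along the multiples of the metric. -/
noncomputable def tlProj : TensorIn M k →ₗ[ℂ] TensorIn M k :=
  (tracelessTensors M k).projection (metricTensors M k) isCompl_metricTensors

theorem tlProj_mem_tracelessTensors (T : TensorIn M k) : tlProj T ∈ tracelessTensors M k :=
  Submodule.projection_apply_mem _ _

theorem sub_tlProj_mem_metricTensors (T : TensorIn M k) : T - tlProj T ∈ metricTensors M k := by
  rw [tlProj, Submodule.projection_eq_self_sub_projection isCompl_metricTensors.symm,
    sub_sub_cancel]
  exact Submodule.projection_apply_mem _ _

theorem tlProj_eq_of {T T₀ : TensorIn M k} (hT₀ : T₀ ∈ tracelessTensors M k)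
    (h : T - T₀ ∈ metricTensors M k) : tlProj T = T₀ := by
  rw [← sub_add_cancel T T₀, map_add, tlProj, (Submodule.projection_apply_eq_zero_iff _).2 h,
    zero_add, Submodule.projection_apply_of_mem_left _ hT₀]

theorem tlProj_of_mem {T : TensorIn M k} (hT : T ∈ tracelessTensors M k) : tlProj T = T :=
  tlProj_eq_of hT (by simp only [sub_self, zero_mem])

theorem map_tlProj (f : M →ₗ[ℂ] N) (T : TensorIn M k) :
    tlProj (fun I => f (T I)) = fun I => f (tlProj T I) := by
  refine tlProj_eq_of (map_mem_tracelessTensors (tlProj_mem_tracelessTensors T) f) ?_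
  convert map_mem_metricTensors (sub_tlProj_mem_metricTensors T) f using 1
  exact funext fun I => (map_sub f _ _).symm

theorem tlProj_comp_perm (σ : Equiv.Perm (Fin k)) (T : TensorIn M k) :
    tlProj (fun I => T (I ∘ σ)) = fun I => tlProj T (I ∘ σ) :=
  tlProj_eq_of (comp_perm_mem_tracelessTensors (tlProj_mem_tracelessTensors T) σ)
    (comp_perm_mem_metricTensors (sub_tlProj_mem_metricTensors T) σ)

theorem tlProj_mem {Y : Submodule ℂ M} {T : TensorIn M k} (hT : ∀ I, T I ∈ Y)
    (I : Fin k → Fin 4) : tlProj T I ∈ Y := by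
  have hzero : (fun I => Y.mkQ (T I)) = (0 : TensorIn (M ⧸ Y) k) :=
    funext fun I => (Submodule.Quotient.mk_eq_zero Y).2 (hT I)
  have h := map_tlProj Y.mkQ T
  rw [hzero, map_zero] at h
  exact (Submodule.Quotient.mk_eq_zero Y).1 (congrFun h I).symm

theorem sub_tlProj_mem {Y : Submodule ℂ M} {T : TensorIn M k}
    (hT : ∀ i j, i ≠ j → ∀ I, contract i j T I ∈ Y) (I : Fin k → Fin 4) :
    T I - tlProj T I ∈ Y := by
  have htraceless : (fun I => Y.mkQ (T I)) ∈ tracelessTensors (M ⧸ Y) k :=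
    mem_tracelessTensors.2 fun i j hij => by
      rw [contract_map]
      exact funext fun I => (Submodule.Quotient.mk_eq_zero Y).2 (hT i j hij I)
  have h := (tlProj_of_mem htraceless).symm.trans (map_tlProj Y.mkQ T)
  exact (Submodule.Quotient.eq Y).1 (congrFun h I)

end TracelessProjection

section TracelessPart

variable {m : ℝ} {k : ℕ} {T T₀ : Tensor m k}

theorem isTraceless_iff : IsTraceless T ↔ T ∈ tracelessTensors (Poly m) k := by
  rw [mem_tracelessTensors]
  exact ⟨fun h i j hij => funext fun I => h I i j hij, fun h I i j hij => congrFun (h i j hij) I⟩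

theorem isTracelessPart_iff : IsTracelessPart T T₀ ↔
    T₀ ∈ tracelessTensors (Poly m) k ∧ T - T₀ ∈ metricTensors (Poly m) k := by
  rw [← isTraceless_iff]
  exact and_congr_right fun _ => ⟨fun ⟨_, hS, hT⟩ => mem_metricTensors_of_eq_sum hS hT,
    exists_of_mem_metricTensors⟩

theorem isTracelessPart_tlProj (T : Tensor m k) : IsTracelessPart T (tlProj T) :=
  isTracelessPart_iff.2 ⟨tlProj_mem_tracelessTensors T, sub_tlProj_mem_metricTensors T⟩

theorem IsTracelessPart.eq_tlProj (h : IsTracelessPart T T₀) : T₀ = tlProj T :=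
  (tlProj_eq_of (isTracelessPart_iff.1 h).1 (isTracelessPart_iff.1 h).2).symm

theorem existsUnique_isTracelessPart (T : Tensor m k) : ∃! T₀, IsTracelessPart T T₀ :=
  ⟨tlProj T, isTracelessPart_tlProj T, fun _ h => h.eq_tlProj⟩

theorem tracelessPart_eq_tlProj (T : Tensor m k) : tracelessPart T = tlProj T := by
  have h : ∃ T₀, IsTracelessPart T T₀ := ⟨_, isTracelessPart_tlProj T⟩
  rw [tracelessPart, dif_pos h]
  exact h.choose_spec.eq_tlProj

end TracelessPart

/-! ## The linear part of `𝒫` -/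

section JetSpace

variable {M : Type*} [AddCommGroup M] [Module ℂ M] {m : ℝ}

/-- The Klein-Gordon equation of mass `m`, with all its derivatives, for the derivatives `f J` of
a field. -/
def KleinGordon (m : ℝ) (f : Multiset (Fin 4) → M) : Prop :=
  ∀ J, ∑ μ, eta μ μ • f (μ ::ₘ μ ::ₘ J) + (m : ℂ) ^ 2 • f J = 0

/-- The Klein-Gordon relations between the jet variables. -/
noncomputable def kgSpan (m : ℝ) : Submodule ℂ (Jet →₀ ℂ) :=
  Submodule.span ℂ {x | ∃ (α : Fld) (J : Multiset (Fin 4)),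
    x = ∑ μ, eta μ μ • Finsupp.single ((α, μ ::ₘ μ ::ₘ J) : Jet) (1 : ℂ)
      + (m : ℂ) ^ 2 • Finsupp.single ((α, J) : Jet) (1 : ℂ)}

/-- The space of linear combinations of jet variables modulo the Klein-Gordon equations. It turns
out to be the linear part of `𝒫`, see `linearPart_toPoly`. -/
abbrev JetSpace (m : ℝ) : Type := (Jet →₀ ℂ) ⧸ kgSpan m

/-- The class of a jet variable. -/
noncomputable def jv (m : ℝ) (a : Jet) : JetSpace m :=
  (kgSpan m).mkQ (Finsupp.single a 1)

/-- The linear map with given values on the jet variables. -/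
noncomputable def jetLift (m : ℝ) (f : Jet → M) (h : ∀ α, KleinGordon m fun J => f (α, J)) :
    JetSpace m →ₗ[ℂ] M :=
  (kgSpan m).liftQ (Finsupp.linearCombination ℂ f) <| by
    rw [kgSpan, Submodule.span_le]
    rintro _ ⟨α, J, rfl⟩
    simpa using h α J

@[simp]
theorem jetLift_jv (f : Jet → M) (h : ∀ α, KleinGordon m fun J => f (α, J)) (a : Jet) :
    jetLift m f h (jv m a) = f a := by
  simp [jv, jetLift]

theorem jv_kleinGordon (m : ℝ) (α : Fld) : KleinGordon m fun J => jv m (α, J) := fun J => by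
  have h := (Submodule.Quotient.mk_eq_zero (kgSpan m)).2 (Submodule.subset_span ⟨α, J, rfl⟩)
  simp only [← Submodule.mkQ_apply, map_add, map_sum, map_smul] at h
  exact h

theorem span_range_jv (m : ℝ) : Submodule.span ℂ (Set.range (jv m)) = ⊤ := by
  rw [show jv m = (kgSpan m).mkQ ∘ fun a => Finsupp.single a 1 from rfl, Set.range_comp,
    Submodule.span_image, show Submodule.span ℂ (Set.range fun a : Jet => Finsupp.single a (1 : ℂ))
      = ⊤ from Finsupp.basisSingleOne.span_eq, Submodule.map_top, Submodule.range_mkQ]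

theorem jetSpace_hom_ext {f g : JetSpace m →ₗ[ℂ] M} (h : ∀ a, f (jv m a) = g (jv m a)) : f = g :=
  LinearMap.ext_on_range (span_range_jv m) h

/-- The inclusion of the linear combinations of jet variables into `𝒫`. -/
noncomputable def toPoly (m : ℝ) : JetSpace m →ₗ[ℂ] Poly m :=
  jetLift m (jet m) (jet_kleinGordon m)

@[simp]
theorem toPoly_jv (m : ℝ) (a : Jet) : toPoly m (jv m a) = jet m a := jetLift_jv _ _ _

theorem lift_inr_jv_eq_of_rel {x y : FreeAlgebra ℂ Jet} (h : Rel m x y) :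
    FreeAlgebra.lift ℂ (fun a : Jet => TrivSqZeroExt.inr (R := ℂ) (jv m a)) x =
      FreeAlgebra.lift ℂ (fun a : Jet => TrivSqZeroExt.inr (R := ℂ) (jv m a)) y := by
  induction h with
  | comm a b => simp
  | kleinGordon α J =>
    have h := congrArg (TrivSqZeroExt.inrHom ℂ (JetSpace m)) (jv_kleinGordon m α J)
    simpa only [map_add, map_sum, map_smul, map_zero, FreeAlgebra.lift_ι_apply,
      TrivSqZeroExt.inrHom_apply] using h

/-- The part of a polynomial which is linear in the jet variables. -/
noncomputable def linearPart (m : ℝ) : Poly m →ₗ[ℂ] JetSpace m :=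
  TrivSqZeroExt.sndHom ℂ (JetSpace m) ∘ₗ
    (Poly.lift m _ fun _ _ => lift_inr_jv_eq_of_rel).toLinearMap

@[simp]
theorem linearPart_toPoly (x : JetSpace m) : linearPart m (toPoly m x) = x := by
  suffices h : linearPart m ∘ₗ toPoly m = LinearMap.id from LinearMap.congr_fun h x
  refine jetSpace_hom_ext fun a => ?_
  simp [linearPart, jet, Poly.lift_mk]

end JetSpace

section KleinGordon

variable {M : Type*} [AddCommGroup M] [Module ℂ M] {m : ℝ}

/-- The solution of the Klein-Gordon equations with given initial data, that is, with given values
on the multi-indices which contain the time index `0` at most once. -/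
noncomputable def kgExtend (m : ℝ) (f : Multiset (Fin 4) → M) (J : Multiset (Fin 4)) : M :=
  if 2 ≤ J.count 0 then
    (∑ i : Fin 3, kgExtend m f (i.succ ::ₘ i.succ ::ₘ (J.erase 0).erase 0))
      - (m : ℂ) ^ 2 • kgExtend m f ((J.erase 0).erase 0)
  else f J
termination_by J.count 0
decreasing_by
  all_goals
    simp only [ne_eq, (Fin.succ_ne_zero _).symm, not_false_eq_true, Multiset.count_cons_of_ne,
      Multiset.count_erase_self]
    omega

theorem kgExtend_of_count_lt (m : ℝ) (f : Multiset (Fin 4) → M) {J : Multiset (Fin 4)}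
    (h : J.count 0 < 2) : kgExtend m f J = f J := by
  rw [kgExtend, if_neg h.not_ge]

theorem kgExtend_cons_cons (m : ℝ) (f : Multiset (Fin 4) → M) (J : Multiset (Fin 4)) :
    kgExtend m f (0 ::ₘ 0 ::ₘ J) = (∑ i : Fin 3, kgExtend m f (i.succ ::ₘ i.succ ::ₘ J))
      - (m : ℂ) ^ 2 • kgExtend m f J := by
  rw [kgExtend, if_pos (by simp), Multiset.erase_cons_head, Multiset.erase_cons_head]

theorem kleinGordon_kgExtend (m : ℝ) (f : Multiset (Fin 4) → M) :
    KleinGordon m (kgExtend m f) := fun J => by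
  rw [sum_eta_self_smul, kgExtend_cons_cons]
  abel

theorem KleinGordon.cons_cons {f : Multiset (Fin 4) → M} (h : KleinGordon m f)
    (J : Multiset (Fin 4)) : f (0 ::ₘ 0 ::ₘ J) = (∑ i : Fin 3, f (i.succ ::ₘ i.succ ::ₘ J))
      - (m : ℂ) ^ 2 • f J := by
  rw [← sub_eq_zero, ← h J, sum_eta_self_smul]
  abel

theorem time_induction {P : Multiset (Fin 4) → Prop} (initial : ∀ J, J.count 0 < 2 → P J)
    (step : ∀ J, P J → (∀ i : Fin 3, P (i.succ ::ₘ i.succ ::ₘ J)) → P (0 ::ₘ 0 ::ₘ J))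
    (J : Multiset (Fin 4)) : P J := by
  induction hn : J.count 0 using Nat.strong_induction_on generalizing J with
  | _ n ih =>
    by_cases h : J.count 0 < 2
    · exact initial J h
    obtain ⟨K, rfl⟩ := Multiset.exists_cons_of_mem (Multiset.count_pos.1 (by omega : 0 < J.count 0))
    rw [Multiset.count_cons_self] at h hn
    obtain ⟨L, rfl⟩ := Multiset.exists_cons_of_mem (Multiset.count_pos.1 (by omega : 0 < K.count 0))
    rw [Multiset.count_cons_self] at hn
    refine step L (ih _ (by omega) L rfl) fun i => ih (L.count 0) (by omega) _ ?_
    simp only [ne_eq, (Fin.succ_ne_zero _).symm, not_false_eq_true, Multiset.count_cons_of_ne]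

theorem kgExtend_mem {f : Multiset (Fin 4) → M} {Y : Submodule ℂ M} (h : ∀ J, f J ∈ Y)
    (J : Multiset (Fin 4)) : kgExtend m f J ∈ Y := by
  induction J using time_induction with
  | initial J hJ => rw [kgExtend_of_count_lt m f hJ]; exact h J
  | step J hJ hi =>
    rw [kgExtend_cons_cons]
    exact Y.sub_mem (Y.sum_mem fun i _ => hi i) (Y.smul_mem _ hJ)

end KleinGordon

/-! ## Tensors with symmetric indices -/

section Index

variable {n : ℕ}

theorem idx_vecCons (a : Fin 4) (f : Fin n → Fin 4) : idx (Matrix.vecCons a f) = a ::ₘ idx f := by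
  simp only [idx, Fin.univ_val_map, List.ofFn_succ, ← Multiset.cons_coe]
  rfl

theorem card_idx (f : Fin n → Fin 4) : Multiset.card (idx f) = n := by
  simp [idx]

theorem idx_comp_perm (f : Fin n → Fin 4) (σ : Equiv.Perm (Fin n)) : idx (f ∘ σ) = idx f := by
  rw [idx, idx, ← Multiset.map_map, Multiset.map_univ_val_equiv]

theorem exists_idx {K : Multiset (Fin 4)} (hK : Multiset.card K = n) :
    ∃ f : Fin n → Fin 4, idx f = K := by
  subst hK
  induction K using Quotient.inductionOn with
  | h l => exact ⟨l.get, (Fin.univ_val_map _).trans (congrArg _ (List.ofFn_get l))⟩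

theorem exists_perm_of_idx_eq {f g : Fin n → Fin 4} (h : idx f = idx g) :
    ∃ σ : Equiv.Perm (Fin n), f = g ∘ σ := by
  simp only [idx, Fin.univ_val_map, Multiset.coe_eq_coe] at h
  have hsort : f ∘ Tuple.sort f = g ∘ Tuple.sort g := List.ofFn_injective <|
    (((Tuple.sort f).ofFn_comp_perm f).trans
      (h.trans ((Tuple.sort g).ofFn_comp_perm g).symm)).eq_of_pairwise'
        (Tuple.monotone_sort f).sortedLE_ofFn.pairwise
        (Tuple.monotone_sort g).sortedLE_ofFn.pairwise
  refine ⟨(Tuple.sort f).symm.trans (Tuple.sort g), funext fun i => ?_⟩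
  simpa using congrFun hsort ((Tuple.sort f).symm i)

theorem map_univ_erase (I : Fin n → Fin 4) (i : Fin n) :
    (Finset.univ.erase i).val.map I = (idx I).erase (I i) := by
  rw [Finset.erase_val, idx, Multiset.map_erase_of_mem _ _ (Finset.mem_univ i)]

theorem mem_idx (I : Fin n → Fin 4) (i : Fin n) : I i ∈ idx I :=
  Multiset.mem_map_of_mem I (Finset.mem_univ i)

theorem idx_update (I : Fin n → Fin 4) (i : Fin n) (μ : Fin 4) :
    idx (Function.update I i μ) = μ ::ₘ (idx I).erase (I i) := by
  have h : (Finset.univ.erase i).val.map (Function.update I i μ) =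
      (Finset.univ.erase i).val.map I :=
    Multiset.map_congr rfl fun l hl =>
      Function.update_of_ne (Finset.ne_of_mem_erase (Finset.mem_def.2 hl)) _ _
  rw [← map_univ_erase I, ← h, map_univ_erase, Function.update_self, Multiset.cons_erase]
  exact Multiset.mem_map.2 ⟨i, Finset.mem_univ i, Function.update_self _ _ _⟩

theorem mem_erase_idx (I : Fin n → Fin 4) {i j : Fin n} (hij : i ≠ j) :
    I j ∈ (idx I).erase (I i) := by
  rw [← map_univ_erase]
  exact Multiset.mem_map_of_mem I (Finset.mem_erase.2 ⟨hij.symm, Finset.mem_univ j⟩)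

theorem idx_update_update (I : Fin n → Fin 4) {i j : Fin n} (hij : i ≠ j) (μ ν : Fin 4) :
    idx (Function.update (Function.update I i μ) j ν) =
      ν ::ₘ μ ::ₘ ((idx I).erase (I i)).erase (I j) := by
  rw [idx_update, idx_update, Function.update_of_ne hij.symm,
    Multiset.erase_cons_tail_of_mem (mem_erase_idx I hij)]

theorem exists_forall_idx_eq {X : Type*} (T : ∀ n, (Fin n → Fin 4) → X)
    (hT : ∀ n f (i j : Fin n), T n (f ∘ Equiv.swap i j) = T n f) :
    ∃ t : Multiset (Fin 4) → X, ∀ n (f : Fin n → Fin 4), t (idx f) = T n f := by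
  have hperm : ∀ {n} (f : Fin n → Fin 4) (σ : Equiv.Perm (Fin n)), T n (f ∘ σ) = T n f :=
    fun f σ => by
      induction σ using Equiv.Perm.swap_induction_on generalizing f with
      | one => rfl
      | swap_mul σ i j _ ih => rw [Equiv.Perm.coe_mul, ← Function.comp_assoc, ih, hT]
  refine ⟨fun K => T _ (exists_idx (K := K) rfl).choose, fun n f => ?_⟩
  suffices h : ∀ k (g : Fin k → Fin 4), k = n → idx g = idx f → T k g = T n f from
    h _ _ (card_idx f) (exists_idx rfl).choose_spec
  rintro k g rfl hg
  obtain ⟨σ, rfl⟩ := exists_perm_of_idx_eq hg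
  exact hperm f σ

theorem vecCons_comp_swap {X : Type*} (a : X) (f : Fin n → X) (i j : Fin n) :
    Matrix.vecCons a f ∘ Equiv.swap i.succ j.succ = Matrix.vecCons a (f ∘ Equiv.swap i j) := by
  funext l
  cases l using Fin.cases with
  | zero => simp [Equiv.swap_apply_of_ne_of_ne, (Fin.succ_ne_zero _).symm]
  | succ l =>
    simp only [Function.comp_apply, Matrix.cons_val_succ, Equiv.swap_apply_def, Fin.succ_inj]
    split_ifs <;> rfl

theorem vecCons_vecCons_comp_swap {X : Type*} (a b : X) (f : Fin n → X) :
    Matrix.vecCons a (Matrix.vecCons b f) ∘ Equiv.swap 0 1 =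
      Matrix.vecCons b (Matrix.vecCons a f) := by
  funext l
  cases l using Fin.cases with
  | zero => simp
  | succ l =>
    cases l using Fin.cases with
    | zero => simp
    | succ l =>
      have h : Equiv.swap (0 : Fin (n + 2)) 1 l.succ.succ = l.succ.succ :=
        Equiv.swap_apply_of_ne_of_ne (Fin.succ_ne_zero _) (by simp [Fin.ext_iff])
      rw [Function.comp_apply, h]
      rfl

theorem exists_perm_vecCons_rotate (X : Type*) (n : ℕ) :
    ∃ σ : Equiv.Perm (Fin (n + 3)), ∀ (a b c : X) (f : Fin n → X),
      Matrix.vecCons a (Matrix.vecCons b (Matrix.vecCons c f)) ∘ σ =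
        Matrix.vecCons b (Matrix.vecCons c (Matrix.vecCons a f)) := by
  refine ⟨Equiv.swap 0 1 * Equiv.swap (Fin.succ 0) (Fin.succ 1), fun a b c f => ?_⟩
  rw [Equiv.Perm.coe_mul, ← Function.comp_assoc, vecCons_vecCons_comp_swap, vecCons_comp_swap,
    vecCons_vecCons_comp_swap]

theorem vecCons_vecCons_tail_tail {X : Type*} (I : Fin (n + 2) → X) :
    Matrix.vecCons (I 0) (Matrix.vecCons (I 1) fun l : Fin n => I l.succ.succ) = I :=
  funext <| Fin.cases rfl <| Fin.cases rfl fun _ => rfl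

end Index

section SymmetricTensors

variable {M : Type*} {n : ℕ}

/-- The symmetric tensor with the components `f {μ₁, …, μₙ}`. -/
def symmTensor (f : Multiset (Fin 4) → M) (n : ℕ) : TensorIn M n := fun I => f (idx I)

/-- The tensor with the components `F μ ν {ρ₁, …, ρₙ}`, which is symmetric in the last `n`
indices. -/
def twoFormTensor (F : Fin 4 → Fin 4 → Multiset (Fin 4) → M) (n : ℕ) : TensorIn M (n + 2) :=
  fun I => F (I 0) (I 1) (idx fun l : Fin n => I l.succ.succ)

theorem twoFormTensor_vecCons (F : Fin 4 → Fin 4 → Multiset (Fin 4) → M) (μ ν : Fin 4)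
    (f : Fin n → Fin 4) :
    twoFormTensor F n (Matrix.vecCons μ (Matrix.vecCons ν f)) = F μ ν (idx f) := rfl

theorem twoFormTensor_comp_swap (F : Fin 4 → Fin 4 → Multiset (Fin 4) → M)
    (I : Fin (n + 2) → Fin 4) (i j : Fin n) :
    twoFormTensor F n (I ∘ Equiv.swap i.succ.succ j.succ.succ) = twoFormTensor F n I := by
  rw [← vecCons_vecCons_tail_tail I, vecCons_comp_swap, vecCons_comp_swap, twoFormTensor_vecCons,
    twoFormTensor_vecCons, idx_comp_perm]

theorem twoFormTensor_comp_swap_zero_one (F : Fin 4 → Fin 4 → Multiset (Fin 4) → M)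
    (I : Fin (n + 2) → Fin 4) :
    twoFormTensor F n (I ∘ Equiv.swap 0 1) =
      F (I 1) (I 0) (idx fun l : Fin n => I l.succ.succ) := by
  nth_rw 1 [← vecCons_vecCons_tail_tail I]
  rw [vecCons_vecCons_comp_swap, twoFormTensor_vecCons]

variable [AddCommGroup M] [Module ℂ M] {Y : Submodule ℂ M}

theorem contract_symmTensor (f : Multiset (Fin 4) → M) {i j : Fin n} (hij : i ≠ j)
    (I : Fin n → Fin 4) : contract i j (symmTensor f n) I =
      ∑ κ, eta κ κ • f (κ ::ₘ κ ::ₘ ((idx I).erase (I i)).erase (I j)) := by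
  simp only [contract_apply, symmTensor, idx_update_update I hij]

theorem forall_contract_symmTensor_mem_iff {f : Multiset (Fin 4) → M} :
    (∀ i j, i ≠ j → ∀ I, contract i j (symmTensor f n) I ∈ Y) ↔
      ∀ K, Multiset.card K + 2 = n → ∑ κ, eta κ κ • f (κ ::ₘ κ ::ₘ K) ∈ Y := by
  refine ⟨?_, fun h i j hij I => ?_⟩
  · rintro h K rfl
    obtain ⟨g, hg⟩ := exists_idx (K := K) rfl
    have h01 := h 0 1 zero_ne_one (Matrix.vecCons 0 (Matrix.vecCons 0 g))
    simpa [contract_symmTensor, idx_vecCons, hg] using h01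
  · rw [contract_symmTensor f hij]
    refine h _ ?_
    have hi := Multiset.card_erase_add_one (mem_idx I i)
    have hj := Multiset.card_erase_add_one (mem_erase_idx I hij)
    rw [card_idx] at hi
    omega

section

variable {F : Fin 4 → Fin 4 → Multiset (Fin 4) → M} (I : Fin (n + 2) → Fin 4)

theorem update_tail_tail (j : Fin n) (μ : Fin 4) :
    (fun l : Fin n => Function.update I j.succ.succ μ l.succ.succ) =
      Function.update (fun l => I l.succ.succ) j μ :=
  Function.update_comp_eq_of_injective I
    ((Fin.succ_injective _).comp (Fin.succ_injective _)) j μ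

theorem apply_self_eq_zero_of_antisymm (hF : ∀ μ ν K, F μ ν K = -F ν μ K) (μ : Fin 4)
    (K : Multiset (Fin 4)) : F μ μ K = 0 := by
  have h : (2 : ℂ) • F μ μ K = 0 := by rw [two_smul, ← eq_neg_iff_add_eq_zero]; exact hF μ μ K
  exact (smul_eq_zero.1 h).resolve_left two_ne_zero

theorem contract_twoFormTensor_zero_one (hF : ∀ μ ν K, F μ ν K = -F ν μ K) :
    contract 0 1 (twoFormTensor F n) I = 0 := by
  simp [contract_apply, twoFormTensor, apply_self_eq_zero_of_antisymm hF]

theorem contract_twoFormTensor_zero_succ (j : Fin n) :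
    contract 0 j.succ.succ (twoFormTensor F n) I =
      ∑ κ, eta κ κ •
        F κ (I 1) (κ ::ₘ (idx fun l : Fin n => I l.succ.succ).erase (I j.succ.succ)) := by
  have h1 : (1 : Fin (n + 2)) ≠ j.succ.succ := by simp [Fin.ext_iff]
  have htail : ∀ μ, (fun l : Fin n => Function.update I 0 μ l.succ.succ) = fun l => I l.succ.succ :=
    fun μ => rfl
  simp only [contract_apply, twoFormTensor, update_tail_tail, htail, idx_update,
    Function.update_of_ne h1, Function.update_of_ne (Fin.succ_ne_zero _).symm,
    Function.update_self, Function.update_of_ne (one_ne_zero (α := Fin (n + 2)))]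

theorem contract_twoFormTensor_one_succ (j : Fin n) :
    contract 1 j.succ.succ (twoFormTensor F n) I =
      ∑ κ, eta κ κ •
        F (I 0) κ (κ ::ₘ (idx fun l : Fin n => I l.succ.succ).erase (I j.succ.succ)) := by
  have h1 : (1 : Fin (n + 2)) ≠ j.succ.succ := by simp [Fin.ext_iff]
  have htail : ∀ μ, (fun l : Fin n => Function.update I 1 μ l.succ.succ) = fun l => I l.succ.succ :=
    fun μ => funext fun l => Function.update_of_ne (by simp [Fin.ext_iff]) _ _
  simp only [contract_apply, twoFormTensor, update_tail_tail, htail, idx_update,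
    Function.update_of_ne h1, Function.update_of_ne (Fin.succ_ne_zero _).symm,
    Function.update_self, Function.update_of_ne (zero_ne_one (α := Fin (n + 2)))]

theorem contract_twoFormTensor_succ_succ (i j : Fin n) :
    contract i.succ.succ j.succ.succ (twoFormTensor F n) I =
      contract i j (symmTensor (F (I 0) (I 1)) n) fun l => I l.succ.succ := by
  have h1 : ∀ i : Fin n, (1 : Fin (n + 2)) ≠ i.succ.succ := fun i => by simp [Fin.ext_iff]
  simp only [contract_apply, twoFormTensor, symmTensor, update_tail_tail,
    Function.update_of_ne (h1 _), Function.update_of_ne (Fin.succ_ne_zero _).symm]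

end

theorem contract_twoFormTensor_mem_of_lt {F : Fin 4 → Fin 4 → Multiset (Fin 4) → M}
    (hF : ∀ μ ν K, F μ ν K = -F ν μ K)
    (hdiv : ∀ ν K, Multiset.card K + 1 = n → ∑ κ, eta κ κ • F κ ν (κ ::ₘ K) ∈ Y)
    (htrace : ∀ μ ν K, Multiset.card K + 2 = n → ∑ κ, eta κ κ • F μ ν (κ ::ₘ κ ::ₘ K) ∈ Y)
    {i j : Fin (n + 2)} (hlt : i < j) (I : Fin (n + 2) → Fin 4) :
    contract i j (twoFormTensor F n) I ∈ Y := by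
  have hcard : ∀ j : Fin n, Multiset.card ((idx fun l : Fin n => I l.succ.succ).erase
      (I j.succ.succ)) + 1 = n := fun j => by
    rw [Multiset.card_erase_add_one (mem_idx (fun l : Fin n => I l.succ.succ) j), card_idx]
  cases j using Fin.cases with
  | zero => exact absurd hlt (Fin.not_lt_zero i)
  | succ j =>
  cases j using Fin.cases with
  | zero =>
    obtain rfl : i = 0 := Fin.ext (by simpa [Fin.lt_def] using hlt)
    rw [show (Fin.succ 0 : Fin (n + 2)) = 1 from rfl, contract_twoFormTensor_zero_one I hF]
    exact Y.zero_mem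
  | succ j =>
  cases i using Fin.cases with
  | zero =>
    rw [contract_twoFormTensor_zero_succ]
    exact hdiv _ _ (hcard j)
  | succ i =>
  cases i using Fin.cases with
  | zero =>
    have h := contract_twoFormTensor_one_succ (F := F) I j
    simp only [hF (I 0), smul_neg, Finset.sum_neg_distrib] at h
    exact h ▸ Y.neg_mem (hdiv _ _ (hcard j))
  | succ i =>
    rw [contract_twoFormTensor_succ_succ]
    exact forall_contract_symmTensor_mem_iff.2 (htrace _ _) i j (by simpa using hlt.ne) _

theorem forall_contract_twoFormTensor_mem_iff {F : Fin 4 → Fin 4 → Multiset (Fin 4) → M}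
    (hF : ∀ μ ν K, F μ ν K = -F ν μ K) :
    (∀ i j, i ≠ j → ∀ I, contract i j (twoFormTensor F n) I ∈ Y) ↔
      (∀ ν K, Multiset.card K + 1 = n → ∑ κ, eta κ κ • F κ ν (κ ::ₘ K) ∈ Y) ∧
      ∀ μ ν K, Multiset.card K + 2 = n → ∑ κ, eta κ κ • F μ ν (κ ::ₘ κ ::ₘ K) ∈ Y := by
  refine ⟨fun h => ⟨?_, fun μ ν => ?_⟩, fun ⟨hdiv, htrace⟩ i j hij I => ?_⟩
  · rintro ν K rfl
    obtain ⟨g, hg⟩ := exists_idx (K := K) rfl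
    have h0 := h 0 (Fin.succ (Fin.succ 0)) (Fin.succ_ne_zero _).symm
      (Matrix.vecCons 0 (Matrix.vecCons ν (Matrix.vecCons 0 g)))
    rw [contract_twoFormTensor_zero_succ] at h0
    simpa [idx_vecCons, hg] using h0
  · refine forall_contract_symmTensor_mem_iff.1 fun i j hij I => ?_
    have hIJ := h i.succ.succ j.succ.succ (by simpa using hij)
      (Matrix.vecCons μ (Matrix.vecCons ν I))
    rwa [contract_twoFormTensor_succ_succ] at hIJ
  · rcases lt_or_gt_of_ne hij with hlt | hgt
    · exact contract_twoFormTensor_mem_of_lt hF hdiv htrace hlt I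
    · rw [contract_comm hij]
      exact contract_twoFormTensor_mem_of_lt hF hdiv htrace hgt I

end SymmetricTensors

section

variable {M : Type*} [AddCommGroup M] [Module ℂ M] {n : ℕ}

theorem symmTensor_mem_tracelessTensors_iff {f : Multiset (Fin 4) → M} :
    symmTensor f n ∈ tracelessTensors M n ↔
      ∀ K, Multiset.card K + 2 = n → ∑ κ, eta κ κ • f (κ ::ₘ κ ::ₘ K) = 0 := by
  simpa only [mem_tracelessTensors, funext_iff, Pi.zero_apply, Submodule.mem_bot] using
    forall_contract_symmTensor_mem_iff (f := f) (n := n) (Y := ⊥)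

theorem twoFormTensor_mem_tracelessTensors_iff {F : Fin 4 → Fin 4 → Multiset (Fin 4) → M}
    (hF : ∀ μ ν K, F μ ν K = -F ν μ K) :
    twoFormTensor F n ∈ tracelessTensors M (n + 2) ↔
      (∀ ν K, Multiset.card K + 1 = n → ∑ κ, eta κ κ • F κ ν (κ ::ₘ K) = 0) ∧
      ∀ μ ν K, Multiset.card K + 2 = n → ∑ κ, eta κ κ • F μ ν (κ ::ₘ κ ::ₘ K) = 0 := by
  simpa only [mem_tracelessTensors, funext_iff, Pi.zero_apply, Submodule.mem_bot] using
    forall_contract_twoFormTensor_mem_iff (n := n) (Y := ⊥) hF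

end

/-! ## The symbols -/

section Symbols

theorem cls_rel {x : MvPolynomial Sym0 ℂ} (h : TensorRel x) :
    Ideal.Quotient.mkₐ ℂ bianchiIdeal x = 0 :=
  Ideal.Quotient.eq_zero_iff_mem.2 (Ideal.mem_sup_left (Ideal.subset_span h))

theorem cls_bianchi {x : MvPolynomial Sym0 ℂ} (h : BianchiRel x) :
    Ideal.Quotient.mkₐ ℂ bianchiIdeal x = 0 :=
  Ideal.Quotient.eq_zero_iff_mem.2 (Ideal.mem_sup_right (Ideal.subset_span h))

theorem mkₐ_X (s : Sym0) : Ideal.Quotient.mkₐ ℂ bianchiIdeal (MvPolynomial.X s) = s.cls := rfl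

variable {n : ℕ}

theorem cls_F_comp_swap (I : Fin (n + 2) → Fin 4) (i j : Fin n) :
    (Sym0.F n (I ∘ Equiv.swap i.succ.succ j.succ.succ)).cls = (Sym0.F n I).cls :=
  (sub_eq_zero.1 (by simpa only [map_sub, mkₐ_X] using cls_rel (.F_symm n I i j))).symm

theorem cls_phi_comp_swap (I : Fin (n + 1) → Fin 4) (i j : Fin (n + 1)) :
    (Sym0.phi n (I ∘ Equiv.swap i j)).cls = (Sym0.phi n I).cls :=
  (sub_eq_zero.1 (by simpa only [map_sub, mkₐ_X] using cls_rel (.phi_symm n I i j))).symm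

theorem cls_F_mem_tracelessTensors (n : ℕ) :
    (fun I => (Sym0.F n I).cls) ∈ tracelessTensors FormalP0 (n + 2) :=
  mem_tracelessTensors.2 fun i j hij => funext fun I => by
    simpa only [map_sum, map_smul, mkₐ_X, contract_apply, Pi.zero_apply] using
      cls_rel (.F_trace n I i j hij)

theorem cls_phi_mem_tracelessTensors (n : ℕ) :
    (fun I => (Sym0.phi n I).cls) ∈ tracelessTensors FormalP0 (n + 1) :=
  mem_tracelessTensors.2 fun i j hij => funext fun I => by
    simpa only [map_sum, map_smul, mkₐ_X, contract_apply, Pi.zero_apply] using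
      cls_rel (.phi_trace n I i j hij)

theorem exists_cls_F_vecCons_eq (μ ν : Fin 4) : ∃ t : Multiset (Fin 4) → FormalP0,
    ∀ n (f : Fin n → Fin 4),
      t (idx f) = (Sym0.F n (Matrix.vecCons μ (Matrix.vecCons ν f))).cls :=
  exists_forall_idx_eq _ fun n f i j => by
    rw [← vecCons_comp_swap, ← vecCons_comp_swap, cls_F_comp_swap]

theorem exists_cls_phi_eq : ∃ t : Multiset (Fin 4) → FormalP0,
    t 0 = 0 ∧ ∀ n (I : Fin (n + 1) → Fin 4), t (idx I) = (Sym0.phi n I).cls := by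
  let T : ∀ n, (Fin n → Fin 4) → FormalP0
    | 0, _ => 0
    | n + 1, I => (Sym0.phi n I).cls
  obtain ⟨t, ht⟩ := exists_forall_idx_eq T fun
    | 0, _, _, _ => rfl
    | n + 1, f, i, j => cls_phi_comp_swap f i j
  exact ⟨t, ht 0 Fin.elim0, fun n I => ht (n + 1) I⟩

/-- The symbol `F⁽⁰⁾_{μν;K}`, indexed by a multiset `K`. -/
noncomputable def clsF (μ ν : Fin 4) : Multiset (Fin 4) → FormalP0 :=
  (exists_cls_F_vecCons_eq μ ν).choose

/-- The symbol `φ⁽⁰⁾_K`, indexed by a multiset `K`, with the value `0` for the empty `K`. -/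
noncomputable def clsPhi : Multiset (Fin 4) → FormalP0 := exists_cls_phi_eq.choose

theorem clsPhi_zero : clsPhi 0 = 0 := exists_cls_phi_eq.choose_spec.1

theorem cls_F_vecCons (μ ν : Fin 4) (f : Fin n → Fin 4) :
    (Sym0.F n (Matrix.vecCons μ (Matrix.vecCons ν f))).cls = clsF μ ν (idx f) :=
  ((exists_cls_F_vecCons_eq μ ν).choose_spec n f).symm

theorem cls_F_eq_twoFormTensor (n : ℕ) : (fun I => (Sym0.F n I).cls) = twoFormTensor clsF n :=
  funext fun I => by rw [← vecCons_vecCons_tail_tail I, cls_F_vecCons, twoFormTensor_vecCons]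

theorem cls_phi_eq_symmTensor (n : ℕ) :
    (fun I => (Sym0.phi n I).cls) = symmTensor clsPhi (n + 1) :=
  funext fun I => (exists_cls_phi_eq.choose_spec.2 n I).symm

theorem clsF_antisymm (μ ν : Fin 4) (K : Multiset (Fin 4)) : clsF μ ν K = -clsF ν μ K := by
  obtain ⟨n, f, rfl⟩ : ∃ n, ∃ f : Fin n → Fin 4, idx f = K := ⟨_, exists_idx rfl⟩
  have h := cls_rel (.F_antisymm _ (Matrix.vecCons μ (Matrix.vecCons ν f)))
  simp only [map_add, mkₐ_X, congrFun (cls_F_eq_twoFormTensor _) _,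
    twoFormTensor_comp_swap_zero_one] at h
  exact eq_neg_of_add_eq_zero_left h

theorem clsF_div (ν : Fin 4) (K : Multiset (Fin 4)) :
    ∑ κ, eta κ κ • clsF κ ν (κ ::ₘ K) = 0 :=
  ((twoFormTensor_mem_tracelessTensors_iff clsF_antisymm).1
    (cls_F_eq_twoFormTensor _ ▸ cls_F_mem_tracelessTensors _)).1 ν K rfl

theorem clsF_trace (μ ν : Fin 4) (K : Multiset (Fin 4)) :
    ∑ κ, eta κ κ • clsF μ ν (κ ::ₘ κ ::ₘ K) = 0 :=
  ((twoFormTensor_mem_tracelessTensors_iff clsF_antisymm).1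
    (cls_F_eq_twoFormTensor _ ▸ cls_F_mem_tracelessTensors _)).2 μ ν K rfl

theorem clsF_bianchi (μ ν ρ : Fin 4) (K : Multiset (Fin 4)) :
    clsF μ ν (ρ ::ₘ K) + clsF ν ρ (μ ::ₘ K) + clsF ρ μ (ν ::ₘ K) = 0 := by
  obtain ⟨n, f, rfl⟩ : ∃ n, ∃ f : Fin n → Fin 4, idx f = K := ⟨_, exists_idx rfl⟩
  simpa only [map_add, mkₐ_X, cls_F_vecCons, idx_vecCons] using cls_bianchi (.mk _ μ ν ρ f)

theorem clsPhi_trace (K : Multiset (Fin 4)) :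
    ∑ κ, eta κ κ • clsPhi (κ ::ₘ κ ::ₘ K) = 0 :=
  symmTensor_mem_tracelessTensors_iff.1
    (cls_phi_eq_symmTensor (Multiset.card K + 1) ▸ cls_phi_mem_tracelessTensors _) K rfl

end Symbols

/-! ## Sums over the elements of a multi-index -/

section EraseSum

variable {α M : Type*} [DecidableEq α] [AddCommGroup M]

/-- The sum `∑_{ρ ∈ J} f_ρ(J - ρ)` over the elements of a multiset, counted with multiplicity. -/
def eraseSum (f : α → Multiset α → M) (J : Multiset α) : M :=
  (J.map fun ρ => f ρ (J.erase ρ)).sum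

theorem eraseSum_cons (f : α → Multiset α → M) (κ : α) (K : Multiset α) :
    eraseSum f (κ ::ₘ K) = f κ K + eraseSum (fun ρ L => f ρ (κ ::ₘ L)) K := by
  rw [eraseSum, Multiset.map_cons, Multiset.sum_cons, Multiset.erase_cons_head, eraseSum]
  congr 2
  exact Multiset.map_congr rfl fun ρ hρ => by rw [Multiset.erase_cons_tail_of_mem hρ]

theorem eraseSum_add (f g : α → Multiset α → M) (K : Multiset α) :
    eraseSum (fun ρ L => f ρ L + g ρ L) K = eraseSum f K + eraseSum g K :=
  Multiset.sum_map_add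

theorem eraseSum_sub (f g : α → Multiset α → M) (K : Multiset α) :
    eraseSum (fun ρ L => f ρ L - g ρ L) K = eraseSum f K - eraseSum g K :=
  Multiset.sum_map_sub

theorem eraseSum_zero (K : Multiset α) : eraseSum (fun _ _ => (0 : M)) K = 0 :=
  Multiset.sum_map_zero

variable [Module ℂ M]

theorem eraseSum_sum_smul {ι : Type*} (s : Finset ι) (c : ι → ℂ) (f : ι → α → Multiset α → M)
    (K : Multiset α) :
    eraseSum (fun ρ L => ∑ κ ∈ s, c κ • f κ ρ L) K = ∑ κ ∈ s, c κ • eraseSum (f κ) K := by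
  simp only [eraseSum, Multiset.smul_sum, Multiset.map_map, Function.comp_def]
  exact Multiset.sum_map_sum_map _ _

theorem eraseSum_mem {Y : Submodule ℂ M} {f : α → Multiset α → M} {K : Multiset α}
    (h : ∀ ρ ∈ K, f ρ (K.erase ρ) ∈ Y) : eraseSum f K ∈ Y :=
  multiset_sum_mem _ <| by simpa only [Multiset.mem_map, forall_exists_index, and_imp,
    forall_apply_eq_imp_iff₂] using h

/-- Euler's formula for homogeneous polynomials. -/
theorem eraseSum_cons_apply (f : Multiset α → M) (K : Multiset α) :
    eraseSum (fun ρ L => f (ρ ::ₘ L)) K = (Multiset.card K : ℂ) • f K := by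
  rw [eraseSum, Multiset.map_congr rfl fun ρ hρ => by rw [Multiset.cons_erase hρ],
    Multiset.map_const', Multiset.sum_replicate, Nat.cast_smul_eq_nsmul]

end EraseSum

section Eta

variable {M : Type*} [AddCommMonoid M] [Module ℂ M]

theorem sum_eta_smul_eta_smul (ρ : Fin 4) (f : Fin 4 → M) :
    ∑ κ, eta κ κ • eta κ ρ • f κ = f ρ := by
  simp only [smul_smul, sum_eta_mul_smul]

theorem sum_eta_smul_eta_smul' (ρ : Fin 4) (f : Fin 4 → M) :
    ∑ κ, eta κ κ • eta ρ κ • f κ = f ρ := by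
  simp only [eta_comm ρ, sum_eta_smul_eta_smul]

theorem sum_eta_smul_eta_self_smul (x : M) : ∑ κ, eta κ κ • eta κ κ • x = (4 : ℂ) • x := by
  simp only [smul_smul, sum_eta_mul_self_smul]

end Eta

/-! ## A left inverse of the embedding of the symbols, up to lower order terms -/

/-- The part of the image of `v_{μ;J}` made of the symbols `F⁽⁰⁾`, up to normalization. -/
noncomputable def curlPart (μ : Fin 4) (J : Multiset (Fin 4)) : FormalP0 :=
  eraseSum (fun ρ L => clsF ρ μ L) J

/-- The tensor `∑_{ρ ∈ J} η_{μρ} φ⁽⁰⁾_{J-ρ}`. -/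
noncomputable def etaPhi (μ : Fin 4) (J : Multiset (Fin 4)) : FormalP0 :=
  eraseSum (fun ρ L => eta μ ρ • clsPhi L) J

/-- The tensor `∑_{ρ,σ} η_{ρσ} φ⁽⁰⁾_{μ(J-ρ-σ)}`, summed over ordered pairs. -/
noncomputable def etaEtaPhi (μ : Fin 4) (J : Multiset (Fin 4)) : FormalP0 :=
  eraseSum (fun ρ L => eraseSum (fun σ M => eta ρ σ • clsPhi (μ ::ₘ M)) L) J

theorem curlPart_trace (μ : Fin 4) (K : Multiset (Fin 4)) :
    ∑ κ, eta κ κ • curlPart μ (κ ::ₘ κ ::ₘ K) = 0 := by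
  simp only [curlPart, eraseSum_cons, smul_add, Finset.sum_add_distrib, ← eraseSum_sum_smul,
    clsF_trace, clsF_div, eraseSum_zero, add_zero]

theorem curlPart_div (I : Multiset (Fin 4)) :
    ∑ μ, eta μ μ • curlPart μ (μ ::ₘ I) = 0 := by
  have hdiv : ∀ ρ L, ∑ μ, eta μ μ • clsF ρ μ (μ ::ₘ L) = 0 := fun ρ L => by
    simp only [clsF_antisymm ρ, smul_neg, Finset.sum_neg_distrib, clsF_div, neg_zero]
  simp only [curlPart, eraseSum_cons, apply_self_eq_zero_of_antisymm clsF_antisymm, zero_add,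
    ← eraseSum_sum_smul, hdiv, eraseSum_zero]

theorem curlPart_curl (μ ν : Fin 4) (K : Multiset (Fin 4)) :
    curlPart ν (μ ::ₘ K) - curlPart μ (ν ::ₘ K) = ((Multiset.card K : ℂ) + 2) • clsF μ ν K := by
  have hbianchi : ∀ ρ L, clsF ρ ν (μ ::ₘ L) - clsF ρ μ (ν ::ₘ L) = clsF μ ν (ρ ::ₘ L) :=
    fun ρ L => by
      have h := clsF_bianchi μ ν ρ L
      rw [clsF_antisymm ν ρ] at h
      rw [← sub_eq_zero, ← neg_eq_zero, ← h]
      abel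
  rw [curlPart, curlPart, eraseSum_cons, eraseSum_cons, add_sub_add_comm, ← eraseSum_sub]
  simp only [hbianchi]
  rw [eraseSum_cons_apply, clsF_antisymm ν μ, sub_neg_eq_add, ← two_smul ℂ, add_comm, add_smul]

theorem sum_eta_smul_smul_clsPhi (c : ℂ) (K : Multiset (Fin 4)) :
    ∑ κ, eta κ κ • c • clsPhi (κ ::ₘ κ ::ₘ K) = 0 := by
  simp only [smul_comm _ c, ← Finset.smul_sum, clsPhi_trace, smul_zero]

theorem etaPhi_trace (μ : Fin 4) (K : Multiset (Fin 4)) :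
    ∑ κ, eta κ κ • etaPhi μ (κ ::ₘ κ ::ₘ K) = (2 : ℂ) • clsPhi (μ ::ₘ K) := by
  simp only [etaPhi, eraseSum_cons, smul_add, Finset.sum_add_distrib, ← eraseSum_sum_smul,
    sum_eta_smul_smul_clsPhi, eraseSum_zero, add_zero, sum_eta_smul_eta_smul', two_smul]

theorem etaPhi_div (I : Multiset (Fin 4)) :
    ∑ μ, eta μ μ • etaPhi μ (μ ::ₘ I) = ((Multiset.card I : ℂ) + 4) • clsPhi I := by
  simp only [etaPhi, eraseSum_cons, smul_add, Finset.sum_add_distrib, ← eraseSum_sum_smul,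
    sum_eta_smul_eta_smul, sum_eta_smul_eta_self_smul, eraseSum_cons_apply]
  rw [← add_smul, add_comm]

theorem etaEtaPhi_trace (μ : Fin 4) (K : Multiset (Fin 4)) :
    ∑ κ, eta κ κ • etaEtaPhi μ (κ ::ₘ κ ::ₘ K) =
      (4 * ((Multiset.card K : ℂ) + 2)) • clsPhi (μ ::ₘ K) := by
  have hμ : ∀ ρ σ L, ∑ κ, eta κ κ • eta ρ σ • clsPhi (μ ::ₘ κ ::ₘ κ ::ₘ L) = 0 := fun ρ σ L => by
    simp only [Multiset.cons_swap μ, sum_eta_smul_smul_clsPhi]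
  have euler : ∀ L, eraseSum (fun ρ L => clsPhi (μ ::ₘ ρ ::ₘ L)) L =
      (Multiset.card L : ℂ) • clsPhi (μ ::ₘ L) := eraseSum_cons_apply fun L => clsPhi (μ ::ₘ L)
  simp only [etaEtaPhi, eraseSum_cons, smul_add, Finset.sum_add_distrib, eraseSum_add,
    ← eraseSum_sum_smul, sum_eta_smul_eta_smul, sum_eta_smul_eta_smul', hμ, eraseSum_zero, euler,
    sum_eta_smul_eta_self_smul, add_zero]
  module

theorem etaEtaPhi_div (I : Multiset (Fin 4)) :
    ∑ μ, eta μ μ • etaEtaPhi μ (μ ::ₘ I) = (2 * (Multiset.card I : ℂ)) • clsPhi I := by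
  simp only [etaEtaPhi, eraseSum_cons, smul_add, Finset.sum_add_distrib, eraseSum_add,
    ← eraseSum_sum_smul, sum_eta_smul_eta_smul, sum_eta_smul_eta_smul', sum_eta_smul_smul_clsPhi,
    eraseSum_zero, eraseSum_cons_apply, add_zero]
  module

/-- The image of `v_{μ;J}` up to lower order terms. The coefficients are such that its traces
vanish and its divergence is `-m φ⁽⁰⁾`; for empty `J`, where the
inner one is junk, the outer one is `0`. -/
noncomputable def vSymbol (m : ℝ) (μ : Fin 4) (J : Multiset (Fin 4)) : FormalP0 :=
  ((Multiset.card J : ℂ) + 1)⁻¹ • curlPart μ J +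
    (-(m : ℂ) * (Multiset.card J : ℂ) / ((Multiset.card J : ℂ) + 1) ^ 2) •
      (etaPhi μ J - (2 * (Multiset.card J : ℂ))⁻¹ • etaEtaPhi μ J)

theorem vSymbol_trace (m : ℝ) (μ : Fin 4) (K : Multiset (Fin 4)) :
    ∑ κ, eta κ κ • vSymbol m μ (κ ::ₘ κ ::ₘ K) = 0 := by
  have hcoeff : (2 : ℂ) - (2 * ((Multiset.card K : ℂ) + 1 + 1))⁻¹ *
      (4 * ((Multiset.card K : ℂ) + 2)) = 0 := by
    have h : (Multiset.card K : ℂ) + 1 + 1 ≠ 0 := by norm_cast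
    field_simp
    ring
  simp only [vSymbol, Multiset.card_cons, smul_add, smul_sub, Finset.sum_add_distrib,
    Finset.sum_sub_distrib, smul_comm (eta _ _), ← Finset.smul_sum, curlPart_trace, etaPhi_trace,
    etaEtaPhi_trace, smul_zero, zero_add]
  rw [← smul_sub, smul_smul _ (4 * _), ← sub_smul]
  push_cast
  rw [hcoeff, zero_smul, smul_zero]

theorem vSymbol_div (m : ℝ) (I : Multiset (Fin 4)) :
    ∑ μ, eta μ μ • vSymbol m μ (μ ::ₘ I) = (-(m : ℂ)) • clsPhi I := by
  have h : (Multiset.card I : ℂ) + 1 ≠ 0 := by norm_cast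
  have h' : (Multiset.card I : ℂ) + 1 + 1 ≠ 0 := by norm_cast
  simp only [vSymbol, Multiset.card_cons, smul_add, smul_sub, Finset.sum_add_distrib,
    Finset.sum_sub_distrib, smul_comm (eta _ _), ← Finset.smul_sum, curlPart_div, etaPhi_div,
    etaEtaPhi_div, smul_zero, zero_add]
  rw [← smul_sub, smul_smul _ (2 * _), ← sub_smul, smul_smul]
  push_cast
  congr 1
  field_simp
  ring

/-! ## Weights of the symbols -/

/-- A weight which orders the symbols by the number of derivatives in their leading terms,
counting `m` as a derivative of half the order: this makes the terms with a trace, and those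
with an additional factor of `m`, lower order terms. -/
def Sym0.weight : Sym0 → ℕ
  | .F n _ => 2 * n + 3
  | .phi n _ => 2 * n + 4

/-- The span of the symbols of weight `≤ w`. -/
noncomputable def symLE (w : ℕ) : Submodule ℂ FormalP0 :=
  Submodule.span ℂ (Sym0.cls '' {s | s.weight ≤ w})

theorem cls_mem_symLE {s : Sym0} {w : ℕ} (h : s.weight ≤ w) : s.cls ∈ symLE w :=
  Submodule.subset_span (Set.mem_image_of_mem _ h)

theorem symLE_mono {w w' : ℕ} (h : w ≤ w') : symLE w ≤ symLE w' :=
  Submodule.span_mono (Set.image_mono fun _ hs => le_trans hs h)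

theorem clsF_mem_symLE (μ ν : Fin 4) (K : Multiset (Fin 4)) {w : ℕ}
    (h : 2 * Multiset.card K + 3 ≤ w) : clsF μ ν K ∈ symLE w := by
  obtain ⟨n, f, rfl⟩ : ∃ n, ∃ f : Fin n → Fin 4, idx f = K := ⟨_, exists_idx rfl⟩
  rw [card_idx] at h
  rw [← cls_F_vecCons]
  exact cls_mem_symLE h

theorem clsPhi_mem_symLE (K : Multiset (Fin 4)) {w : ℕ}
    (h : 2 * Multiset.card K + 2 ≤ w) : clsPhi K ∈ symLE w := by
  obtain ⟨_ | n, f, rfl⟩ : ∃ n, ∃ f : Fin n → Fin 4, idx f = K := ⟨_, exists_idx rfl⟩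
  · rw [Multiset.card_eq_zero.1 (card_idx f), clsPhi_zero]
    exact Submodule.zero_mem _
  · rw [card_idx] at h
    rw [show clsPhi (idx f) = (Sym0.phi n f).cls from
      (congrFun (cls_phi_eq_symmTensor n) f).symm]
    exact cls_mem_symLE (by simp only [Sym0.weight]; omega)

theorem curlPart_mem_symLE (μ : Fin 4) (J : Multiset (Fin 4)) {w : ℕ}
    (h : 2 * Multiset.card J + 1 ≤ w) : curlPart μ J ∈ symLE w :=
  eraseSum_mem fun ρ hρ => clsF_mem_symLE _ _ _ (by have := Multiset.card_erase_add_one hρ; omega)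

theorem etaPhi_mem_symLE (μ : Fin 4) (J : Multiset (Fin 4)) {w : ℕ}
    (h : 2 * Multiset.card J ≤ w) : etaPhi μ J ∈ symLE w :=
  eraseSum_mem fun ρ hρ => Submodule.smul_mem _ _ <|
    clsPhi_mem_symLE _ (by have := Multiset.card_erase_add_one hρ; omega)

theorem etaEtaPhi_mem_symLE (μ : Fin 4) (J : Multiset (Fin 4)) {w : ℕ}
    (h : 2 * Multiset.card J ≤ w) : etaEtaPhi μ J ∈ symLE w :=
  eraseSum_mem fun ρ hρ => eraseSum_mem fun σ hσ => Submodule.smul_mem _ _ <|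
    clsPhi_mem_symLE _ (by
      have := Multiset.card_erase_add_one hρ
      have := Multiset.card_erase_add_one hσ
      rw [Multiset.card_cons]; omega)

theorem vSymbol_sub_mem_symLE (m : ℝ) (μ : Fin 4) (J : Multiset (Fin 4)) {w : ℕ}
    (h : 2 * Multiset.card J ≤ w) :
    vSymbol m μ J - ((Multiset.card J : ℂ) + 1)⁻¹ • curlPart μ J ∈ symLE w := by
  rw [vSymbol, add_sub_cancel_left]
  exact Submodule.smul_mem _ _ (Submodule.sub_mem _ (etaPhi_mem_symLE _ _ h)
    (Submodule.smul_mem _ _ (etaEtaPhi_mem_symLE _ _ h)))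

theorem vSymbol_mem_symLE (m : ℝ) (μ : Fin 4) (J : Multiset (Fin 4)) {w : ℕ}
    (h : 2 * Multiset.card J + 1 ≤ w) : vSymbol m μ J ∈ symLE w :=
  (Submodule.sub_mem_iff_left _ (Submodule.smul_mem _ _ (curlPart_mem_symLE μ J h))).1
    (vSymbol_sub_mem_symLE m μ J (by omega))

theorem vSymbol_curl_sub_mem_symLE (m : ℝ) (μ ν : Fin 4) (K : Multiset (Fin 4)) :
    vSymbol m ν (μ ::ₘ K) - vSymbol m μ (ν ::ₘ K) - clsF μ ν K ∈
      symLE (2 * Multiset.card K + 2) := by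
  have h : (Multiset.card K : ℂ) + 2 ≠ 0 := by norm_cast
  have hF : clsF μ ν K = ((Multiset.card K : ℂ) + 1 + 1)⁻¹ •
      (curlPart ν (μ ::ₘ K) - curlPart μ (ν ::ₘ K)) := by
    rw [curlPart_curl, smul_smul, add_assoc, one_add_one_eq_two, inv_mul_cancel₀ h, one_smul]
  have hle : ∀ κ, 2 * Multiset.card (κ ::ₘ K) ≤ 2 * Multiset.card K + 2 := fun κ => by
    rw [Multiset.card_cons]; omega
  have := Submodule.sub_mem _ (vSymbol_sub_mem_symLE m ν (μ ::ₘ K) (hle μ))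
    (vSymbol_sub_mem_symLE m μ (ν ::ₘ K) (hle ν))
  simpa only [hF, smul_sub, sub_sub_sub_comm, Multiset.card_cons, Nat.cast_add, Nat.cast_one]

/-- The image of `v_{μ;J}`: the solution of the Klein-Gordon equation with the initial data
`vSymbol`. -/
noncomputable def vImage (m : ℝ) (μ : Fin 4) : Multiset (Fin 4) → FormalP0 :=
  kgExtend m (vSymbol m μ)

theorem vImage_sub_vSymbol_mem_symLE (m : ℝ) (μ : Fin 4) (J : Multiset (Fin 4)) :
    vImage m μ J - vSymbol m μ J ∈ symLE (2 * Multiset.card J - 1) := by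
  induction J using time_induction with
  | initial J h => rw [vImage, kgExtend_of_count_lt m _ h, sub_self]; exact Submodule.zero_mem _
  | step J ih ih' =>
    have e : vImage m μ (0 ::ₘ 0 ::ₘ J) - vSymbol m μ (0 ::ₘ 0 ::ₘ J) =
        (∑ i : Fin 3, (vImage m μ (i.succ ::ₘ i.succ ::ₘ J) -
          vSymbol m μ (i.succ ::ₘ i.succ ::ₘ J))) -
        (m : ℂ) ^ 2 • ((vImage m μ J - vSymbol m μ J) + vSymbol m μ J) := by
      have h := vSymbol_trace m μ J
      rw [sum_eta_self_smul, sub_eq_zero] at h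
      rw [Finset.sum_sub_distrib, ← h, vImage, kgExtend_cons_cons, sub_add_cancel]
      abel
    rw [e]
    simp only [Multiset.card_cons] at ih' ⊢
    exact Submodule.sub_mem _ (Submodule.sum_mem _ fun i _ => ih' i) (Submodule.smul_mem _ _
      (Submodule.add_mem _ (symLE_mono (by omega) ih) (vSymbol_mem_symLE _ _ _ (by omega))))

theorem vImage_mem_symLE (m : ℝ) (μ : Fin 4) (J : Multiset (Fin 4)) {w : ℕ}
    (h : 2 * Multiset.card J + 1 ≤ w) : vImage m μ J ∈ symLE w :=
  (Submodule.sub_mem_iff_left _ (vSymbol_mem_symLE m μ J h)).1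
    (symLE_mono (by omega) (vImage_sub_vSymbol_mem_symLE m μ J))

/-- The images of the jet variables in the formal polynomials. That of `Φ_J` makes the image of
`Cjet m J` vanish. -/
noncomputable def jetImage (m : ℝ) : Jet → FormalP0
  | (.v μ, J) => vImage m μ J
  | (.Phi, J) => (-(m : ℂ)⁻¹) • ∑ μ, eta μ μ • vImage m μ (μ ::ₘ J)
  | (.u, _) => 0
  | (.ut, _) => 0

section KleinGordon

variable {M : Type*} [AddCommGroup M] [Module ℂ M] {m : ℝ}

theorem KleinGordon.zero : KleinGordon m fun _ => (0 : M) := fun J => by simp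

theorem KleinGordon.const_smul {f : Multiset (Fin 4) → M} (hf : KleinGordon m f) (c : ℂ) :
    KleinGordon m fun J => c • f J := fun J => by
  simp only [smul_comm _ c, ← Finset.smul_sum, ← smul_add, hf J, smul_zero]

theorem KleinGordon.sum {ι : Type*} {s : Finset ι} {f : ι → Multiset (Fin 4) → M}
    (hf : ∀ i ∈ s, KleinGordon m (f i)) : KleinGordon m fun J => ∑ i ∈ s, f i J := fun J => by
  simp only [Finset.smul_sum]
  rw [Finset.sum_comm, ← Finset.sum_add_distrib]
  exact Finset.sum_eq_zero fun i hi => hf i hi J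

theorem KleinGordon.cons {f : Multiset (Fin 4) → M} (hf : KleinGordon m f) (κ : Fin 4) :
    KleinGordon m fun J => f (κ ::ₘ J) := fun J => by
  simpa only [Multiset.cons_swap κ] using hf (κ ::ₘ J)

end KleinGordon

theorem jetImage_kleinGordon (m : ℝ) (α : Fld) : KleinGordon m fun J => jetImage m (α, J) := by
  have hv : ∀ μ, KleinGordon m (vImage m μ) := fun μ => kleinGordon_kgExtend m _
  cases α with
  | v μ => exact hv μ
  | Phi => exact (KleinGordon.sum fun μ _ => ((hv μ).cons μ).const_smul _).const_smul _
  | u => exact KleinGordon.zero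
  | ut => exact KleinGordon.zero

theorem jetImage_rel (m : ℝ) ⦃x y : FreeAlgebra ℂ Jet⦄ (h : Rel m x y) :
    FreeAlgebra.lift ℂ (jetImage m) x = FreeAlgebra.lift ℂ (jetImage m) y := by
  induction h with
  | comm a b =>
    obtain ⟨α, J⟩ := a
    obtain ⟨β, K⟩ := b
    cases α <;> cases β <;> simp [Fld.parity, jetImage, mul_comm]
  | kleinGordon α J => simpa using jetImage_kleinGordon m α J

/-- The algebra homomorphism from `𝒫` to the formal polynomials with the values `jetImage` on the
variables. -/
noncomputable def toFormal (m : ℝ) : Poly m →ₐ[ℂ] FormalP0 :=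
  Poly.lift m (jetImage m) (jetImage_rel m)

@[simp]
theorem toFormal_jet (m : ℝ) (a : Jet) : toFormal m (jet m a) = jetImage m a := by
  rw [toFormal, jet, Poly.lift_mk, FreeAlgebra.lift_ι_apply]

section ToFormal

variable {m : ℝ}

theorem toFormal_Cjet (hm : m ≠ 0) (J : Multiset (Fin 4)) : toFormal m (Cjet m J) = 0 := by
  simp only [Cjet, map_add, map_sum, map_smul, toFormal_jet, jetImage]
  rw [smul_smul, mul_neg, mul_inv_cancel₀ (Complex.ofReal_ne_zero.2 hm), neg_one_smul,
    add_neg_cancel]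

theorem toFormal_dQ (hm : m ≠ 0) (p : Poly m) : toFormal m (dQ m p) = 0 := by
  induction p using poly_induction m with
  | h1 c => simp [dQ_algebraMap]
  | hj a =>
    obtain ⟨α, J⟩ := a
    rw [dQ_jet]
    cases α <;> simp [dQGen, jetImage, toFormal_Cjet hm]
  | hm p q hp hq => simp [dQ_mul, hp, hq]
  | ha p q hp hq => simp [hp, hq]

end ToFormal

/-! ## The weight filtration -/

section WeightLE

variable {G G' A B : Type} [Semiring A] [Algebra ℂ A] [Semiring B] [Algebra ℂ B] {gen : G → A}
  {w : G → ℕ} {gen' : G' → A} {w' : G' → ℕ} {i j n : ℤ} {a b : A}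

theorem prod_mem_weightLE (L : List G) : (L.map gen).prod ∈ weightLE gen w (L.map w).sum :=
  Submodule.subset_span ⟨L, le_rfl, rfl⟩

theorem weightLE_le_iff {Y : Submodule ℂ A} :
    weightLE gen w n ≤ Y ↔ ∀ L : List G, ((L.map w).sum : ℤ) ≤ n → (L.map gen).prod ∈ Y := by
  rw [weightLE, Submodule.span_le]
  exact ⟨fun h L hL => h ⟨L, hL, rfl⟩, by rintro h _ ⟨L, hL, rfl⟩; exact h L hL⟩

theorem weightLE_mono (h : i ≤ j) : weightLE gen w i ≤ weightLE gen w j :=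
  Submodule.span_mono fun _ ⟨L, hL, e⟩ => ⟨L, hL.trans h, e⟩

theorem gen_mem_weightLE (g : G) : gen g ∈ weightLE gen w (w g) := by
  simpa using prod_mem_weightLE (gen := gen) (w := w) [g]

theorem one_mem_weightLE : (1 : A) ∈ weightLE gen w 0 := by
  simpa using prod_mem_weightLE (gen := gen) (w := w) []

theorem mul_mem_weightLE (ha : a ∈ weightLE gen w i) (hb : b ∈ weightLE gen w j) :
    a * b ∈ weightLE gen w (i + j) := by
  suffices h : weightLE gen w i * weightLE gen w j ≤ weightLE gen w (i + j) from
    h (Submodule.mul_mem_mul ha hb)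
  rw [weightLE, weightLE, Submodule.span_mul_span, Submodule.span_le]
  rintro _ ⟨_, ⟨L, hL, rfl⟩, _, ⟨L', hL', rfl⟩, rfl⟩
  refine Submodule.subset_span ⟨L ++ L', ?_, by simp⟩
  simpa using add_le_add hL hL'

theorem weightLE_le_of_gen (h : ∀ g, gen' g ∈ weightLE gen w (w' g)) (n : ℤ) :
    weightLE gen' w' n ≤ weightLE gen w n := by
  refine weightLE_le_iff.2 fun L hL => weightLE_mono hL ?_
  clear hL
  induction L with
  | nil => simpa using one_mem_weightLE
  | cons g L ih => simpa using mul_mem_weightLE (h g) ih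

theorem map_mem_weightLE (f : A →ₐ[ℂ] B) (ha : a ∈ weightLE gen w n) :
    f a ∈ weightLE (fun g => f (gen g)) w n := by
  suffices h : weightLE gen w n ≤ (weightLE (fun g => f (gen g)) w n).comap f.toLinearMap from h ha
  refine weightLE_le_iff.2 fun L hL => Submodule.subset_span ⟨L, hL, ?_⟩
  rw [AlgHom.toLinearMap_apply, map_list_prod, List.map_map]
  rfl

theorem weightLE_of_neg (hn : n < 0) : weightLE gen w n = ⊥ :=
  eq_bot_iff.2 <| weightLE_le_iff.2 fun L hL => absurd hL (by omega)

theorem exists_mem_weightLE (h : Algebra.adjoin ℂ (Set.range gen) = ⊤) (a : A) :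
    ∃ n : ℕ, a ∈ weightLE gen w n := by
  have ha : a ∈ Algebra.adjoin ℂ (Set.range gen) := h ▸ Algebra.mem_top
  induction ha using Algebra.adjoin_induction with
  | mem x hx => obtain ⟨g, rfl⟩ := hx; exact ⟨_, gen_mem_weightLE g⟩
  | algebraMap r =>
    exact ⟨0, Algebra.algebraMap_eq_smul_one (A := A) r ▸ Submodule.smul_mem _ _ one_mem_weightLE⟩
  | add x y _ _ hx hy =>
    obtain ⟨i, hi⟩ := hx
    obtain ⟨j, hj⟩ := hy
    exact ⟨max i j, Submodule.add_mem _ (weightLE_mono (by simp) hi) (weightLE_mono (by simp) hj)⟩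
  | mul x y _ _ hx hy =>
    obtain ⟨i, hi⟩ := hx
    obtain ⟨j, hj⟩ := hy
    exact ⟨i + j, by push_cast; exact mul_mem_weightLE hi hj⟩

end WeightLE

/-! ## The embedding of the formal polynomials -/

section Center

variable {m : ℝ}

/-- The linear combinations of jet variables of parity `ε`. -/
noncomputable def parityPart (m : ℝ) (ε : ℕ) : Submodule ℂ (JetSpace m) :=
  Submodule.span ℂ (jv m '' {a | a.1.parity = ε})

theorem jv_mem_parityPart (m : ℝ) (a : Jet) : jv m a ∈ parityPart m a.1.parity :=
  Submodule.subset_span ⟨a, rfl, rfl⟩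

theorem toPoly_mul_jet {ε : ℕ} {x : JetSpace m} (hx : x ∈ parityPart m ε) (b : Jet) :
    toPoly m x * jet m b = (-1 : ℂ) ^ (ε * b.1.parity) • (jet m b * toPoly m x) := by
  induction hx using Submodule.span_induction with
  | mem x hx =>
    obtain ⟨a, rfl, rfl⟩ := hx
    simpa using jet_comm m a b
  | zero => simp
  | add x y _ _ hx hy => rw [map_add, add_mul, mul_add, hx, hy, smul_add]
  | smul c x _ hx => rw [map_smul, smul_mul_assoc, hx, mul_smul_comm, smul_comm]

theorem toPoly_mem_center {x : JetSpace m} (hx : x ∈ parityPart m 0) :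
    toPoly m x ∈ Subalgebra.center ℂ (Poly m) := by
  rw [Subalgebra.mem_center_iff]
  intro p
  induction p using poly_induction m with
  | h1 c => exact Algebra.commutes c _
  | hj a => simpa using (toPoly_mul_jet hx a).symm
  | hm p q hp hq => rw [mul_assoc, hq, ← mul_assoc, hp, mul_assoc]
  | ha p q hp hq => rw [add_mul, mul_add, hp, hq]

end Center

/-- The linear combination `v_{ν;μK} - v_{μ;νK}` of jet variables, so that `F_{μν;ρ₁…ρₙ}` is
`curlVec m μ ν {ρ₁, …, ρₙ}`. -/
noncomputable def curlVec (m : ℝ) (μ ν : Fin 4) (K : Multiset (Fin 4)) : JetSpace m :=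
  jv m (.v ν, μ ::ₘ K) - jv m (.v μ, ν ::ₘ K)

/-- The linear combination `g_K` of jet variables, with `g_∅ = 0`. -/
noncomputable def gVec (m : ℝ) (K : Multiset (Fin 4)) : JetSpace m :=
  (Multiset.card K : ℂ)⁻¹ • eraseSum (fun ρ L => jv m (.v ρ, L)) K

/-- The linear combination `φ_K` of jet variables. -/
noncomputable def phiVec (m : ℝ) (K : Multiset (Fin 4)) : JetSpace m :=
  jv m (.Phi, K) - (m : ℂ) • gVec m K

/-- The linear combination of jet variables denoted by a symbol. -/
noncomputable def Sym0.vec (m : ℝ) : Sym0 → JetSpace m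
  | .F n I => tlProj (twoFormTensor (curlVec m) n) I
  | .phi n I => tlProj (symmTensor (phiVec m) (n + 1)) I

section SymbolVectors

variable (m : ℝ) {n : ℕ}

theorem toPoly_twoFormTensor_curlVec (n : ℕ) :
    (fun I => toPoly m (twoFormTensor (curlVec m) n I)) = fieldStrength m n := by
  funext I
  simp only [twoFormTensor, curlVec, fieldStrength, map_sub, toPoly_jv]

theorem toPoly_symmTensor_phiVec (n : ℕ) :
    (fun I => toPoly m (symmTensor (phiVec m) n I)) = phiTensor m n := by
  funext I
  have h : eraseSum (fun ρ L => jv m (.v ρ, L)) (idx I) =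
      ∑ l, jv m (.v (I l), (Finset.univ.erase l).val.map I) := by
    simp only [eraseSum, map_univ_erase]
    rw [idx, Multiset.map_map]
    rfl
  simp only [symmTensor, phiVec, gVec, phiTensor, gTensor, h, card_idx, map_sub, map_smul, map_sum,
    toPoly_jv]

theorem toPoly_vec (s : Sym0) : toPoly m (s.vec m) = s.val m := by
  cases s with
  | F n I =>
    rw [Sym0.val, tracelessPart_eq_tlProj, ← toPoly_twoFormTensor_curlVec, map_tlProj, Sym0.vec]
  | phi n I =>
    rw [Sym0.val, tracelessPart_eq_tlProj, ← toPoly_symmTensor_phiVec, map_tlProj, Sym0.vec]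

theorem vec_mem_parityPart (s : Sym0) : s.vec m ∈ parityPart m 0 := by
  have hv : ∀ μ J, jv m (.v μ, J) ∈ parityPart m 0 := fun μ J => jv_mem_parityPart m (.v μ, J)
  have hPhi : ∀ J, jv m (.Phi, J) ∈ parityPart m 0 := fun J => jv_mem_parityPart m (.Phi, J)
  cases s with
  | F n I => exact tlProj_mem (fun I => Submodule.sub_mem _ (hv _ _) (hv _ _)) I
  | phi n I =>
    exact tlProj_mem (fun I => Submodule.sub_mem _ (hPhi _) (Submodule.smul_mem _ _
      (Submodule.smul_mem _ _ (eraseSum_mem fun ρ _ => hv _ _)))) I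

theorem val_mem_center (s : Sym0) : s.val m ∈ Subalgebra.center ℂ (Poly m) :=
  toPoly_vec m s ▸ toPoly_mem_center (vec_mem_parityPart m s)

theorem vec_F_antisymm (I : Fin (n + 2) → Fin 4) :
    (Sym0.F n I).vec m + (Sym0.F n (I ∘ Equiv.swap 0 1)).vec m = 0 := by
  have h : twoFormTensor (curlVec m) n +
      (fun I => twoFormTensor (curlVec m) n (I ∘ Equiv.swap 0 1)) = 0 := by
    funext J
    rw [Pi.add_apply, twoFormTensor_comp_swap_zero_one, twoFormTensor, curlVec, curlVec,
      sub_add_sub_cancel, sub_self, Pi.zero_apply]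
  have h' := congrArg tlProj h
  rw [map_add, map_zero, tlProj_comp_perm] at h'
  exact congrFun h' I

theorem vec_F_comp_swap (I : Fin (n + 2) → Fin 4) (i j : Fin n) :
    (Sym0.F n (I ∘ Equiv.swap i.succ.succ j.succ.succ)).vec m = (Sym0.F n I).vec m := by
  have h : (fun I => twoFormTensor (curlVec m) n (I ∘ Equiv.swap i.succ.succ j.succ.succ)) =
      twoFormTensor (curlVec m) n := funext fun J => twoFormTensor_comp_swap _ J i j
  exact (congrFun (tlProj_comp_perm _ _) I).symm.trans (congrFun (congrArg tlProj h) I)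

theorem vec_phi_comp_swap (I : Fin (n + 1) → Fin 4) (i j : Fin (n + 1)) :
    (Sym0.phi n (I ∘ Equiv.swap i j)).vec m = (Sym0.phi n I).vec m := by
  have h : (fun I => symmTensor (phiVec m) (n + 1) (I ∘ Equiv.swap i j)) =
      symmTensor (phiVec m) (n + 1) := funext fun J => congrArg (phiVec m) (idx_comp_perm J _)
  exact (congrFun (tlProj_comp_perm _ _) I).symm.trans (congrFun (congrArg tlProj h) I)

theorem vec_bianchi (μ ν ρ : Fin 4) (τ : Fin n → Fin 4) :
    (Sym0.F (n + 1) (Matrix.vecCons μ (Matrix.vecCons ν (Matrix.vecCons ρ τ)))).vec m +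
    (Sym0.F (n + 1) (Matrix.vecCons ν (Matrix.vecCons ρ (Matrix.vecCons μ τ)))).vec m +
    (Sym0.F (n + 1) (Matrix.vecCons ρ (Matrix.vecCons μ (Matrix.vecCons ν τ)))).vec m = 0 := by
  obtain ⟨σ, hσ⟩ := exists_perm_vecCons_rotate (Fin 4) n
  let T := twoFormTensor (curlVec m) (n + 1)
  have hT : T + (fun I => T (I ∘ σ)) + (fun I => T (I ∘ σ ∘ σ)) = 0 := by
    funext J
    obtain ⟨a, b, c, τ, rfl⟩ : ∃ a b c τ,
        J = Matrix.vecCons a (Matrix.vecCons b (Matrix.vecCons c τ)) :=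
      ⟨J 0, J 1, J 2, _, ((congrArg _ (congrArg _ (Matrix.cons_head_tail _))).trans
        (vecCons_vecCons_tail_tail J)).symm⟩
    simp only [T, Pi.add_apply, ← Function.comp_assoc, hσ, twoFormTensor_vecCons, idx_vecCons,
      curlVec, Multiset.cons_swap a, Multiset.cons_swap c b, Pi.zero_apply]
    abel
  have hσσ : tlProj (fun I => T (I ∘ σ ∘ σ)) = fun I => tlProj T (I ∘ σ ∘ σ) :=
    tlProj_comp_perm (σ * σ) T
  have h := congrArg tlProj hT
  rw [map_add, map_add, map_zero, tlProj_comp_perm, hσσ] at h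
  have h' := congrFun h (Matrix.vecCons μ (Matrix.vecCons ν (Matrix.vecCons ρ τ)))
  simp only [Pi.add_apply, ← Function.comp_assoc, hσ] at h'
  exact h'

theorem sum_eta_smul_vec_F_update (I : Fin (n + 2) → Fin 4) {i j : Fin (n + 2)} (hij : i ≠ j) :
    ∑ μ, eta μ μ • (Sym0.F n (Function.update (Function.update I i μ) j μ)).vec m = 0 :=
  congrFun (mem_tracelessTensors.1 (tlProj_mem_tracelessTensors _) i j hij) I

theorem sum_eta_smul_vec_phi_update (I : Fin (n + 1) → Fin 4) {i j : Fin (n + 1)} (hij : i ≠ j) :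
    ∑ μ, eta μ μ • (Sym0.phi n (Function.update (Function.update I i μ) j μ)).vec m = 0 :=
  congrFun (mem_tracelessTensors.1 (tlProj_mem_tracelessTensors _) i j hij) I

end SymbolVectors

section OfFormal

variable (m : ℝ)

/-- The evaluation of polynomials in the symbols. -/
noncomputable def evalSym : MvPolynomial Sym0 ℂ →ₐ[ℂ] Subalgebra.center ℂ (Poly m) :=
  MvPolynomial.aeval fun s => ⟨s.val m, val_mem_center m s⟩

theorem evalSym_X (s : Sym0) : (evalSym m (MvPolynomial.X s) : Poly m) = toPoly m (s.vec m) := by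
  simp [evalSym, toPoly_vec]

theorem evalSym_eq_zero_of_tensorRel {x : MvPolynomial Sym0 ℂ} (h : TensorRel x) :
    evalSym m x = 0 := by
  apply Subtype.ext
  cases h with
  | F_antisymm n I => simpa [evalSym_X] using congrArg (toPoly m) (vec_F_antisymm m I)
  | F_symm n I i j => simp [evalSym_X, vec_F_comp_swap]
  | F_trace n I i j h =>
    simpa [evalSym_X] using congrArg (toPoly m) (sum_eta_smul_vec_F_update m I h)
  | phi_symm n I i j => simp [evalSym_X, vec_phi_comp_swap]
  | phi_trace n I i j h =>
    simpa [evalSym_X] using congrArg (toPoly m) (sum_eta_smul_vec_phi_update m I h)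

theorem evalSym_eq_zero_of_bianchiRel {x : MvPolynomial Sym0 ℂ} (h : BianchiRel x) :
    evalSym m x = 0 := by
  obtain ⟨n, μ, ν, ρ, τ⟩ := h
  exact Subtype.ext (by simpa [evalSym_X] using congrArg (toPoly m) (vec_bianchi m μ ν ρ τ))

theorem evalSym_eq_zero {x : MvPolynomial Sym0 ℂ} (hx : x ∈ bianchiIdeal) : evalSym m x = 0 := by
  suffices h : bianchiIdeal ≤ RingHom.ker (evalSym m) from h hx
  exact sup_le (Ideal.span_le.2 fun _ => evalSym_eq_zero_of_tensorRel m)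
    (Ideal.span_le.2 fun _ => evalSym_eq_zero_of_bianchiRel m)

/-- The embedding of the formal polynomials into `𝒫`. -/
noncomputable def ofFormal : FormalP0 →ₐ[ℂ] Poly m :=
  (Subalgebra.center ℂ (Poly m)).val.comp
    (Ideal.Quotient.liftₐ bianchiIdeal (evalSym m) fun _ => evalSym_eq_zero m)

@[simp]
theorem ofFormal_cls (s : Sym0) : ofFormal m s.cls = s.val m :=
  (evalSym_X m s).trans (toPoly_vec m s)

theorem adjoin_cls : Algebra.adjoin ℂ (Set.range Sym0.cls) = ⊤ := by
  rw [show Sym0.cls = Ideal.Quotient.mkₐ ℂ bianchiIdeal ∘ MvPolynomial.X from rfl, Set.range_comp,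
    ← AlgHom.map_adjoin, MvPolynomial.adjoin_range_X, Algebra.map_top, AlgHom.range_eq_top]
  exact Ideal.Quotient.mkₐ_surjective ℂ _

theorem ofFormal_range : (ofFormal m).range = P0 m := by
  rw [← Algebra.map_top, ← adjoin_cls, AlgHom.map_adjoin, ← Set.range_comp, P0]
  congr 2
  funext s
  exact ofFormal_cls m s

end OfFormal

/-! ## Injectivity in cohomology -/

section Injectivity

variable {m : ℝ}

theorem toFormal_toPoly_tlProj_sub_mem {k : ℕ} {T : TensorIn (JetSpace m) k}
    {T' : TensorIn FormalP0 k} {Y : Submodule ℂ FormalP0} (hT' : T' ∈ tracelessTensors FormalP0 k)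
    (h : ∀ I, toFormal m (toPoly m (T I)) - T' I ∈ Y) (I : Fin k → Fin 4) :
    toFormal m (toPoly m (tlProj T I)) - T' I ∈ Y := by
  let f : JetSpace m →ₗ[ℂ] FormalP0 := (toFormal m).toLinearMap ∘ₗ toPoly m
  have hsub := tlProj_mem (T := (fun I => f (T I)) - T') h I
  rwa [map_sub, map_tlProj, tlProj_of_mem hT'] at hsub

theorem toFormal_toPoly_curlVec_sub_mem (μ ν : Fin 4) (K : Multiset (Fin 4)) :
    toFormal m (toPoly m (curlVec m μ ν K)) - clsF μ ν K ∈ symLE (2 * Multiset.card K + 2) := by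
  have hle : ∀ α β, vImage m α (β ::ₘ K) - vSymbol m α (β ::ₘ K) ∈
      symLE (2 * Multiset.card K + 2) := fun α β =>
    symLE_mono (by rw [Multiset.card_cons]; omega) (vImage_sub_vSymbol_mem_symLE m α _)
  have h := Submodule.add_mem _ (Submodule.sub_mem _ (hle ν μ) (hle μ ν))
    (vSymbol_curl_sub_mem_symLE m μ ν K)
  rw [sub_sub_sub_comm, sub_add_sub_cancel] at h
  simpa only [curlVec, map_sub, toPoly_jv, toFormal_jet, jetImage] using h

theorem toFormal_toPoly_gVec_mem {K : Multiset (Fin 4)} {w : ℕ} (h : 2 * Multiset.card K ≤ w + 1) :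
    toFormal m (toPoly m (gVec m K)) ∈ symLE w := by
  suffices hg : gVec m K ∈ (symLE w).comap ((toFormal m).toLinearMap ∘ₗ toPoly m) from hg
  refine Submodule.smul_mem _ _ (eraseSum_mem fun ρ hρ => ?_)
  rw [Submodule.mem_comap, LinearMap.comp_apply, toPoly_jv, AlgHom.toLinearMap_apply, toFormal_jet]
  have := Multiset.card_erase_add_one hρ
  exact vImage_mem_symLE m _ _ (by omega)

theorem toFormal_toPoly_phiVec_sub_mem (hm : m ≠ 0) (K : Multiset (Fin 4)) :
    toFormal m (toPoly m (phiVec m K)) - clsPhi K ∈ symLE (2 * Multiset.card K + 1) := by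
  have hPhi : jetImage m (.Phi, K) - clsPhi K =
      (-(m : ℂ)⁻¹) • ∑ μ, eta μ μ • (vImage m μ (μ ::ₘ K) - vSymbol m μ (μ ::ₘ K)) := by
    simp only [jetImage, smul_sub (eta _ _), Finset.sum_sub_distrib, vSymbol_div]
    rw [smul_sub, smul_smul, neg_mul_neg, inv_mul_cancel₀ (Complex.ofReal_ne_zero.2 hm), one_smul]
  rw [phiVec, map_sub, map_sub, map_smul, map_smul, toPoly_jv, toFormal_jet, sub_right_comm, hPhi]
  refine Submodule.sub_mem _ (Submodule.smul_mem _ _ (Submodule.sum_mem _ fun μ _ =>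
    Submodule.smul_mem _ _ (symLE_mono ?_ (vImage_sub_vSymbol_mem_symLE m μ _))))
    (Submodule.smul_mem _ _ (toFormal_toPoly_gVec_mem (by omega)))
  rw [Multiset.card_cons]
  omega

theorem toFormal_val_sub_cls_mem (hm : m ≠ 0) (s : Sym0) :
    toFormal m (s.val m) - s.cls ∈ symLE (s.weight - 1) := by
  rw [← toPoly_vec]
  cases s with
  | F n I =>
    refine toFormal_toPoly_tlProj_sub_mem (cls_F_mem_tracelessTensors n) (fun I => ?_) I
    have h := toFormal_toPoly_curlVec_sub_mem (m := m) (I 0) (I 1) (idx fun l => I l.succ.succ)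
    rw [card_idx] at h
    rwa [congrFun (cls_F_eq_twoFormTensor n) I]
  | phi n I =>
    refine toFormal_toPoly_tlProj_sub_mem (cls_phi_mem_tracelessTensors n) (fun I => ?_) I
    have h := toFormal_toPoly_phiVec_sub_mem hm (idx I)
    rw [card_idx] at h
    rwa [congrFun (cls_phi_eq_symmTensor n) I]

theorem symLE_le_weightLE (w : ℕ) : symLE w ≤ weightLE Sym0.cls Sym0.weight w := by
  refine Submodule.span_le.2 ?_
  rintro _ ⟨s, hs, rfl⟩
  exact weightLE_mono (Nat.cast_le.2 hs) (gen_mem_weightLE s)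

theorem toFormal_ofFormal_prod_sub_mem (hm : m ≠ 0) (L : List Sym0) :
    toFormal m (ofFormal m (L.map Sym0.cls).prod) - (L.map Sym0.cls).prod ∈
      weightLE Sym0.cls Sym0.weight ((L.map Sym0.weight).sum - 1) := by
  induction L with
  | nil => simp
  | cons s L ih =>
    have hs : toFormal m (s.val m) - s.cls ∈
        weightLE Sym0.cls Sym0.weight ((s.weight : ℤ) - 1) := by
      have h : 1 ≤ s.weight := by cases s <;> simp only [Sym0.weight] <;> omega
      rw [← Nat.cast_one, ← Nat.cast_sub h]
      exact symLE_le_weightLE _ (toFormal_val_sub_cls_mem hm s)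
    have hL : toFormal m (ofFormal m (L.map Sym0.cls).prod) ∈
        weightLE Sym0.cls Sym0.weight (L.map Sym0.weight).sum :=
      (Submodule.sub_mem_iff_left _ (prod_mem_weightLE L)).1 (weightLE_mono (by omega) ih)
    simp only [List.map_cons, List.prod_cons, List.sum_cons, map_mul, ofFormal_cls, Nat.cast_add]
    rw [← sub_add_sub_cancel _ (s.cls * toFormal m (ofFormal m (L.map Sym0.cls).prod)), ← sub_mul,
      ← mul_sub]
    exact Submodule.add_mem _ (weightLE_mono (by omega) (mul_mem_weightLE hs hL))
      (weightLE_mono (by omega) (mul_mem_weightLE (gen_mem_weightLE s) ih))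

theorem toFormal_ofFormal_sub_mem (hm : m ≠ 0) {n : ℤ} {a : FormalP0}
    (ha : a ∈ weightLE Sym0.cls Sym0.weight n) :
    toFormal m (ofFormal m a) - a ∈ weightLE Sym0.cls Sym0.weight (n - 1) := by
  let f : FormalP0 →ₗ[ℂ] FormalP0 := ((toFormal m).comp (ofFormal m)).toLinearMap - LinearMap.id
  suffices h : weightLE Sym0.cls Sym0.weight n ≤
    (weightLE Sym0.cls Sym0.weight (n - 1)).comap f from h ha
  exact weightLE_le_iff.2 fun L hL =>
    weightLE_mono (by omega) (toFormal_ofFormal_prod_sub_mem hm L)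

theorem toFormal_ofFormal_injective (hm : m ≠ 0) :
    Function.Injective ((toFormal m).comp (ofFormal m)) := by
  rw [injective_iff_map_eq_zero]
  intro a ha
  suffices h : ∀ n : ℕ, a ∈ weightLE Sym0.cls Sym0.weight ((n : ℤ) - 1) → a = 0 by
    obtain ⟨n, hn⟩ := exists_mem_weightLE (w := Sym0.weight) adjoin_cls a
    exact h (n + 1) (by simpa using hn)
  intro n
  induction n with
  | zero => simp [weightLE_of_neg]
  | succ n ih =>
    intro h
    have hlower := toFormal_ofFormal_sub_mem hm h
    rw [← AlgHom.comp_apply, ha, zero_sub, neg_mem_iff] at hlower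
    exact ih (by simpa using hlower)

theorem eq_zero_of_ofFormal_eq_dQ (hm : m ≠ 0) {a : FormalP0} {q : Poly m}
    (h : ofFormal m a = dQ m q) : a = 0 := by
  refine (injective_iff_map_eq_zero _).1 (toFormal_ofFormal_injective hm) a ?_
  rw [AlgHom.comp_apply, h, toFormal_dQ hm]

end Injectivity

/-! ## Odd derivations -/

section OddDerivation

variable {m : ℝ}

/-- Odd graded derivations of `𝒫`. -/
structure IsOddDerivation (δ : Poly m →ₗ[ℂ] Poly m) : Prop where
  mul : ∀ p q, δ (p * q) = δ p * q + parityAut m p * δ q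
  parity : ∀ p, δ (parityAut m p) = -parityAut m (δ p)

theorem neg_one_pow_mul_self (n : ℕ) : (-1 : ℂ) ^ n * (-1) ^ n = 1 := by
  rw [← mul_pow, neg_one_mul, neg_neg, one_pow]

theorem parityAut_parityAut (p : Poly m) : parityAut m (parityAut m p) = p := by
  induction p using poly_induction m with
  | h1 c => simp
  | hj a => simp [parityAut_jet, smul_smul, neg_one_pow_mul_self]
  | hm p q hp hq => simp [hp, hq]
  | ha p q hp hq => simp [hp, hq]

theorem parityAut_toPoly {ε : ℕ} {x : JetSpace m} (hx : x ∈ parityPart m ε) :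
    parityAut m (toPoly m x) = (-1 : ℂ) ^ ε • toPoly m x := by
  induction hx using Submodule.span_induction with
  | mem x hx =>
    obtain ⟨a, rfl, rfl⟩ := hx
    rw [toPoly_jv, parityAut_jet]
  | zero => simp
  | add x y _ _ hx hy => rw [map_add, map_add, hx, hy, smul_add]
  | smul c x _ hx => rw [map_smul, map_smul, hx, smul_comm]

theorem IsOddDerivation.map_one {δ : Poly m →ₗ[ℂ] Poly m} (h : IsOddDerivation δ) : δ 1 = 0 := by
  simpa using h.mul 1 1

theorem IsOddDerivation.anticomm_mul {δ ε : Poly m →ₗ[ℂ] Poly m} (hδ : IsOddDerivation δ)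
    (hε : IsOddDerivation ε) (p q : Poly m) :
    δ (ε (p * q)) + ε (δ (p * q)) =
      (δ (ε p) + ε (δ p)) * q + p * (δ (ε q) + ε (δ q)) := by
  simp only [hδ.mul, hε.mul, map_add, hδ.parity, hε.parity, parityAut_parityAut]
  noncomm_ring

theorem Fld.parity_eq_zero_or_one (α : Fld) : α.parity = 0 ∨ α.parity = 1 := by
  cases α <;> simp [Fld.parity]

/-- The linear endomorphisms of the space of jet variables which change the parity. -/
def IsOdd (L : JetSpace m →ₗ[ℂ] JetSpace m) : Prop :=
  ∀ a, L (jv m a) ∈ parityPart m (1 - a.1.parity)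

theorem IsOdd.map_mem {L : JetSpace m →ₗ[ℂ] JetSpace m} (hL : IsOdd L) {ε : ℕ} {x : JetSpace m}
    (hx : x ∈ parityPart m ε) : L x ∈ parityPart m (1 - ε) := by
  suffices h : parityPart m ε ≤ (parityPart m (1 - ε)).comap L from h hx
  refine Submodule.span_le.2 ?_
  rintro _ ⟨a, rfl, rfl⟩
  exact hL a

theorem isOddDerivation_of_jet {δ : Poly m →ₗ[ℂ] Poly m}
    (hmul : ∀ p q, δ (p * q) = δ p * q + parityAut m p * δ q)
    {L : JetSpace m →ₗ[ℂ] JetSpace m} (hL : IsOdd L)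
    (hδ : ∀ a, δ (jet m a) = toPoly m (L (jv m a))) : IsOddDerivation δ := by
  refine ⟨hmul, fun p => ?_⟩
  induction p using poly_induction m with
  | h1 c =>
    have h1 : δ 1 = 0 := by simpa using hmul 1 1
    simp [Algebra.algebraMap_eq_smul_one, h1]
  | hj a =>
    rw [parityAut_jet, map_smul, hδ, parityAut_toPoly (hL a), ← neg_smul]
    rcases a.1.parity_eq_zero_or_one with h | h <;> simp [h]
  | hm p q hp hq =>
    simp only [hmul, map_mul, map_add, hp, hq, parityAut_parityAut]
    noncomm_ring
  | ha p q hp hq => simp only [map_add, hp, hq, neg_add]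

/-- The matrix `[[parity x, L x], [0, x]]`. As for `dQMat`, extending it multiplicatively amounts
to extending `L` as an odd derivation. -/
noncomputable def oddMat (L : JetSpace m →ₗ[ℂ] JetSpace m) :
    JetSpace m →ₗ[ℂ] Matrix (Fin 2) (Fin 2) (Poly m) where
  toFun x := !![parityAut m (toPoly m x), toPoly m (L x); 0, toPoly m x]
  map_add' x y := by simp
  map_smul' c x := by simp

theorem oddMat_mul_comm {L : JetSpace m →ₗ[ℂ] JetSpace m} (hL : IsOdd L) (a b : Jet) :
    oddMat L (jv m a) * oddMat L (jv m b) =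
      (-1 : ℂ) ^ (a.1.parity * b.1.parity) • (oddMat L (jv m b) * oddMat L (jv m a)) := by
  have hab := jet_comm m a b
  have hLa := toPoly_mul_jet (hL a) b
  have hLb := toPoly_mul_jet (hL b) a
  simp only [oddMat, LinearMap.coe_mk, AddHom.coe_mk, toPoly_jv, Matrix.mul_fin_two, parityAut_jet,
    hLa, hLb]
  rcases a.1.parity_eq_zero_or_one with ha | ha <;>
    rcases b.1.parity_eq_zero_or_one with hb | hb <;>
      simp [ha, hb, hab, add_comm]

theorem lift_oddMat_eq_of_rel {L : JetSpace m →ₗ[ℂ] JetSpace m} (hL : IsOdd L)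
    {x y : FreeAlgebra ℂ Jet} (h : Rel m x y) :
    FreeAlgebra.lift ℂ (fun a => oddMat L (jv m a)) x =
      FreeAlgebra.lift ℂ (fun a => oddMat L (jv m a)) y := by
  induction h with
  | comm a b => simpa using oddMat_mul_comm hL a b
  | kleinGordon α J =>
    have h := congrArg (oddMat L) (jv_kleinGordon m α J)
    simpa only [map_add, map_sum, map_smul, map_zero, FreeAlgebra.lift_ι_apply] using h

/-- The multiplicative extension of `oddMat`. -/
noncomputable def oddHom {L : JetSpace m →ₗ[ℂ] JetSpace m} (hL : IsOdd L) :
    Poly m →ₐ[ℂ] Matrix (Fin 2) (Fin 2) (Poly m) :=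
  Poly.lift m (fun a => oddMat L (jv m a)) fun _ _ => lift_oddMat_eq_of_rel hL

theorem oddHom_jet {L : JetSpace m →ₗ[ℂ] JetSpace m} (hL : IsOdd L) (a : Jet) :
    oddHom hL (jet m a) = !![parityAut m (jet m a), toPoly m (L (jv m a)); 0, jet m a] := by
  rw [oddHom, jet, Poly.lift_mk, FreeAlgebra.lift_ι_apply, oddMat, LinearMap.coe_mk, AddHom.coe_mk,
    toPoly_jv, jet]

theorem oddHom_apply {L : JetSpace m →ₗ[ℂ] JetSpace m} (hL : IsOdd L) (p : Poly m) :
    oddHom hL p = !![parityAut m p, oddHom hL p 0 1; 0, p] := by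
  induction p using poly_induction m with
  | h1 c =>
    ext i j
    fin_cases i <;> fin_cases j <;> simp [Matrix.algebraMap_matrix_apply]
  | hj a => simp [oddHom_jet]
  | hm p q hp hq =>
    rw [map_mul, hp, hq, Matrix.mul_fin_two]
    simp
  | ha p q hp hq =>
    rw [map_add, hp, hq]
    simp

/-- The odd derivation which extends an odd linear map. -/
noncomputable def oddDerivation {L : JetSpace m →ₗ[ℂ] JetSpace m} (hL : IsOdd L) :
    Poly m →ₗ[ℂ] Poly m :=
  Matrix.entryLinearMap ℂ (Poly m) 0 1 ∘ₗ (oddHom hL).toLinearMap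

theorem oddDerivation_toPoly {L : JetSpace m →ₗ[ℂ] JetSpace m} (hL : IsOdd L) (x : JetSpace m) :
    oddDerivation hL (toPoly m x) = toPoly m (L x) := by
  suffices h : oddDerivation hL ∘ₗ toPoly m = toPoly m ∘ₗ L from LinearMap.congr_fun h x
  exact jetSpace_hom_ext fun a => by simp [oddDerivation, oddHom_jet]

theorem isOddDerivation_oddDerivation {L : JetSpace m →ₗ[ℂ] JetSpace m} (hL : IsOdd L) :
    IsOddDerivation (oddDerivation hL) := by
  refine isOddDerivation_of_jet (fun p q => ?_) hL fun a => by
    rw [← oddDerivation_toPoly hL, toPoly_jv]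
  have h : oddHom hL (p * q) 0 1 = parityAut m p * oddHom hL q 0 1 + oddHom hL p 0 1 * q := by
    rw [map_mul, oddHom_apply hL p, oddHom_apply hL q, Matrix.mul_fin_two]
    simp
  simpa [oddDerivation, add_comm] using h

end OddDerivation

/-! ## The linear part of the differential -/

section DQLin

variable (m : ℝ)

/-- The linear combination `C_J = ∂^μ v_{μ;J} + m Φ_J` of jet variables. -/
noncomputable def cVec (J : Multiset (Fin 4)) : JetSpace m :=
  ∑ μ, eta μ μ • jv m (.v μ, μ ::ₘ J) + (m : ℂ) • jv m (.Phi, J)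

theorem toPoly_cVec (J : Multiset (Fin 4)) : toPoly m (cVec m J) = Cjet m J := by
  simp only [cVec, Cjet, map_add, map_sum, map_smul, toPoly_jv]

/-- The restriction of `d_Q` to the linear combinations of jet variables. -/
noncomputable def dQLin : JetSpace m →ₗ[ℂ] JetSpace m := linearPart m ∘ₗ dQ m ∘ₗ toPoly m

variable {m}

theorem dQLin_eq {x y : JetSpace m} (h : dQ m (toPoly m x) = toPoly m y) : dQLin m x = y := by
  rw [dQLin, LinearMap.comp_apply, LinearMap.comp_apply, h, linearPart_toPoly]

variable (m)

theorem dQLin_v (μ : Fin 4) (J : Multiset (Fin 4)) :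
    dQLin m (jv m (.v μ, J)) = Complex.I • jv m (.u, μ ::ₘ J) :=
  dQLin_eq (by simp [dQ_jet, dQGen])

theorem dQLin_Phi (J : Multiset (Fin 4)) :
    dQLin m (jv m (.Phi, J)) = (Complex.I * (m : ℂ)) • jv m (.u, J) :=
  dQLin_eq (by simp [dQ_jet, dQGen])

theorem dQLin_u (J : Multiset (Fin 4)) : dQLin m (jv m (.u, J)) = 0 :=
  dQLin_eq (by simp [dQ_jet, dQGen])

theorem dQLin_ut (J : Multiset (Fin 4)) :
    dQLin m (jv m (.ut, J)) = -Complex.I • cVec m J :=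
  dQLin_eq (by simp [dQ_jet, dQGen, toPoly_cVec])

theorem dQLin_cVec (J : Multiset (Fin 4)) : dQLin m (cVec m J) = 0 :=
  dQLin_eq (by rw [toPoly_cVec, dQ_Cjet, map_zero])

theorem toPoly_dQLin (x : JetSpace m) : toPoly m (dQLin m x) = dQ m (toPoly m x) := by
  suffices h : toPoly m ∘ₗ dQLin m = dQ m ∘ₗ toPoly m from LinearMap.congr_fun h x
  refine jetSpace_hom_ext fun ⟨α, J⟩ => ?_
  cases α <;> simp [dQLin_v, dQLin_Phi, dQLin_u, dQLin_ut, dQ_jet, dQGen, toPoly_cVec]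

theorem cVec_mem_parityPart (J : Multiset (Fin 4)) : cVec m J ∈ parityPart m 0 :=
  Submodule.add_mem _ (Submodule.sum_mem _ fun μ _ => Submodule.smul_mem _ _
    (jv_mem_parityPart m (.v μ, _))) (Submodule.smul_mem _ _ (jv_mem_parityPart m (.Phi, J)))

theorem isOdd_dQLin : IsOdd (dQLin m) := by
  rintro ⟨α, J⟩
  cases α with
  | v μ => rw [dQLin_v]; exact Submodule.smul_mem _ _ (jv_mem_parityPart m (.u, _))
  | Phi => rw [dQLin_Phi]; exact Submodule.smul_mem _ _ (jv_mem_parityPart m (.u, _))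
  | u => rw [dQLin_u]; exact Submodule.zero_mem _
  | ut => rw [dQLin_ut]; exact Submodule.smul_mem _ _ (cVec_mem_parityPart m _)

theorem isOddDerivation_dQ : IsOddDerivation (dQ m) :=
  isOddDerivation_of_jet (dQ_mul m) (isOdd_dQLin m) fun a => by rw [toPoly_dQLin, toPoly_jv]

end DQLin

section Cocycles

variable (m : ℝ)

theorem dQLin_curlVec (μ ν : Fin 4) (K : Multiset (Fin 4)) : dQLin m (curlVec m μ ν K) = 0 := by
  rw [curlVec, map_sub, dQLin_v, dQLin_v, Multiset.cons_swap, sub_self]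

theorem dQLin_gVec {K : Multiset (Fin 4)} (hK : K ≠ 0) :
    dQLin m (gVec m K) = Complex.I • jv m (.u, K) := by
  have hsum : dQLin m (eraseSum (fun ρ L => jv m (.v ρ, L)) K) =
      (Multiset.card K : ℂ) • Complex.I • jv m (.u, K) := by
    rw [← eraseSum_cons_apply fun J => Complex.I • jv m (.u, J)]
    simp only [eraseSum, map_multiset_sum, Multiset.map_map, Function.comp_def, dQLin_v]
  rw [gVec, map_smul, hsum, smul_smul, inv_mul_cancel₀, one_smul]
  exact Nat.cast_ne_zero.2 (mt Multiset.card_eq_zero.1 hK)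

theorem dQLin_phiVec {K : Multiset (Fin 4)} (hK : K ≠ 0) : dQLin m (phiVec m K) = 0 := by
  rw [phiVec, map_sub, map_smul, dQLin_Phi, dQLin_gVec m hK, smul_smul, mul_comm, sub_self]

theorem dQLin_vec (s : Sym0) : dQLin m (s.vec m) = 0 := by
  cases s with
  | F n I => exact tlProj_mem (Y := LinearMap.ker (dQLin m)) (fun _ => dQLin_curlVec m _ _ _) I
  | phi n I =>
    refine tlProj_mem (Y := LinearMap.ker (dQLin m)) (fun I => dQLin_phiVec m ?_) I
    rw [← Multiset.card_pos, card_idx]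
    exact n.succ_pos

theorem dQ_ofFormal (a : FormalP0) : dQ m (ofFormal m a) = 0 := by
  have ha : a ∈ Algebra.adjoin ℂ (Set.range Sym0.cls) := adjoin_cls ▸ Algebra.mem_top
  induction ha using Algebra.adjoin_induction with
  | mem x hx =>
    obtain ⟨s, rfl⟩ := hx
    rw [ofFormal_cls, ← toPoly_vec, ← toPoly_dQLin, dQLin_vec, map_zero]
  | algebraMap c => rw [AlgHom.commutes, dQ_algebraMap]
  | add x y _ _ hx hy => rw [map_add, map_add, hx, hy, add_zero]
  | mul x y _ _ hx hy => rw [map_mul, dQ_mul, hx, hy, zero_mul, mul_zero, add_zero]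

end Cocycles

/-! ## Generators adapted to the differential -/

section Generators

/-- Initial data of `gauge`: a field `v_{μ;L}` with `μ ::ₘ L = J`, or `m⁻¹ Φ` for `J = 0`. -/
noncomputable def gaugeData (m : ℝ) (J : Multiset (Fin 4)) : JetSpace m :=
  if h : J = 0 then (m : ℂ)⁻¹ • jv m (.Phi, 0)
  else jv m (.v (Multiset.exists_mem_of_ne_zero h).choose,
    J.erase (Multiset.exists_mem_of_ne_zero h).choose)

theorem gaugeData_zero (m : ℝ) : gaugeData m 0 = (m : ℂ)⁻¹ • jv m (.Phi, 0) := dif_pos rfl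

theorem exists_gaugeData_eq (m : ℝ) {J : Multiset (Fin 4)} (h : J ≠ 0) :
    ∃ μ L, μ ::ₘ L = J ∧ gaugeData m J = jv m (.v μ, L) :=
  ⟨_, _, Multiset.cons_erase (Multiset.exists_mem_of_ne_zero h).choose_spec, dif_neg h⟩

/-- The contractible partners of the ghosts: `d_Q` maps `gauge m J` to `i u_J`. -/
noncomputable def gauge (m : ℝ) : Multiset (Fin 4) → JetSpace m := kgExtend m (gaugeData m)

variable {m : ℝ}

theorem gauge_mem_parityPart (J : Multiset (Fin 4)) : gauge m J ∈ parityPart m 0 := by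
  refine kgExtend_mem (fun J => ?_) J
  by_cases hJ : J = 0
  · rw [hJ, gaugeData_zero]
    exact Submodule.smul_mem _ _ (jv_mem_parityPart m (.Phi, 0))
  · obtain ⟨μ, L, -, hL⟩ := exists_gaugeData_eq m hJ
    rw [hL]
    exact jv_mem_parityPart m (.v μ, L)

theorem dQLin_gauge (hm : m ≠ 0) (J : Multiset (Fin 4)) :
    dQLin m (gauge m J) = Complex.I • jv m (.u, J) := by
  induction J using time_induction with
  | initial J hJ =>
    rw [gauge, kgExtend_of_count_lt _ _ hJ]
    by_cases h : J = 0
    · rw [h, gaugeData_zero, map_smul, dQLin_Phi, smul_smul, mul_left_comm,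
        inv_mul_cancel₀ (Complex.ofReal_ne_zero.2 hm), mul_one]
    · obtain ⟨μ, L, rfl, hL⟩ := exists_gaugeData_eq m h
      rw [hL, dQLin_v]
  | step J ih ih' =>
    rw [gauge] at ih ih' ⊢
    simp only [kgExtend_cons_cons, (jv_kleinGordon m .u).cons_cons, map_sub, map_sum, map_smul,
      smul_sub, Finset.smul_sum, smul_comm Complex.I, ih, ih']

/-- Generators of `𝒫` on which the differential is diagonal: cocycles `W` and the contractible
pairs `T ↦ C` and `G ↦ U`, up to constants. -/
inductive Gen : Type
  | W (s : Sym0)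
  | C (J : Multiset (Fin 4))
  | G (J : Multiset (Fin 4))
  | U (J : Multiset (Fin 4))
  | T (J : Multiset (Fin 4))

/-- The linear combination of jet variables denoted by a generator. -/
noncomputable def Gen.vec (m : ℝ) : Gen → JetSpace m
  | .W s => s.vec m
  | .C J => cVec m J
  | .G J => gauge m J
  | .U J => jv m (.u, J)
  | .T J => jv m (.ut, J)

/-- The canonical dimension of a generator. It is `1` for `G 0`, which is `m⁻¹ Φ`. -/
def Gen.dim : Gen → ℕ
  | .W s => s.dim
  | .C J => Multiset.card J + 2
  | .G J => max 1 (Multiset.card J)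
  | .U J => Multiset.card J + 1
  | .T J => Multiset.card J + 1

/-- The weight of a generator for the operator which counts the contractible generators. -/
def Gen.charge : Gen → ℕ
  | .W _ => 0
  | _ => 1

/-- The span of the jet variables of dimension at most `n`. -/
noncomputable def jetLE (m : ℝ) (n : ℕ) : Submodule ℂ (JetSpace m) :=
  Submodule.span ℂ (jv m '' {a | a.dim ≤ n})

theorem jetLE_mono {i j : ℕ} (h : i ≤ j) : jetLE m i ≤ jetLE m j :=
  Submodule.span_mono (Set.image_mono fun _ ha => le_trans ha h)

theorem jv_mem_jetLE {α : Fld} {J : Multiset (Fin 4)} {n : ℕ} (h : Multiset.card J < n) :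
    jv m (α, J) ∈ jetLE m n :=
  Submodule.subset_span ⟨(α, J), by simp only [Set.mem_ofPred_eq, Jet.dim]; omega, rfl⟩

/-- The span of the adapted generators of dimension at most `n`. -/
noncomputable def genLE (m : ℝ) (n : ℕ) : Submodule ℂ (JetSpace m) :=
  Submodule.span ℂ (Gen.vec m '' {g | g.dim ≤ n})

theorem genLE_mono {i j : ℕ} (h : i ≤ j) : genLE m i ≤ genLE m j :=
  Submodule.span_mono (Set.image_mono fun _ hg => le_trans hg h)

theorem Gen.vec_mem_genLE (g : Gen) {n : ℕ} (h : g.dim ≤ n) : g.vec m ∈ genLE m n :=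
  Submodule.subset_span ⟨g, h, rfl⟩

end Generators

section JetLELeGenLE

variable {m : ℝ} {n : ℕ}

theorem KleinGordon.sum_eta_smul_mem {M : Type*} [AddCommGroup M] [Module ℂ M]
    {Y : Submodule ℂ M} {f : Multiset (Fin 4) → M} (hf : KleinGordon m f) {J : Multiset (Fin 4)}
    (h : f J ∈ Y) : ∑ κ, eta κ κ • f (κ ::ₘ κ ::ₘ J) ∈ Y := by
  rw [eq_neg_of_add_eq_zero_left (hf J)]
  exact Y.neg_mem (Y.smul_mem _ h)

theorem mem_of_tlProj_mem {Y : Submodule ℂ (JetSpace m)} {T : TensorIn (JetSpace m) n}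
    (htrace : ∀ i j, i ≠ j → ∀ I, contract i j T I ∈ Y) {I : Fin n → Fin 4} (h : tlProj T I ∈ Y) :
    T I ∈ Y :=
  (Y.sub_mem_iff_left h).1 (sub_tlProj_mem htrace I)

theorem gVec_mem_jetLE (K : Multiset (Fin 4)) : gVec m K ∈ jetLE m (Multiset.card K) :=
  Submodule.smul_mem _ _ (eraseSum_mem fun _ hρ => jv_mem_jetLE (Multiset.card_erase_lt_of_mem hρ))

theorem phiVec_mem_genLE (h : jetLE m n ≤ genLE m n) {K : Multiset (Fin 4)} (hK : K ≠ 0)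
    (hn : Multiset.card K = n) : phiVec m K ∈ genLE m (n + 1) := by
  obtain ⟨k, rfl⟩ : ∃ k, n = k + 1 :=
    Nat.exists_eq_add_one.2 (hn ▸ Multiset.card_pos.2 hK)
  have h' : jetLE m (k + 1) ≤ genLE m (k + 2) := h.trans (genLE_mono (by omega))
  obtain ⟨I, rfl⟩ := exists_idx hn
  refine mem_of_tlProj_mem (T := symmTensor (phiVec m) (k + 1))
    (forall_contract_symmTensor_mem_iff.2 fun L hL => ?_) ((Gen.W (.phi k I)).vec_mem_genLE le_rfl)
  simp only [phiVec, smul_sub, Finset.sum_sub_distrib]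
  refine Submodule.sub_mem _
    ((jv_kleinGordon m .Phi).sum_eta_smul_mem (h' (jv_mem_jetLE (by omega))))
    (Submodule.sum_mem _ fun κ _ => Submodule.smul_mem _ _ (Submodule.smul_mem _ _ (h' ?_)))
  exact jetLE_mono (by simp [hL]) (gVec_mem_jetLE _)

theorem sum_eta_smul_curlVec_cons (ν : Fin 4) (K : Multiset (Fin 4)) :
    ∑ κ, eta κ κ • curlVec m κ ν (κ ::ₘ K) = ∑ κ, eta κ κ • jv m (.v ν, κ ::ₘ κ ::ₘ K) -
      (cVec m (ν ::ₘ K) - (m : ℂ) • jv m (.Phi, ν ::ₘ K)) := by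
  simp only [curlVec, cVec, smul_sub, Finset.sum_sub_distrib, Multiset.cons_swap ν,
    add_sub_cancel_right]

theorem curlVec_mem_genLE (h : jetLE m n ≤ genLE m n) (μ ν : Fin 4) {K : Multiset (Fin 4)}
    (hn : Multiset.card K + 1 = n) : curlVec m μ ν K ∈ genLE m (n + 1) := by
  have hjet : ∀ {α : Fld} {J : Multiset (Fin 4)}, Multiset.card J < n →
      jv m (α, J) ∈ genLE m (n + 1) := fun hJ => genLE_mono n.le_succ (h (jv_mem_jetLE hJ))
  obtain ⟨k, hk⟩ : ∃ k, Multiset.card K = k := ⟨_, rfl⟩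
  obtain ⟨I, rfl⟩ := exists_idx hk
  rw [card_idx] at hn
  rw [← twoFormTensor_vecCons (curlVec m)]
  refine mem_of_tlProj_mem ((forall_contract_twoFormTensor_mem_iff (F := curlVec m)
    fun μ ν K => (neg_sub _ _).symm).2 ⟨fun ν L hL => ?_, fun μ ν L hL => ?_⟩)
    ((Gen.W (.F _ _)).vec_mem_genLE (by simp only [Gen.dim, Sym0.dim]; omega))
  · rw [sum_eta_smul_curlVec_cons]
    refine Submodule.sub_mem _ ((jv_kleinGordon m (.v ν)).sum_eta_smul_mem (hjet (by omega)))
      (Submodule.sub_mem _ ((Gen.C (ν ::ₘ L)).vec_mem_genLE ?_) (Submodule.smul_mem _ _ (hjet ?_)))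
    · simp only [Gen.dim, Multiset.card_cons]; omega
    · rw [Multiset.card_cons]; omega
  · simp only [curlVec, smul_sub, Finset.sum_sub_distrib]
    refine Submodule.sub_mem _ (((jv_kleinGordon m (.v ν)).cons μ).sum_eta_smul_mem (hjet ?_))
      (((jv_kleinGordon m (.v μ)).cons ν).sum_eta_smul_mem (hjet ?_)) <;>
    · rw [Multiset.card_cons]; omega

theorem v_sub_v_mem_genLE (h : jetLE m n ≤ genLE m n) {μ ν : Fin 4} {J K : Multiset (Fin 4)}
    (hcons : μ ::ₘ J = ν ::ₘ K) (hn : Multiset.card J = n) :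
    jv m (.v μ, J) - jv m (.v ν, K) ∈ genLE m (n + 1) := by
  rcases Multiset.cons_eq_cons.1 hcons with ⟨rfl, rfl⟩ | ⟨_, L, rfl, rfl⟩
  · rw [sub_self]
    exact Submodule.zero_mem _
  · rw [Multiset.card_cons] at hn
    exact curlVec_mem_genLE h ν μ hn

theorem v_sub_gauge_mem_genLE (h : jetLE m n ≤ genLE m n) (μ : Fin 4) (J : Multiset (Fin 4))
    (hn : Multiset.card J = n) : jv m (.v μ, J) - gauge m (μ ::ₘ J) ∈ genLE m (n + 1) := by
  induction hK : μ ::ₘ J using time_induction generalizing μ J with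
  | initial K hK0 =>
    rw [gauge, kgExtend_of_count_lt _ _ hK0]
    obtain ⟨ν, L, hL, hdata⟩ := exists_gaugeData_eq m (hK ▸ Multiset.cons_ne_zero : K ≠ 0)
    rw [hdata]
    exact v_sub_v_mem_genLE h (hK.trans hL.symm) hn
  | step L _ ih =>
    have hL : Multiset.card L + 1 = n := by
      simpa [hn] using (congrArg Multiset.card hK).symm
    have hv : jv m (.v 0, 0 ::ₘ L) = cVec m L - (m : ℂ) • jv m (.Phi, L) +
        ∑ i : Fin 3, jv m (.v i.succ, i.succ ::ₘ L) := by
      rw [cVec, sum_eta_self_smul]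
      abel
    have hsplit : jv m (.v μ, J) - gauge m (0 ::ₘ 0 ::ₘ L) =
        (jv m (.v μ, J) - jv m (.v 0, 0 ::ₘ L)) + cVec m L - (m : ℂ) • jv m (.Phi, L) +
        (∑ i : Fin 3, (jv m (.v i.succ, i.succ ::ₘ L) - gauge m (i.succ ::ₘ i.succ ::ₘ L))) +
        (m : ℂ) ^ 2 • gauge m L := by
      rw [gauge, kgExtend_cons_cons, hv, Finset.sum_sub_distrib]
      abel
    rw [hsplit]
    refine Submodule.add_mem _ (Submodule.add_mem _ (Submodule.sub_mem _ (Submodule.add_mem _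
      (v_sub_v_mem_genLE h hK hn) ((Gen.C L).vec_mem_genLE ?_)) (Submodule.smul_mem _ _
      (genLE_mono n.le_succ (h (jv_mem_jetLE (by omega)))))) (Submodule.sum_mem _ fun i _ =>
      ih i _ _ ?_ rfl)) (Submodule.smul_mem _ _ ((Gen.G L).vec_mem_genLE ?_))
    · simp only [Gen.dim]; omega
    · rw [Multiset.card_cons, hL]
    · simp only [Gen.dim]; omega

theorem Phi_mem_genLE (hm : m ≠ 0) (h : jetLE m n ≤ genLE m n) {J : Multiset (Fin 4)}
    (hn : Multiset.card J = n) : jv m (.Phi, J) ∈ genLE m (n + 1) := by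
  by_cases hJ : J = 0
  · have hG : gauge m 0 ∈ genLE m (n + 1) := (Gen.G 0).vec_mem_genLE (by simp [Gen.dim])
    rw [gauge, kgExtend_of_count_lt _ _ (by simp), gaugeData_zero] at hG
    rw [hJ]
    exact ((genLE m (n + 1)).smul_mem_iff (inv_ne_zero (Complex.ofReal_ne_zero.2 hm))).1 hG
  · refine ((genLE m (n + 1)).sub_mem_iff_left (Submodule.smul_mem _ _ ?_)).1
      (phiVec_mem_genLE h hJ hn)
    exact genLE_mono n.le_succ (h (hn ▸ gVec_mem_jetLE J))

theorem jetLE_le_genLE (hm : m ≠ 0) (n : ℕ) : jetLE m n ≤ genLE m n := by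
  induction n with
  | zero =>
    refine Submodule.span_le.2 ?_
    rintro _ ⟨a, ha, rfl⟩
    simp only [Set.mem_ofPred_eq, Jet.dim] at ha
    omega
  | succ n ih =>
    refine Submodule.span_le.2 ?_
    rintro _ ⟨⟨α, J⟩, ha, rfl⟩
    simp only [Set.mem_ofPred_eq, Jet.dim] at ha
    rcases (by omega : Multiset.card J < n ∨ Multiset.card J = n) with hJ | hJ
    · exact genLE_mono n.le_succ (ih (jv_mem_jetLE hJ))
    cases α with
    | v μ =>
      refine ((genLE m (n + 1)).sub_mem_iff_left ((Gen.G (μ ::ₘ J)).vec_mem_genLE ?_)).1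
        (v_sub_gauge_mem_genLE ih μ J hJ)
      simp only [Gen.dim, Multiset.card_cons]
      omega
    | Phi => exact Phi_mem_genLE hm ih hJ
    | u => exact (Gen.U J).vec_mem_genLE (by simp only [Gen.dim]; omega)
    | ut => exact (Gen.T J).vec_mem_genLE (by simp only [Gen.dim]; omega)

end JetLELeGenLE

/-! ## The contracting homotopy -/

section Homotopy

variable {m : ℝ}

theorem jetLift_mem {M : Type*} [AddCommGroup M] [Module ℂ M] {Y : Submodule ℂ M} {f : Jet → M}
    {hf : ∀ α, KleinGordon m fun J => f (α, J)} (h : ∀ a, f a ∈ Y) (x : JetSpace m) :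
    jetLift m f hf x ∈ Y := by
  suffices hY : ⊤ ≤ Y.comap (jetLift m f hf) from hY (Submodule.mem_top : x ∈ ⊤)
  rw [← span_range_jv, Submodule.span_le]
  rintro _ ⟨a, rfl⟩
  simpa using h a

/-- The linear map `u_J ↦ gauge J` which vanishes on the other jet variables. -/
noncomputable def gaugeMap (m : ℝ) : JetSpace m →ₗ[ℂ] JetSpace m :=
  jetLift m (fun | (.u, J) => gauge m J | _ => 0) fun α => by
    cases α with
    | u => exact kleinGordon_kgExtend m _
    | v _ | Phi | ut => exact KleinGordon.zero

/-- The linear map `Φ_J ↦ ũ_J` which vanishes on the other jet variables. -/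
noncomputable def antighostMap (m : ℝ) : JetSpace m →ₗ[ℂ] JetSpace m :=
  jetLift m (fun | (.Phi, J) => jv m (.ut, J) | _ => 0) fun α => by
    cases α with
    | Phi => exact jv_kleinGordon m .ut
    | v _ | u | ut => exact KleinGordon.zero

theorem gaugeMap_u (J : Multiset (Fin 4)) : gaugeMap m (jv m (.u, J)) = gauge m J :=
  jetLift_jv _ _ _

theorem gaugeMap_ut (J : Multiset (Fin 4)) : gaugeMap m (jv m (.ut, J)) = 0 :=
  jetLift_jv _ _ _

theorem gaugeMap_of_even {x : JetSpace m} (hx : x ∈ parityPart m 0) : gaugeMap m x = 0 := by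
  suffices h : parityPart m 0 ≤ LinearMap.ker (gaugeMap m) from h hx
  refine Submodule.span_le.2 ?_
  rintro _ ⟨⟨α, J⟩, h, rfl⟩
  cases α with
  | v _ | Phi => exact jetLift_jv _ _ _
  | u | ut => simp [Fld.parity] at h

theorem gaugeMap_mem_parityPart (x : JetSpace m) : gaugeMap m x ∈ parityPart m 0 := by
  refine jetLift_mem (fun ⟨α, J⟩ => ?_) x
  cases α with
  | u => exact gauge_mem_parityPart J
  | v _ | Phi | ut => exact Submodule.zero_mem _

theorem antighostMap_Phi (J : Multiset (Fin 4)) :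
    antighostMap m (jv m (.Phi, J)) = jv m (.ut, J) :=
  jetLift_jv _ _ _

theorem antighostMap_v (μ : Fin 4) (J : Multiset (Fin 4)) :
    antighostMap m (jv m (.v μ, J)) = 0 :=
  jetLift_jv _ _ _

theorem antighostMap_of_odd {x : JetSpace m} (hx : x ∈ parityPart m 1) :
    antighostMap m x = 0 := by
  suffices h : parityPart m 1 ≤ LinearMap.ker (antighostMap m) from h hx
  refine Submodule.span_le.2 ?_
  rintro _ ⟨⟨α, J⟩, h, rfl⟩
  cases α with
  | v _ | Phi => simp [Fld.parity] at h
  | u | ut => exact jetLift_jv _ _ _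

theorem antighostMap_mem_parityPart (x : JetSpace m) : antighostMap m x ∈ parityPart m 1 := by
  refine jetLift_mem (fun ⟨α, J⟩ => ?_) x
  cases α with
  | Phi => exact jv_mem_parityPart m (.ut, J)
  | v _ | u | ut => exact Submodule.zero_mem _

theorem antighostMap_cVec (J : Multiset (Fin 4)) :
    antighostMap m (cVec m J) = (m : ℂ) • jv m (.ut, J) := by
  simp only [cVec, map_add, map_sum, map_smul, antighostMap_Phi, antighostMap_v, smul_zero,
    Finset.sum_const_zero, zero_add]

theorem toFormal_toPoly_of_odd {x : JetSpace m} (hx : x ∈ parityPart m 1) :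
    toFormal m (toPoly m x) = 0 := by
  suffices h : parityPart m 1 ≤ LinearMap.ker ((toFormal m).toLinearMap ∘ₗ toPoly m) from h hx
  refine Submodule.span_le.2 ?_
  rintro _ ⟨⟨α, J⟩, h, rfl⟩
  cases α with
  | v _ | Phi => simp [Fld.parity] at h
  | u | ut => simp [jetImage]

theorem exists_symbolProj (hm : m ≠ 0) : ∃ P : JetSpace m →ₗ[ℂ] JetSpace m,
    (∀ x, toFormal m (toPoly m x) = 0 → P x = 0) ∧ ∀ s : Sym0, P (s.vec m) = s.vec m := by
  obtain ⟨ℓ, hℓ⟩ := LinearMap.exists_leftInverse_of_injective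
    ((toFormal m).comp (ofFormal m)).toLinearMap
    (LinearMap.ker_eq_bot.2 (toFormal_ofFormal_injective hm))
  refine ⟨linearPart m ∘ₗ (ofFormal m).toLinearMap ∘ₗ ℓ ∘ₗ (toFormal m).toLinearMap ∘ₗ toPoly m,
    fun x hx => by simp [hx], fun s => ?_⟩
  have hs : ℓ (toFormal m (s.val m)) = s.cls := by simpa using LinearMap.congr_fun hℓ s.cls
  simp only [LinearMap.comp_apply, AlgHom.toLinearMap_apply, toPoly_vec, hs, ofFormal_cls]
  rw [← toPoly_vec, linearPart_toPoly]

/-- A homotopy for the linear part of `d_Q`, given a projection `P` to the span of the symbols. -/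
noncomputable def homotopy (P : JetSpace m →ₗ[ℂ] JetSpace m) : JetSpace m →ₗ[ℂ] JetSpace m :=
  (Complex.I * (m : ℂ)⁻¹) • antighostMap m ∘ₗ (LinearMap.id - P) ∘ₗ
    (LinearMap.id + Complex.I • gaugeMap m ∘ₗ dQLin m) - Complex.I • gaugeMap m

theorem homotopy_of_even (P : JetSpace m →ₗ[ℂ] JetSpace m) {x : JetSpace m}
    (hx : x ∈ parityPart m 0) : homotopy P x = (Complex.I * (m : ℂ)⁻¹) • antighostMap m
      (x + Complex.I • gaugeMap m (dQLin m x) - P (x + Complex.I • gaugeMap m (dQLin m x))) := by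
  simp [homotopy, gaugeMap_of_even hx]

theorem homotopy_of_odd {P : JetSpace m →ₗ[ℂ] JetSpace m}
    (hP : ∀ x, toFormal m (toPoly m x) = 0 → P x = 0) {x : JetSpace m}
    (hx : x ∈ parityPart m 1) : homotopy P x = -Complex.I • gaugeMap m x := by
  have hdx := (isOdd_dQLin m).map_mem hx
  simp [homotopy, gaugeMap_of_even hdx, hP x (toFormal_toPoly_of_odd hx), antighostMap_of_odd hx]

theorem isOdd_homotopy {P : JetSpace m →ₗ[ℂ] JetSpace m}
    (hP : ∀ x, toFormal m (toPoly m x) = 0 → P x = 0) : IsOdd (homotopy P) := fun a => by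
  have ha := jv_mem_parityPart m a
  rcases a.1.parity_eq_zero_or_one with h | h <;> rw [h] at ha ⊢
  · rw [homotopy_of_even P ha]
    exact Submodule.smul_mem _ _ (antighostMap_mem_parityPart _)
  · rw [homotopy_of_odd hP ha]
    exact Submodule.smul_mem _ _ (gaugeMap_mem_parityPart _)

/-- The values of the homotopy on the adapted generators. -/
noncomputable def Gen.homotopyVec (m : ℝ) : Gen → JetSpace m
  | .C J => Complex.I • jv m (.ut, J)
  | .U J => -Complex.I • gauge m J
  | _ => 0

theorem homotopy_vec (hm : m ≠ 0) {P : JetSpace m →ₗ[ℂ] JetSpace m}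
    (hP : ∀ x, toFormal m (toPoly m x) = 0 → P x = 0) (hPvec : ∀ s : Sym0, P (s.vec m) = s.vec m)
    (g : Gen) : homotopy P (g.vec m) = g.homotopyVec m := by
  cases g with
  | W s => simp [Gen.vec, Gen.homotopyVec, homotopy_of_even P (vec_mem_parityPart m s),
      dQLin_vec, hPvec]
  | C J =>
    have hPC : P (cVec m J) = 0 := hP _ (by rw [toPoly_cVec, toFormal_Cjet hm])
    rw [Gen.vec, Gen.homotopyVec, homotopy_of_even P (cVec_mem_parityPart m J), dQLin_cVec,
      map_zero, smul_zero, add_zero, hPC, sub_zero, antighostMap_cVec, smul_smul, mul_assoc,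
      inv_mul_cancel₀ (Complex.ofReal_ne_zero.2 hm), mul_one]
  | G J => simp [Gen.vec, Gen.homotopyVec, homotopy_of_even P (gauge_mem_parityPart J),
      dQLin_gauge hm, gaugeMap_u, smul_smul]
  | U J => simp [Gen.vec, Gen.homotopyVec, homotopy_of_odd hP (jv_mem_parityPart m (.u, J)),
      gaugeMap_u]
  | T J => simp [Gen.vec, Gen.homotopyVec, homotopy_of_odd hP (jv_mem_parityPart m (.ut, J)),
      gaugeMap_ut]

theorem dQLin_homotopy_add (hm : m ≠ 0) {L : JetSpace m →ₗ[ℂ] JetSpace m}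
    (hL : ∀ g : Gen, L (g.vec m) = g.homotopyVec m) (g : Gen) :
    dQLin m (L (g.vec m)) + L (dQLin m (g.vec m)) = (g.charge : ℂ) • g.vec m := by
  have hC : ∀ J, L (cVec m J) = Complex.I • jv m (.ut, J) := fun J => hL (.C J)
  have hU : ∀ J, L (jv m (.u, J)) = -Complex.I • gauge m J := fun J => hL (.U J)
  rw [hL]
  cases g with
  | W s => simp [Gen.vec, Gen.homotopyVec, Gen.charge, dQLin_vec]
  | C J => simp [Gen.vec, Gen.homotopyVec, Gen.charge, dQLin_cVec, dQLin_ut, smul_smul]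
  | G J => simp [Gen.vec, Gen.homotopyVec, Gen.charge, dQLin_gauge hm, hU, smul_smul]
  | U J => simp [Gen.vec, Gen.homotopyVec, Gen.charge, dQLin_gauge hm, dQLin_u, smul_smul]
  | T J => simp [Gen.vec, Gen.homotopyVec, Gen.charge, dQLin_ut, hC, smul_smul]

end Homotopy

/-! ## Reduction of cocycles -/

section Filtration

variable {m : ℝ}

theorem toPoly_mem_PolyLE {x : JetSpace m} {n : ℕ} (hx : x ∈ jetLE m n) :
    toPoly m x ∈ PolyLE m n := by
  suffices h : jetLE m n ≤ (PolyLE m n).comap (toPoly m) from h hx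
  refine Submodule.span_le.2 ?_
  rintro _ ⟨a, ha, rfl⟩
  rw [SetLike.mem_coe, Submodule.mem_comap, toPoly_jv]
  exact weightLE_mono (Nat.cast_le.2 ha) (gen_mem_weightLE a)

theorem gauge_mem_jetLE {J : Multiset (Fin 4)} {n : ℕ} (h : max 1 (Multiset.card J) ≤ n) :
    gauge m J ∈ jetLE m n := by
  induction J using time_induction with
  | initial J hJ =>
    rw [gauge, kgExtend_of_count_lt _ _ hJ]
    by_cases hJ0 : J = 0
    · rw [hJ0, gaugeData_zero]
      exact Submodule.smul_mem _ _ (jv_mem_jetLE (le_of_max_le_left h))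
    · obtain ⟨μ, L, rfl, hdata⟩ := exists_gaugeData_eq m hJ0
      rw [Multiset.card_cons] at h
      rw [hdata]
      exact jv_mem_jetLE (le_of_max_le_right h)
  | step J ih ih' =>
    simp only [Multiset.card_cons] at h ih'
    rw [gauge, kgExtend_cons_cons]
    exact Submodule.sub_mem _ (Submodule.sum_mem _ fun i _ => ih' i h)
      (Submodule.smul_mem _ _ (ih (by omega)))

theorem Gen.vec_mem_jetLE (g : Gen) : g.vec m ∈ jetLE m g.dim := by
  have hjv : ∀ {α : Fld} {J : Multiset (Fin 4)} {n : ℕ}, Multiset.card J + 1 = n →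
      jv m (α, J) ∈ jetLE m n := fun h => jv_mem_jetLE (by omega)
  cases g with
  | W s =>
    cases s with
    | F n I =>
      refine tlProj_mem (T := twoFormTensor (curlVec m) n) (fun I => ?_) I
      exact Submodule.sub_mem _ (hjv (by simp [card_idx, Gen.dim, Sym0.dim]))
        (hjv (by simp [card_idx, Gen.dim, Sym0.dim]))
    | phi n I =>
      refine tlProj_mem (T := symmTensor (phiVec m) (n + 1)) (fun I => ?_) I
      refine Submodule.sub_mem _ (hjv (by simp [card_idx, Gen.dim, Sym0.dim]))
        (Submodule.smul_mem _ _ ?_)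
      exact jetLE_mono (by simp [card_idx, Gen.dim, Sym0.dim]) (gVec_mem_jetLE (idx I))
  | C J =>
    exact Submodule.add_mem _ (Submodule.sum_mem _ fun μ _ => Submodule.smul_mem _ _
      (hjv (by simp [Gen.dim]))) (Submodule.smul_mem _ _ (jv_mem_jetLE (by simp [Gen.dim])))
  | G J => exact gauge_mem_jetLE le_rfl
  | U J => exact hjv rfl
  | T J => exact hjv rfl

/-- The element of `𝒫` denoted by a generator. -/
noncomputable def Gen.val (m : ℝ) (g : Gen) : Poly m := toPoly m (g.vec m)

theorem Gen.val_mem_PolyLE (g : Gen) : g.val m ∈ PolyLE m g.dim :=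
  toPoly_mem_PolyLE g.vec_mem_jetLE

theorem PolyLE_eq_weightLE_val (hm : m ≠ 0) (n : ℤ) :
    PolyLE m n = weightLE (Gen.val m) Gen.dim n := by
  refine le_antisymm (weightLE_le_of_gen (fun a => ?_) n)
    (weightLE_le_of_gen Gen.val_mem_PolyLE n)
  have h : genLE m a.dim ≤ (weightLE (Gen.val m) Gen.dim a.dim).comap (toPoly m) := by
    refine Submodule.span_le.2 ?_
    rintro _ ⟨g, hg, rfl⟩
    exact weightLE_mono (Nat.cast_le.2 hg) (gen_mem_weightLE g)
  rw [← toPoly_jv]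
  exact h (jetLE_le_genLE hm _ (Submodule.subset_span ⟨a, Set.mem_ofPred_eq ▸ le_rfl, rfl⟩))

theorem parityAut_mem_PolyLE {p : Poly m} {n : ℤ} (hp : p ∈ PolyLE m n) :
    parityAut m p ∈ PolyLE m n := by
  refine weightLE_le_of_gen (fun a => ?_) n (map_mem_weightLE (parityAut m) hp)
  rw [parityAut_jet]
  exact Submodule.smul_mem _ _ (gen_mem_weightLE a)

theorem ofFormal_mem_PolyLE {a : FormalP0} {n : ℤ} (ha : a ∈ FormalP0LE n) :
    ofFormal m a ∈ PolyLE m n := by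
  refine weightLE_le_of_gen (fun s => ?_) n (map_mem_weightLE (ofFormal m) ha)
  rw [ofFormal_cls, ← toPoly_vec]
  exact (Gen.W s).val_mem_PolyLE

theorem adjoin_jet : Algebra.adjoin ℂ (Set.range (jet m)) = ⊤ := by
  rw [eq_top_iff]
  rintro p -
  induction p using poly_induction m with
  | h1 c => exact Subalgebra.algebraMap_mem _ c
  | hj a => exact Algebra.subset_adjoin ⟨a, rfl⟩
  | hm p q hp hq => exact Subalgebra.mul_mem _ hp hq
  | ha p q hp hq => exact Subalgebra.add_mem _ hp hq

theorem Gen.charge_le_dim (g : Gen) : g.charge ≤ g.dim := by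
  rcases g with (_ | _) | _ | _ | _ | _ <;> simp [Gen.charge, Gen.dim]

end Filtration

section EigenFilter

variable {V : Type*} [AddCommGroup V] [Module ℂ V] {D : V →ₗ[ℂ] V}

/-- The operator `(1 - D / N) ⋯ (1 - D / 2) (1 - D)`, which annihilates the eigenvectors of `D`
with eigenvalue `1, …, N`. -/
noncomputable def eigenFilter (D : V →ₗ[ℂ] V) : ℕ → V →ₗ[ℂ] V
  | 0 => LinearMap.id
  | N + 1 => (LinearMap.id - ((N : ℂ) + 1)⁻¹ • D) ∘ₗ eigenFilter D N

theorem eigenFilter_succ (N : ℕ) (x : V) :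
    eigenFilter D (N + 1) x = eigenFilter D N x - ((N : ℂ) + 1)⁻¹ • D (eigenFilter D N x) := rfl

theorem eigenFilter_of_eigen {x : V} {c : ℂ} (hx : D x = c • x) (N : ℕ) :
    eigenFilter D N x = (∏ j ∈ Finset.range N, (1 - ((j : ℂ) + 1)⁻¹ * c)) • x := by
  induction N with
  | zero => simp [eigenFilter]
  | succ N ih =>
    rw [eigenFilter_succ, ih, map_smul, hx, Finset.prod_range_succ]
    module

theorem eigenFilter_eq_zero {x : V} {c N : ℕ} (hx : D x = (c : ℂ) • x) (hc : c ≠ 0) (hN : c ≤ N) :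
    eigenFilter D N x = 0 := by
  obtain ⟨c, rfl⟩ := Nat.exists_eq_succ_of_ne_zero hc
  rw [eigenFilter_of_eigen hx, Finset.prod_eq_zero (Finset.mem_range.2 hN), zero_smul]
  rw [Nat.cast_succ, inv_mul_cancel₀ (Nat.cast_add_one_ne_zero c), sub_self]

end EigenFilter

section Reduction

variable {m : ℝ}

/-- A contracting homotopy for the differential on the adapted generators. -/
structure IsHomotopy (h : Poly m →ₗ[ℂ] Poly m) : Prop extends IsOddDerivation h where
  mem : ∀ g : Gen, h (g.val m) ∈ PolyLE m g.dim
  anticomm : ∀ g : Gen, dQ m (h (g.val m)) + h (dQ m (g.val m)) = (g.charge : ℂ) • g.val m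

theorem Gen.homotopyVec_mem_jetLE (g : Gen) : g.homotopyVec m ∈ jetLE m g.dim := by
  cases g with
  | C J => exact Submodule.smul_mem _ _ (jv_mem_jetLE (by simp [Gen.dim]))
  | U J => exact Submodule.smul_mem _ _ (gauge_mem_jetLE (by simp [Gen.dim]))
  | W _ | G _ | T _ => exact Submodule.zero_mem _

theorem exists_isHomotopy (hm : m ≠ 0) : ∃ h : Poly m →ₗ[ℂ] Poly m, IsHomotopy h := by
  obtain ⟨P, hP, hPvec⟩ := exists_symbolProj hm
  have hvec := homotopy_vec hm hP hPvec
  have hodd := isOdd_homotopy hP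
  refine ⟨oddDerivation hodd, isOddDerivation_oddDerivation hodd, fun g => ?_, fun g => ?_⟩
  · rw [Gen.val, oddDerivation_toPoly, hvec]
    exact toPoly_mem_PolyLE g.homotopyVec_mem_jetLE
  · rw [Gen.val, oddDerivation_toPoly, ← toPoly_dQLin, ← toPoly_dQLin, oddDerivation_toPoly,
      ← map_add, dQLin_homotopy_add hm hvec, map_smul]

variable {h : Poly m →ₗ[ℂ] Poly m} {p : Poly m}

theorem IsHomotopy.mem_PolyLE (hm : m ≠ 0) (hh : IsHomotopy h) {n : ℤ} (hp : p ∈ PolyLE m n) :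
    h p ∈ PolyLE m n := by
  rw [PolyLE_eq_weightLE_val hm] at hp
  refine (weightLE_le_iff (Y := (PolyLE m n).comap h)).2 (fun L hL => weightLE_mono hL ?_) hp
  clear hL
  change h _ ∈ PolyLE m _
  induction L with
  | nil => simp [hh.map_one]
  | cons g L ih =>
    have hL : (L.map (Gen.val m)).prod ∈ PolyLE m ((L.map Gen.dim).sum : ℕ) :=
      PolyLE_eq_weightLE_val hm _ ▸ prod_mem_weightLE L
    simp only [List.map_cons, List.prod_cons, List.sum_cons, Nat.cast_add, hh.mul]
    exact Submodule.add_mem _ (mul_mem_weightLE (hh.mem g) hL)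
      (mul_mem_weightLE (parityAut_mem_PolyLE g.val_mem_PolyLE) ih)

/-- The anticommutator of the differential and `h`. For a homotopy it is the derivation which
counts the contractible generators. -/
noncomputable def countOp (h : Poly m →ₗ[ℂ] Poly m) : Poly m →ₗ[ℂ] Poly m :=
  dQ m ∘ₗ h + h ∘ₗ dQ m

theorem countOp_apply (p : Poly m) : countOp h p = dQ m (h p) + h (dQ m p) := rfl

theorem IsHomotopy.countOp_prod (hh : IsHomotopy h) (L : List Gen) :
    countOp h (L.map (Gen.val m)).prod =
      (((L.map Gen.charge).sum : ℕ) : ℂ) • (L.map (Gen.val m)).prod := by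
  induction L with
  | nil => simp [countOp_apply, hh.map_one, (isOddDerivation_dQ m).map_one]
  | cons g L ih =>
    rw [countOp_apply] at ih
    simp only [List.map_cons, List.prod_cons, List.sum_cons, Nat.cast_add]
    rw [countOp_apply, (isOddDerivation_dQ m).anticomm_mul hh.toIsOddDerivation, ih, hh.anticomm,
      smul_mul_assoc, mul_smul_comm, add_smul]

theorem IsHomotopy.eigenFilter_mem (hm : m ≠ 0) (hh : IsHomotopy h) {n : ℤ}
    (hp : p ∈ PolyLE m n) (N : ℕ) : eigenFilter (countOp h) N p ∈ PolyLE m n := by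
  rw [PolyLE_eq_weightLE_val hm] at hp ⊢
  refine (weightLE_le_iff (Y := (weightLE (Gen.val m) Gen.dim n).comap
    (eigenFilter (countOp h) N))).2 (fun L hL => ?_) hp
  rw [Submodule.mem_comap, eigenFilter_of_eigen (hh.countOp_prod L)]
  exact Submodule.smul_mem _ _ (weightLE_mono hL (prod_mem_weightLE L))

theorem exists_eigenFilter_eq_sub_dQ (hm : m ≠ 0) (hh : IsHomotopy h) {n : ℤ}
    (hp : p ∈ PolyLE m n) (hd : dQ m p = 0) (N : ℕ) :
    ∃ y ∈ PolyLE m n, eigenFilter (countOp h) N p = p - dQ m y := by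
  induction N with
  | zero => exact ⟨0, Submodule.zero_mem _, by simp [eigenFilter]⟩
  | succ N ih =>
    obtain ⟨y, hy, hpy⟩ := ih
    have hcocycle : dQ m (eigenFilter (countOp h) N p) = 0 := by
      rw [hpy, map_sub, hd, dQ_dQ, sub_zero]
    refine ⟨y + ((N : ℂ) + 1)⁻¹ • h (eigenFilter (countOp h) N p), Submodule.add_mem _ hy
      (Submodule.smul_mem _ _ (hh.mem_PolyLE hm (hh.eigenFilter_mem hm hp N))), ?_⟩
    rw [eigenFilter_succ, countOp_apply, hcocycle, map_zero, add_zero, map_add, map_smul, ← sub_sub,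
      ← hpy]

theorem prod_val_mem_map_of_charge_eq_zero {L : List Gen} (hL : (L.map Gen.charge).sum = 0) :
    (L.map (Gen.val m)).prod ∈
      (FormalP0LE (L.map Gen.dim).sum).map (ofFormal m).toLinearMap := by
  induction L with
  | nil => exact ⟨1, one_mem_weightLE, map_one (ofFormal m)⟩
  | cons g L ih =>
    simp only [List.map_cons, List.sum_cons, Nat.add_eq_zero_iff] at hL
    cases g with
    | C _ | G _ | U _ | T _ => exact absurd hL.1 one_ne_zero
    | W s =>
      obtain ⟨a, ha, hprod⟩ := ih hL.2
      refine ⟨s.cls * a, ?_, ?_⟩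
      · rw [List.map_cons, List.sum_cons, Nat.cast_add]
        exact mul_mem_weightLE (gen_mem_weightLE s) ha
      · rw [List.map_cons, List.prod_cons, ← hprod, Gen.val, Gen.vec, toPoly_vec, ← ofFormal_cls]
        exact map_mul (ofFormal m) _ _

theorem IsHomotopy.eigenFilter_mem_map (hm : m ≠ 0) (hh : IsHomotopy h) {n : ℕ}
    (hp : p ∈ PolyLE m n) :
    eigenFilter (countOp h) n p ∈ (FormalP0LE n).map (ofFormal m).toLinearMap := by
  rw [PolyLE_eq_weightLE_val hm] at hp
  refine (weightLE_le_iff (Y := ((FormalP0LE n).map (ofFormal m).toLinearMap).comap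
    (eigenFilter (countOp h) n))).2 (fun L hL => ?_) hp
  rw [Submodule.mem_comap]
  by_cases hc : (L.map Gen.charge).sum = 0
  · rw [eigenFilter_of_eigen (hh.countOp_prod L)]
    exact Submodule.smul_mem _ _ (Submodule.map_mono (weightLE_mono hL)
      (prod_val_mem_map_of_charge_eq_zero hc))
  · have hcn : (L.map Gen.charge).sum ≤ n :=
      (List.sum_le_sum fun g _ => g.charge_le_dim).trans (Nat.cast_le.1 hL)
    rw [eigenFilter_eq_zero (hh.countOp_prod L) hc hcn]
    exact Submodule.zero_mem _

theorem exists_eq_ofFormal_add_dQ (hm : m ≠ 0) {n : ℕ} (hp : p ∈ PolyLE m n)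
    (hd : dQ m p = 0) : ∃ a ∈ FormalP0LE n, ∃ y ∈ PolyLE m n, p = ofFormal m a + dQ m y := by
  obtain ⟨h, hh⟩ := exists_isHomotopy hm
  obtain ⟨y, hy, hpy⟩ := exists_eigenFilter_eq_sub_dQ hm hh hp hd n
  obtain ⟨a, ha, hpa⟩ := hh.eigenFilter_mem_map hm hp
  exact ⟨a, ha, y, hy, sub_eq_iff_eq_add.1 (hpy.symm.trans hpa.symm)⟩

end Reduction

/-! ## The cohomology spaces -/

section Cohomology

variable {m : ℝ}

theorem exists_mem_PolyLE (p : Poly m) : ∃ n : ℕ, p ∈ PolyLE m n :=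
  exists_mem_weightLE adjoin_jet p

theorem ofFormal_mem_P0 (a : FormalP0) : ofFormal m a ∈ P0 m :=
  ofFormal_range m ▸ AlgHom.mem_range_self (ofFormal m) a

theorem ofFormal_injective (hm : m ≠ 0) : Function.Injective (ofFormal m) :=
  Function.Injective.of_comp (f := toFormal m) (toFormal_ofFormal_injective hm)

theorem exists_eq_P0_add_dQ (hm : m ≠ 0) {p : Poly m} (hp : p ∈ ZQ m) :
    ∃ p₀ ∈ P0 m, ∃ q, p = p₀ + dQ m q := by
  obtain ⟨n, hn⟩ := exists_mem_PolyLE p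
  obtain ⟨a, -, q, -, hpq⟩ := exists_eq_ofFormal_add_dQ hm hn hp
  exact ⟨_, ofFormal_mem_P0 a, q, hpq⟩

theorem exists_eq_P0_add_dQ_of_mem_ZQLE (hm : m ≠ 0) {n : ℕ} {p : Poly m} (hp : p ∈ ZQLE m n) :
    ∃ p₁ ∈ P0 m, ∃ p₂ ∈ PolyLE m n, p₁ ∈ PolyLE m n ∧ p = p₁ + dQ m p₂ := by
  obtain ⟨a, ha, q, hq, hpq⟩ := exists_eq_ofFormal_add_dQ hm hp.2 hp.1
  exact ⟨_, ofFormal_mem_P0 a, q, hq, ofFormal_mem_PolyLE ha, hpq⟩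

variable (m) in
/-- The map sending an element of the formal algebra to the cohomology class it represents. -/
noncomputable def classMap : FormalP0 →ₗ[ℂ] HQ m :=
  ((BQ m).submoduleOf (ZQ m)).mkQ ∘ₗ
    (ofFormal m).toLinearMap.codRestrict (ZQ m) (dQ_ofFormal m)

theorem classMap_injective (hm : m ≠ 0) : Function.Injective (classMap m) := by
  refine (injective_iff_map_eq_zero _).2 fun a ha => ?_
  obtain ⟨q, hq⟩ := (Submodule.Quotient.mk_eq_zero _).1 ha
  exact eq_zero_of_ofFormal_eq_dQ hm hq.symm

theorem classMap_surjective (hm : m ≠ 0) : Function.Surjective (classMap m) := by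
  intro x
  obtain ⟨⟨p, hp⟩, rfl⟩ := Submodule.Quotient.mk_surjective _ x
  obtain ⟨n, hn⟩ := exists_mem_PolyLE p
  obtain ⟨a, -, y, -, hpy⟩ := exists_eq_ofFormal_add_dQ hm hn hp
  refine ⟨a, (Submodule.Quotient.eq _).2 ⟨-y, ?_⟩⟩
  change dQ m (-y) = ofFormal m a - p
  rw [map_neg, hpy, sub_add_cancel_left]

theorem exists_equiv_HQ (hm : m ≠ 0) :
    ∃ e : FormalP0 ≃ₗ[ℂ] HQ m, ∀ a : FormalP0, ∃ h : ofFormal m a ∈ ZQ m,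
      e a = Submodule.Quotient.mk ⟨ofFormal m a, h⟩ :=
  ⟨LinearEquiv.ofBijective (classMap m) ⟨classMap_injective hm, classMap_surjective hm⟩,
    fun a => ⟨dQ_ofFormal m a, rfl⟩⟩

theorem ofFormal_mem_ZQLE {a : FormalP0} {n : ℤ} (ha : a ∈ FormalP0LE n) :
    ofFormal m a ∈ ZQLE m n :=
  ⟨dQ_ofFormal m a, ofFormal_mem_PolyLE ha⟩

theorem SQLE_le_ZQLE (n : ℤ) : SQLE m n ≤ ZQLE m n := by
  rintro _ ⟨hp, q, -, rfl⟩
  exact ⟨dQ_dQ m q, hp⟩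

variable (m) in
/-- The sum of the map `a ↦ [Ψ a]` on primary cocycles and of the inclusion of the classes of the
secondary ones. -/
noncomputable def classMapLE (n : ℤ) :
    (FormalP0LE n × (SQLE m n ⧸ (BQLE m n).submoduleOf (SQLE m n))) →ₗ[ℂ] HQLE m n :=
  (((BQLE m n).submoduleOf (ZQLE m n)).mkQ ∘ₗ
    ((ofFormal m).toLinearMap ∘ₗ (FormalP0LE n).subtype).codRestrict (ZQLE m n)
      fun a => ofFormal_mem_ZQLE a.2).coprod
  (((BQLE m n).submoduleOf (SQLE m n)).mapQ ((BQLE m n).submoduleOf (ZQLE m n))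
    (Submodule.inclusion (SQLE_le_ZQLE n)) fun _ hs => hs)

theorem classMapLE_mk {n : ℤ} (a : FormalP0LE n) (s : SQLE m n) :
    classMapLE m n (a, Submodule.Quotient.mk s) = Submodule.Quotient.mk
      ⟨ofFormal m a + s, Submodule.add_mem _ (ofFormal_mem_ZQLE a.2) (SQLE_le_ZQLE n s.2)⟩ :=
  rfl

theorem classMapLE_injective (hm : m ≠ 0) (n : ℤ) : Function.Injective (classMapLE m n) := by
  refine (injective_iff_map_eq_zero _).2 ?_
  rintro ⟨a, x⟩ hx
  obtain ⟨⟨s, hs⟩, rfl⟩ := Submodule.Quotient.mk_surjective _ x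
  obtain ⟨q, hq, hqs : dQ m q = ofFormal m a + s⟩ := (Submodule.Quotient.mk_eq_zero _).1 hx
  obtain ⟨-, r, -, rfl⟩ := hs
  obtain rfl : a = 0 := Subtype.ext <| eq_zero_of_ofFormal_eq_dQ hm (q := q - r) <| by
    rw [map_sub, hqs, add_sub_cancel_right]
  refine Prod.ext rfl ((Submodule.Quotient.mk_eq_zero _).2 ⟨q, hq, hqs.trans ?_⟩)
  rw [ZeroMemClass.coe_zero, map_zero, zero_add, Submodule.subtype_apply]

theorem classMapLE_surjective (hm : m ≠ 0) (n : ℕ) : Function.Surjective (classMapLE m n) := by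
  intro x
  obtain ⟨⟨p, hp⟩, rfl⟩ := Submodule.Quotient.mk_surjective _ x
  obtain ⟨a, ha, y, hy, rfl⟩ := exists_eq_ofFormal_add_dQ hm hp.2 hp.1
  have hs : dQ m y ∈ SQLE m n :=
    ⟨(Submodule.add_mem_iff_right _ (ofFormal_mem_PolyLE ha)).1 hp.2, y, hy, rfl⟩
  exact ⟨(⟨a, ha⟩, Submodule.Quotient.mk ⟨_, hs⟩), classMapLE_mk _ _⟩

theorem exists_equiv_HQLE (hm : m ≠ 0) (n : ℕ) :
    ∃ e : (FormalP0LE n × (SQLE m n ⧸ (BQLE m n).submoduleOf (SQLE m n))) ≃ₗ[ℂ] HQLE m n,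
      ∀ (a : FormalP0LE n) (s : SQLE m n),
        ∃ h : ofFormal m (a : FormalP0) + (s : Poly m) ∈ ZQLE m n,
          e (a, Submodule.Quotient.mk s) = Submodule.Quotient.mk ⟨_, h⟩ :=
  ⟨LinearEquiv.ofBijective (classMapLE m n)
      ⟨classMapLE_injective hm n, classMapLE_surjective hm n⟩,
    fun a s => ⟨_, classMapLE_mk a s⟩⟩

end Cohomology

end MassiveGauge

theorem mainTheorem4 (m : ℝ) (hm : 0 < m) :
    -- the traceless parts `F⁽⁰⁾` and `φ⁽⁰⁾` exist and are unique
    (∀ n : ℕ, ∃! T₀, MassiveGauge.IsTracelessPart (MassiveGauge.fieldStrength m n) T₀) ∧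
    (∀ n : ℕ, ∃! T₀, MassiveGauge.IsTracelessPart (MassiveGauge.phiTensor m (n + 1)) T₀) ∧
    -- every cocycle is cohomologous to an element of `𝒫₀`
    (∀ p ∈ MassiveGauge.ZQ m, ∃ p₀ ∈ MassiveGauge.P0 m, ∃ q : MassiveGauge.Poly m,
      p = p₀ + MassiveGauge.dQ m q) ∧
    -- the relations in `𝒫₀` are the Bianchi identities, and the quotient is the cohomology
    ∃ Ψ : MassiveGauge.FormalP0 →ₐ[ℂ] MassiveGauge.Poly m,
      (∀ s : MassiveGauge.Sym0, Ψ s.cls = s.val m) ∧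
      Function.Injective Ψ ∧
      Ψ.range = MassiveGauge.P0 m ∧
      (∃ e : MassiveGauge.FormalP0 ≃ₗ[ℂ] MassiveGauge.HQ m,
        ∀ a : MassiveGauge.FormalP0, ∃ h : Ψ a ∈ MassiveGauge.ZQ m,
          e a = Submodule.Quotient.mk ⟨Ψ a, h⟩) ∧
      -- the version filtered by the canonical dimension
      ∀ n : ℕ,
        (∀ p ∈ MassiveGauge.ZQLE m n, ∃ p₁ ∈ MassiveGauge.P0 m, ∃ p₂ ∈ MassiveGauge.PolyLE m n,
          p₁ ∈ MassiveGauge.PolyLE m n ∧ p = p₁ + MassiveGauge.dQ m p₂) ∧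
        ∃ e : (MassiveGauge.FormalP0LE n ×
            (MassiveGauge.SQLE m n ⧸ (MassiveGauge.BQLE m n).submoduleOf (MassiveGauge.SQLE m n)))
            ≃ₗ[ℂ] MassiveGauge.HQLE m n,
          ∀ (a : MassiveGauge.FormalP0LE n) (s : MassiveGauge.SQLE m n),
            ∃ h : Ψ (a : MassiveGauge.FormalP0) + (s : MassiveGauge.Poly m) ∈ MassiveGauge.ZQLE m n,
              e (a, Submodule.Quotient.mk s) = Submodule.Quotient.mk ⟨_, h⟩ := by
  have hm₀ : m ≠ 0 := hm.ne'
  refine ⟨fun n => MassiveGauge.existsUnique_isTracelessPart _,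
    fun n => MassiveGauge.existsUnique_isTracelessPart _,
    fun p hp => MassiveGauge.exists_eq_P0_add_dQ hm₀ hp, MassiveGauge.ofFormal m,
    MassiveGauge.ofFormal_cls m, MassiveGauge.ofFormal_injective hm₀, MassiveGauge.ofFormal_range m,
    MassiveGauge.exists_equiv_HQ hm₀, fun n => ⟨fun p hp => ?_,
      MassiveGauge.exists_equiv_HQLE hm₀ n⟩⟩
  exact MassiveGauge.exists_eq_P0_add_dQ_of_mem_ZQLE hm₀ hp
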